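/- **Setup.** For each $n$, let $n$ nodes $X_1,\dots,X_n$ be independent and uniform on $[0,1]\times[0,1]$, and let the source–destination pairs be $(i,\sigma(i))$, where $\sigma$ is uniformly distributed over the permutations of $\{1,\dots,n\}$ without fixed points and independent of the positions. Let the transmission range $d_n>0$ satisfy $\pi d_n^2=\frac{\log n+\xi_n}{n}$ for some $\xi_n\to\infty$. Every node simultaneously sends a separate, arbitrarily narrow beam to every node within (Euclidean) distance $d_n$: there is a directed link from $i$ to $j\ne i$ if $|X_i-X_j|\le d_n$ and there is no third node $k$ with $|X_k-X_j|\le d_n$ such that $X_i,X_k,X_j$ lie on a straight line. All links have the same fixed capacity $c>0$. The maximum stable throughput per node, $\lambda_n^*$, is the largest $\lambda$ for which there are flows $f_i(u,v)\ge 0$ $(1\le i\le n)$, supported on the links, with $\sum_i f_i(u,v)\le c$ for every link $(u,v)$, such that for each $i$ the net flow of commodity $i$ out of node $i$ is $\lambda$, and its net flow out of every node other than $i$ and $\sigma(i)$ is $0$; the total throughput is $n\lambda_n^*$. We say that $Y_n=\Theta(g_n)$ with probability tending to 1 if there are constants $c_1,c_2>0$ with $P(c_1g_n\le Y_n\le c_2g_n)\to1$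 as $n\to\infty$, and that $Y_n=\Omega(g_n)$ with probability tending to 1 if there is $c_1>0$ with $P(c_1g_n\le Y_n)\to1$. **Theorem.** 1. Suppose $(d_n)$ is bounded, and let $N_n$ be the number of links across the cut $x=\frac12$, i.e. links from a node in $[0,\frac12)\times[0,1]$ to a node in $[\frac12,1]\times[0,1]$. Then $E(N_n)=\Theta(n^2d_n^3)$, and $N_n=\Theta(n^2d_n^3)$ with probability tending to 1. 2. If the radius is of minimal order, $d_n=O(\sqrt{\log n/n})$, then $\lambda_n^*=\Theta\big(\log^{3/2}n/\sqrt n\big)$ with probability tending to 1. 3. The total throughput is linear, that is, $n\lambda_n^*=\Theta(n)$ with probability tending to 1, if and only if $d_n=\Theta(n^{-1/3})$. Moreover $n\lambda_n^*=\Omega(n)$ with probability tending to 1 if and only if $d_n=\Omega(n^{-1/3})$, so that $n^{-1/3}$ is the minimal order of such a radius. 4. If $n\lambda_n^*=\Theta(n)$ with probability tending to 1, then the number of beams of each node, i.e. the number of other nodes within distance $d_n$ of it, is $\Theta(n^{1/3})$ uniformly over all nodes: there are constants $c_1,c_2>0$ such that, with probability tending to 1, every node has between $c_1n^{1/3}$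 and $c_2n^{1/3}$ beams. -/

import Mathlib

open MeasureTheory Filter Topology Asymptotics

noncomputable section

namespace BeamNetwork

/-- The Euclidean plane. -/
abbrev Plane : Type := EuclideanSpace ℝ (Fin 2)

/-- The closed unit square `[0,1] × [0,1]`. -/
def unitSquare : Set Plane := {p | ∀ k, p k ∈ Set.Icc (0 : ℝ) 1}

/-- The law of `n` independent node positions, each uniform on the unit square
(which has area one). -/
def nodeLaw (n : ℕ) : Measure (Fin n → Plane) :=
  Measure.pi fun _ => volume.restrict unitSquare

instance permMeasurableSpace (n : ℕ) : MeasurableSpace (Equiv.Perm (Fin n)) := ⊤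

/-- The law of a random network: independent uniform node positions, and, independently of
them, a uniformly random assignment of destinations (node `i` sends to node `σ i`) in which
every node is the destination of exactly one other node. -/
def networkLaw (n : ℕ) : Measure ((Fin n → Plane) × Equiv.Perm (Fin n)) :=
  (nodeLaw n).prod (ProbabilityTheory.uniformOn (derangements (Fin n)))

/-- The radius condition for connectivity: `π d_n² = (log n + ξ_n) / n` with `ξ_n → ∞`. -/
def IsConnectivityRadius (d : ℕ → ℝ) : Prop :=
  ∃ ξ : ℕ → ℝ, Tendsto ξ atTop atTop ∧
    ∀ n : ℕ, 0 < n → Real.pi * d n ^ 2 = (Real.log n + ξ n) / n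

/-- The (directed) links when every node sends a separate, arbitrarily narrow beam to every
node within distance `r`. Node `j` decodes the message of node `i` provided that `i` is within
range and no other transmitter `k` in range of `j` lies on the straight line through `i`
and `j`. -/
def Link {n : ℕ} (X : Fin n → Plane) (r : ℝ) (i j : Fin n) : Prop :=
  i ≠ j ∧ dist (X i) (X j) ≤ r ∧
    ∀ k, k ≠ i → k ≠ j → dist (X k) (X j) ≤ r → ¬ Collinear ℝ {X i, X k, X j}

/-- The number of links that straddle the cut `x = 1/2`: transmitter in `[0,1/2) × [0,1]`,
receiver in `[1/2,1] × [0,1]`. -/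
def cutEdges {n : ℕ} (X : Fin n → Plane) (r : ℝ) : ℕ :=
  {e : Fin n × Fin n | X e.1 0 < 1 / 2 ∧ 1 / 2 ≤ X e.2 0 ∧ Link X r e.1 e.2}.ncard

/-- The number of beams of node `i`: one for each other node within its transmission range. -/
def beams {n : ℕ} (X : Fin n → Plane) (r : ℝ) (i : Fin n) : ℕ :=
  {j : Fin n | j ≠ i ∧ dist (X i) (X j) ≤ r}.ncard

/-- A feasible multicommodity flow with common rate `l`. Commodity `k` goes from node `k` to
node `σ k`, and `f k u v` is the amount of it sent along the link from `u` to `v`. Flows are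
nonnegative on directed links, so opposite flows of different commodities do not cancel in the
capacity constraint. -/
structure IsFeasibleFlow {n : ℕ} (link : Fin n → Fin n → Prop) (σ : Equiv.Perm (Fin n))
    (cap l : ℝ) (f : Fin n → Fin n → Fin n → ℝ) : Prop where
  nonneg : ∀ k u v, 0 ≤ f k u v
  support : ∀ k u v, ¬ link u v → f k u v = 0
  capacity : ∀ u v, ∑ k, f k u v ≤ cap
  conservation : ∀ k u, u ≠ k → u ≠ σ k → ∑ v, f k u v = ∑ v, f k v u
  rate : ∀ k, ∑ v, f k k v - ∑ v, f k v k = l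

/-- The maximum stable throughput per node: the optimal value of the multicommodity flow linear
program in which all sources inject at the same rate and each link has capacity `cap`. -/
def throughput {n : ℕ} (X : Fin n → Plane) (r : ℝ) (σ : Equiv.Perm (Fin n)) (cap : ℝ) : ℝ :=
  sSup {l | ∃ f, IsFeasibleFlow (Link X r) σ cap l f}

/-- `Y n = Θ(g n)` with probability tending to one as `n → ∞`. -/
def ThetaWHP {Ω : ℕ → Type*} [∀ n, MeasurableSpace (Ω n)] (P : ∀ n, Measure (Ω n))
    (Y : ∀ n, Ω n → ℝ) (g : ℕ → ℝ) : Prop :=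
  ∃ c₁ > 0, ∃ c₂ > 0,
    Tendsto (fun n => P n {ω | c₁ * g n ≤ Y n ω ∧ Y n ω ≤ c₂ * g n}) atTop (𝓝 1)

/-- `Y n = Ω(g n)` with probability tending to one as `n → ∞`. -/
def OmegaWHP {Ω : ℕ → Type*} [∀ n, MeasurableSpace (Ω n)] (P : ∀ n, Measure (Ω n))
    (Y : ∀ n, Ω n → ℝ) (g : ℕ → ℝ) : Prop :=
  ∃ c₁ > 0, Tendsto (fun n => P n {ω | c₁ * g n ≤ Y n ω}) atTop (𝓝 1)

/-- The total throughput `n λ_n` of the whole network of `n` nodes. -/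
def totalThroughput (d : ℕ → ℝ) (cap : ℝ) (n : ℕ)
    (ω : (Fin n → Plane) × Equiv.Perm (Fin n)) : ℝ :=
  n * throughput ω.1 (d n) ω.2 cap

end BeamNetwork

end

noncomputable section

namespace BeamNetwork

open scoped Classical

/-! Almost surely no three nodes are collinear (`ae_genPos`), so the interference condition is void
and a link is an ordered pair of distinct nodes at distance at most `d n`. What remains is a
max-flow estimate on a random geometric graph. Write `d` for the radius. The rate per node is at
most of order `n d³` at every connectivity radius, and it reaches this order at the two scales that
matter: `n^(-1/3)` and the minimal one.

Upper bound. Divide the square into tiles of side between `d/6` and `d/4`. Since `log n = O(n d²)`,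
Chernoff bounds show that every tile has `O(n d²)` nodes. A link across the cut starts in one of
`O(1/d)` tiles near the cut, and each node has `O(n d²)` partners, so there are `O(n² d³)` such
links (`whp_cutEdges_le`). By Chebyshev, at least `n/8` of the pairs have to cross from left to
right (`whp_crossCount`), and dividing the cut capacity among them gives `whp_throughput_le`.
Conversely, by Markov, in at least half of the rows both tiles touching the cut are well filled,
which gives the matching lower bound for the number of links (`many_good_rows`, `whp_cutEdges_ge`).

Lower bound at `n^(-1/3)`. The mean number `a` of nodes per tile is of order `n^(1/3)`, so all tiles
are well filled. Traffic follows the row of the source and then the column of the destination,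
spread evenly over all links between adjacent tiles. With `m` tiles per side, `O(m a)` commodities
share a row, each loading a link by `O(1/a²)`, so the rate `a/m`, of order `n d³`, is feasible
(`exists_feasibleFlow_of_full_tiles`).

Lower bound at minimal order. Now `a` is only of order `log n`, and some tiles may be poorly filled.
But `k` given tiles are all poor with probability at most `n^(-3)` for a suitable constant `k`, so
in every bounded window one of any `k` rows (or columns) is well filled. These rows and columns form
a grid that carries the traffic. A node without access to the grid can only communicate within a set
of nodes confined between good rows and columns; such a set would be an isolated cluster of extent
`O(d)`, and there is none (`whp_no_cluster`). Hence every node reaches the grid inside its own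
neighbourhood (`reach_hub`). The access load is `O(log n)` per link, which is negligible against the
grid load `1/(n d³)`.

Absence of clusters. The highest, lowest and leftmost nodes of a cluster force two half discs and a
rectangle to be empty: an area `π d²` plus a term growing with the extent of the cluster. Positions
are recorded on a grid of spacing about `1/(n d)`, fine enough to cost only a constant factor. The
extra area makes the sum over all relative positions converge, so the first moment is `O(exp(-ξ))`
in the interior. Near a side it is `O(exp(-ξ/2))`: half the area is compensated by the smaller
number of positions. At a corner it is a power of `n d²` times an exponentially small factor.

Conclusion. `SupportsRate` passes to larger radii. Thus a linear upper bound on the total throughput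
forces `d = O(n^(-1/3))`, and a linear lower bound forces `n d³` to be bounded below. At this radius
`n d²` is of order `n^(1/3)`, which is the number of beams by the tile counts (`whp_beams`). -/

/-- The uniform law on the unit square. -/
abbrev sq : Measure Plane := volume.restrict unitSquare

/-! ### Uniform points: areas of rectangles and product events -/

/-- A half-open coordinate rectangle. -/
def rect (x₀ x₁ y₀ y₁ : ℝ) : Set Plane := {p | p 0 ∈ Set.Ico x₀ x₁ ∧ p 1 ∈ Set.Ico y₀ y₁}

lemma measurable_coord (k : Fin 2) : Measurable fun p : Plane => p k := by fun_prop

lemma measurableSet_rect (x₀ x₁ y₀ y₁ : ℝ) : MeasurableSet (rect x₀ x₁ y₀ y₁) :=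
  (measurable_coord 0 measurableSet_Ico).inter (measurable_coord 1 measurableSet_Ico)

lemma volume_box (A B : Set ℝ) (hA : MeasurableSet A) (hB : MeasurableSet B) :
    volume {p : Plane | p 0 ∈ A ∧ p 1 ∈ B} = volume A * volume B := by
  have h := (PiLp.volume_preserving_ofLp (Fin 2)).measure_preimage
    (s := Set.pi Set.univ ![A, B]) (by
      refine (MeasurableSet.univ_pi ?_).nullMeasurableSet
      intro i; fin_cases i <;> simpa)
  rw [volume_pi_pi] at h
  simp only [Fin.prod_univ_two, Matrix.cons_val_zero, Matrix.cons_val_one] at h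
  rw [← h]
  congr 1
  ext p
  simp [Set.mem_pi, Fin.forall_fin_two]

lemma volume_rect (x₀ x₁ y₀ y₁ : ℝ) :
    volume (rect x₀ x₁ y₀ y₁) = ENNReal.ofReal (x₁ - x₀) * ENNReal.ofReal (y₁ - y₀) := by
  unfold rect
  rw [volume_box _ _ measurableSet_Ico measurableSet_Ico, Real.volume_Ico, Real.volume_Ico]

lemma measurableSet_unitSquare : MeasurableSet unitSquare := by
  have : unitSquare = ⋂ k, {p : Plane | p k ∈ Set.Icc (0:ℝ) 1} := by
    ext p; simp [unitSquare]
  rw [this]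
  exact MeasurableSet.iInter fun k => measurable_coord k measurableSet_Icc

lemma volume_unitSquare : volume unitSquare = 1 := by
  have : unitSquare = {p : Plane | p 0 ∈ Set.Icc (0:ℝ) 1 ∧ p 1 ∈ Set.Icc (0:ℝ) 1} := by
    ext p; simp only [unitSquare, Fin.forall_fin_two, Set.mem_ofPred_eq]
  rw [this, volume_box _ _ measurableSet_Icc measurableSet_Icc]
  simp

instance : IsProbabilityMeasure sq := ⟨by simp [volume_unitSquare]⟩

instance (n : ℕ) : IsProbabilityMeasure (nodeLaw n) := by unfold nodeLaw; infer_instance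

lemma sq_le_volume (A : Set Plane) : sq A ≤ volume A := Measure.restrict_apply_le _ _

lemma sq_of_subset {A : Set Plane} (h : A ⊆ unitSquare) : sq A = volume A :=
  Measure.restrict_eq_self _ h

lemma sq_real_of_subset {A : Set Plane} (h : A ⊆ unitSquare) : sq.real A = volume.real A := by
  simp [Measure.real, sq_of_subset h]

lemma rect_subset_unitSquare {x₀ x₁ y₀ y₁ : ℝ} (h₀ : 0 ≤ x₀) (h₁ : x₁ ≤ 1) (h₂ : 0 ≤ y₀)
    (h₃ : y₁ ≤ 1) : rect x₀ x₁ y₀ y₁ ⊆ unitSquare := by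
  intro p hp
  simp only [rect, Set.mem_ofPred_eq, Set.mem_Ico] at hp
  simp only [unitSquare, Fin.forall_fin_two, Set.mem_ofPred_eq, Set.mem_Icc]
  exact ⟨⟨by linarith, by linarith⟩, by linarith, by linarith⟩

lemma volume_real_rect {x₀ x₁ y₀ y₁ : ℝ} (hx : x₀ ≤ x₁) (hy : y₀ ≤ y₁) :
    volume.real (rect x₀ x₁ y₀ y₁) = (x₁ - x₀) * (y₁ - y₀) := by
  rw [Measure.real, volume_rect, ENNReal.toReal_mul, ENNReal.toReal_ofReal (by linarith),
    ENNReal.toReal_ofReal (by linarith)]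

lemma nodeLaw_box {n : ℕ} (A : Fin n → Set Plane) :
    (nodeLaw n).real {X | ∀ i, X i ∈ A i} = ∏ i, sq.real (A i) := by
  have : {X : Fin n → Plane | ∀ i, X i ∈ A i} = Set.pi Set.univ A := by ext; simp
  rw [this, Measure.real, nodeLaw, Measure.pi_pi, ENNReal.toReal_prod]
  rfl

lemma nodeLaw_finset_box {n : ℕ} (I : Finset (Fin n)) (A : Fin n → Set Plane) :
    (nodeLaw n).real {X | ∀ i ∈ I, X i ∈ A i} = ∏ i ∈ I, sq.real (A i) := by
  have : {X : Fin n → Plane | ∀ i ∈ I, X i ∈ A i}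
      = {X | ∀ i, X i ∈ (if i ∈ I then A i else Set.univ)} := by
    ext X
    simp only [Set.mem_ofPred_eq]
    refine forall_congr' fun i => ?_
    split_ifs with h <;> simp [h]
  rw [this, nodeLaw_box, ← Finset.prod_subset (Finset.subset_univ I)]
  · exact Finset.prod_congr rfl fun i hi => by rw [if_pos hi]
  · intro i _ hi
    rw [if_neg hi]; simp

/-! ### Exponential tail bounds for the number of nodes in a set -/

/-- The number of nodes in a set. -/
def cnt {n : ℕ} (X : Fin n → Plane) (A : Set Plane) : ℕ :=
  (Finset.univ.filter fun i => X i ∈ A).card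

/-- The product form lets the exponential moment factor over the independent nodes. -/
lemma exp_mul_cnt {n : ℕ} (X : Fin n → Plane) (A : Set Plane) (t : ℝ) :
    Real.exp (t * cnt X A) = ∏ i, (1 + A.indicator (fun _ => Real.exp t - 1) (X i)) := by
  have h1 : ∀ i, (1 + A.indicator (fun _ => Real.exp t - 1) (X i))
      = if X i ∈ A then Real.exp t else 1 := by
    intro i
    by_cases h : X i ∈ A <;> simp [h]
  simp_rw [h1]
  rw [Finset.prod_ite]
  simp [cnt, ← Real.exp_nat_mul, mul_comm]

lemma integral_exp_cnt {n : ℕ} {A : Set Plane} (hA : MeasurableSet A) (t : ℝ) :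
    ∫ X, Real.exp (t * cnt X A) ∂nodeLaw n = (1 + sq.real A * (Real.exp t - 1)) ^ n := by
  simp_rw [exp_mul_cnt]
  unfold nodeLaw
  rw [integral_fintype_prod_eq_prod (𝕜 := ℝ)
    (f := fun (_ : Fin n) (x : Plane) => 1 + A.indicator (fun _ => Real.exp t - 1) x)]
  rw [Finset.prod_const, Finset.card_univ, Fintype.card_fin]
  congr 1
  rw [integral_add (integrable_const _) ((integrable_const _).indicator hA),
    integral_indicator hA]
  simp [mul_comm]

lemma cnt_le {n : ℕ} (X : Fin n → Plane) (A : Set Plane) : cnt X A ≤ n :=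
  (Finset.card_filter_le _ _).trans (by simp)

lemma measurable_cnt {n : ℕ} {A : Set Plane} (hA : MeasurableSet A) :
    Measurable fun X : Fin n → Plane => (cnt X A : ℝ) := by
  have : (fun X : Fin n → Plane => (cnt X A : ℝ))
      = fun X => ∑ i, A.indicator (fun _ => (1:ℝ)) (X i) := by
    ext X
    simp [cnt, Set.indicator_apply]
  rw [this]
  refine Finset.measurable_sum _ fun i _ => ?_
  exact (measurable_const.indicator hA).comp (measurable_pi_apply i)

/-- Markov's inequality for `exp (t * cnt X A)`, with `1 + x ≤ exp x` applied to each factor. Both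
signs of `t` are used. -/
lemma exp_tail {n : ℕ} {A : Set Plane} (hA : MeasurableSet A) (t a : ℝ) :
    (nodeLaw n).real {X | a ≤ t * cnt X A}
      ≤ Real.exp (n * sq.real A * (Real.exp t - 1) - a) := by
  have hint : Integrable (fun X => Real.exp (t * cnt X A)) (nodeLaw n) := by
    refine Integrable.of_bound (C := Real.exp (|t| * n))
      ((Real.measurable_exp.comp ((measurable_cnt hA).const_mul t)).aestronglyMeasurable) ?_
    refine Eventually.of_forall fun X => ?_
    rw [Real.norm_eq_abs, Real.abs_exp]
    refine Real.exp_le_exp.2 ?_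
    refine (le_abs_self _).trans ?_
    rw [abs_mul]
    refine mul_le_mul_of_nonneg_left ?_ (abs_nonneg _)
    rw [Nat.abs_cast]
    exact_mod_cast cnt_le X A
  have h := mul_meas_ge_le_integral_of_nonneg
    (Eventually.of_forall fun X => (Real.exp_pos (t * cnt X A)).le) hint (Real.exp a)
  simp only [Real.exp_le_exp] at h
  rw [integral_exp_cnt hA] at h
  have hp : sq.real A ≤ 1 := measureReal_le_one
  have hp0 : 0 ≤ sq.real A := measureReal_nonneg
  have h2 : (1 + sq.real A * (Real.exp t - 1)) ^ n
      ≤ Real.exp (n * sq.real A * (Real.exp t - 1)) := by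
    rw [mul_assoc, Real.exp_nat_mul]
    refine pow_le_pow_left₀ ?_ ?_ n
    · nlinarith [Real.exp_pos t]
    · linarith [Real.add_one_le_exp (sq.real A * (Real.exp t - 1))]
  rw [Real.exp_sub, le_div_iff₀ (Real.exp_pos _), mul_comm]
  exact h.trans h2

/-- The choice `t = 1`, with `e - 1 ≤ 2`. -/
lemma upper_tail {n : ℕ} {A : Set Plane} (hA : MeasurableSet A) (a : ℝ) :
    (nodeLaw n).real {X | a ≤ cnt X A} ≤ Real.exp (2 * (n * sq.real A) - a) := by
  have h := exp_tail (n := n) hA 1 a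
  simp only [one_mul] at h
  refine h.trans (Real.exp_le_exp.2 ?_)
  have : Real.exp 1 - 1 ≤ 2 := by linarith [Real.exp_one_lt_d9]
  have h0 : 0 ≤ n * sq.real A := by positivity
  nlinarith

/-- The choice `t = -1`: since `1 / e - 1 ≤ -1/2`, the exponent is at most `-n v / 2 + n v / 4`. -/
lemma lower_tail {n : ℕ} {A : Set Plane} (hA : MeasurableSet A) {v : ℝ} (hv : v ≤ sq.real A) :
    (nodeLaw n).real {X | (cnt X A : ℝ) ≤ n * v / 4} ≤ Real.exp (-(n * v) / 4) := by
  have h := exp_tail (n := n) hA (-1) (-(n * v / 4))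
  have e : {X : Fin n → Plane | -(n * v / 4) ≤ -1 * (cnt X A : ℝ)}
      = {X | (cnt X A : ℝ) ≤ n * v / 4} := by
    ext X; simp only [Set.mem_ofPred_eq]; constructor <;> intro h <;> linarith
  rw [e] at h
  refine h.trans (Real.exp_le_exp.2 ?_)
  have h1 : Real.exp (-1) - 1 ≤ -1/2 := by linarith [Real.exp_neg_one_lt_d9]
  have h2 : (n:ℝ) * v ≤ n * sq.real A := by gcongr
  have h0 : 0 ≤ n * sq.real A := by positivity
  nlinarith

/-! ### Calculus of events of probability tending to one -/

/-- The event `G` holds with probability tending to one. -/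
def Whp {Ω : ℕ → Type*} [∀ n, MeasurableSpace (Ω n)] (P : ∀ n, Measure (Ω n))
    (G : ∀ n, Ω n → Prop) : Prop :=
  Tendsto (fun n => P n {ω | ¬ G n ω}) atTop (𝓝 0)

section Whp
variable {Ω : ℕ → Type*} [∀ n, MeasurableSpace (Ω n)] {P : ∀ n, Measure (Ω n)}
  {G H : ∀ n, Ω n → Prop}

lemma Whp.mono (hG : Whp P G) (h : ∀ᶠ n in atTop, ∀ ω, G n ω → H n ω) : Whp P H := by
  refine tendsto_of_tendsto_of_tendsto_of_le_of_le' tendsto_const_nhds hG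
    (Eventually.of_forall fun _ => zero_le) ?_
  filter_upwards [h] with n hn
  exact measure_mono fun ω hω hG => hω (hn ω hG)

lemma Whp.and (hG : Whp P G) (hH : Whp P H) : Whp P fun n ω => G n ω ∧ H n ω := by
  have := hG.add hH
  rw [add_zero] at this
  refine tendsto_of_tendsto_of_tendsto_of_le_of_le tendsto_const_nhds this
    (fun _ => zero_le) fun n => ?_
  refine (measure_mono ?_).trans (measure_union_le _ _)
  intro ω hω
  simp only [Set.mem_ofPred_eq, Set.mem_union] at *
  tauto

/-- Subadditivity of the outer measure suffices, so `G` need not be measurable. This is why `Whp`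
speaks of the complement: events such as throughput bounds are never shown to be measurable. -/
lemma Whp.tendsto_one [∀ n, IsProbabilityMeasure (P n)] (hG : Whp P G) :
    Tendsto (fun n => P n {ω | G n ω}) atTop (𝓝 1) := by
  have h1 : Tendsto (fun n => 1 - P n {ω | ¬ G n ω}) atTop (𝓝 (1 - 0)) :=
    ENNReal.Tendsto.sub tendsto_const_nhds hG (by simp)
  rw [tsub_zero] at h1
  refine tendsto_of_tendsto_of_tendsto_of_le_of_le h1 tendsto_const_nhds (fun n => ?_)
    fun n => prob_le_one
  rw [tsub_le_iff_right]
  rw [← measure_univ (μ := P n)]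
  refine (measure_mono ?_).trans (measure_union_le _ _)
  intro ω _
  simp only [Set.mem_ofPred_eq, Set.mem_union]
  tauto

/-- If `E n` missed `G n`, it would lie in a set of measure below `1/2`. This turns probabilistic
hypotheses on the throughput into deterministic bounds on the radius. -/
lemma Whp.eventually_exists {E : ∀ n, Set (Ω n)} (hG : Whp P G)
    (hE : Tendsto (fun n => P n (E n)) atTop (𝓝 1)) :
    ∀ᶠ n in atTop, ∃ ω ∈ E n, G n ω := by
  have h1 := hE.eventually (lt_mem_nhds (show (1/2 : ENNReal) < 1 by
    rw [one_div]; exact ENNReal.inv_lt_one.2 (by norm_num)))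
  have h2 := hG.eventually (gt_mem_nhds (show (0 : ENNReal) < 1/2 by simp))
  filter_upwards [h1, h2] with n h1 h2
  by_contra! hcon
  exact absurd (measure_mono (μ := P n) fun ω hω => hcon ω hω) (not_le.2 (h2.trans h1))

lemma whp_of_real_le [∀ n, IsFiniteMeasure (P n)] {b : ℕ → ℝ}
    (h : ∀ᶠ n in atTop, (P n).real {ω | ¬ G n ω} ≤ b n) (hb : Tendsto b atTop (𝓝 0)) :
    Whp P G := by
  have hb' := ENNReal.tendsto_ofReal hb
  rw [ENNReal.ofReal_zero] at hb'
  refine tendsto_of_tendsto_of_tendsto_of_le_of_le' tendsto_const_nhds hb'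
    (Eventually.of_forall fun _ => zero_le) ?_
  filter_upwards [h] with n hn
  rw [← ofReal_measureReal]
  exact ENNReal.ofReal_le_ofReal hn

lemma whp_of_ae (h : ∀ᶠ n in atTop, ∀ᵐ ω ∂P n, G n ω) : Whp P G := by
  refine tendsto_const_nhds.congr' ?_
  filter_upwards [h] with n hn
  exact (ae_iff.1 hn).symm

end Whp

/-! ### Null sets: boundary points, coincidences and collinear triples -/

/-- The open unit square. -/
def openSquare : Set Plane := {p | ∀ k, p k ∈ Set.Ioo (0 : ℝ) 1}

lemma ae_openSquare : ∀ᵐ p ∂sq, p ∈ openSquare := by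
  have hm : MeasurableSet openSquare := by
    have : openSquare = ⋂ k, {p : Plane | p k ∈ Set.Ioo (0:ℝ) 1} := by
      ext p; simp [openSquare]
    rw [this]
    exact MeasurableSet.iInter fun k => measurable_coord k measurableSet_Ioo
  have hv : volume openSquare = 1 := by
    have : openSquare = {p : Plane | p 0 ∈ Set.Ioo (0:ℝ) 1 ∧ p 1 ∈ Set.Ioo (0:ℝ) 1} := by
      ext p; simp only [openSquare, Fin.forall_fin_two, Set.mem_ofPred_eq]
    rw [this, volume_box _ _ measurableSet_Ioo measurableSet_Ioo]
    simp
  have h1 : sq openSquareᶜ = 0 := (prob_compl_eq_zero_iff hm).2 (by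
    rw [sq_of_subset]
    · exact hv
    · intro p hp k; exact ⟨(hp k).1.le, (hp k).2.le⟩)
  exact h1

lemma ae_forall_mem {n : ℕ} {A : Set Plane} (hA : ∀ᵐ p ∂sq, p ∈ A) :
    ∀ᵐ X ∂nodeLaw n, ∀ i, X i ∈ A := by
  rw [ae_all_iff]
  intro i
  exact (measurePreserving_eval (fun _ : Fin n => sq) i).quasiMeasurePreserving.ae hA

/-- Fubini, integrating over the position of node `k` first with the other nodes frozen. -/
lemma nodeLaw_null_of_update {n : ℕ} (k : Fin n) {B : Set (Fin n → Plane)} (hB : MeasurableSet B)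
    (h : ∀ X, sq {x | Function.update X k x ∈ B} = 0) : nodeLaw n B = 0 := by
  obtain ⟨m, rfl⟩ : ∃ m, n = m + 1 := ⟨n - 1, by have := k.pos; omega⟩
  have hp := (measurePreserving_piFinSuccAbove (fun _ : Fin (m + 1) => sq) k).symm
  rw [nodeLaw, ← hp.measure_preimage hB.nullMeasurableSet,
    Measure.prod_apply_symm (hp.measurable hB)]
  refine (lintegral_congr fun y => ?_).trans lintegral_zero
  rw [← h (k.insertNth (0 : Plane) y)]
  congr 1
  ext x
  simp [MeasurableEquiv.piFinSuccAbove, Fin.insertNthEquiv]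

lemma sq_singleton (p : Plane) : sq {p} = 0 :=
  le_antisymm ((sq_le_volume _).trans (by simp)) zero_le

lemma ae_injective (n : ℕ) : ∀ᵐ X ∂nodeLaw n, Function.Injective X := by
  have : ∀ i j : Fin n, i ≠ j → ∀ᵐ X ∂nodeLaw n, X i ≠ X j := by
    intro i j hij
    rw [ae_iff]
    refine nodeLaw_null_of_update i ?_ fun X => ?_
    · simp only [not_not]
      exact measurableSet_eq_fun (measurable_pi_apply i) (measurable_pi_apply j)
    · rw [← sq_singleton (X j)]
      congr 1
      ext x
      simp [hij.symm]
  have h2 : ∀ᵐ X ∂nodeLaw n, ∀ i j : Fin n, i ≠ j → X i ≠ X j := by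
    simp_rw [ae_all_iff]; exact this
  filter_upwards [h2] with X hX i j h
  by_contra hne
  exact hX i j hne h

/-- Twice the signed area of the triangle `a`, `b`, `c`. -/
def area2 (a b c : Plane) : ℝ := (b 0 - a 0) * (c 1 - a 1) - (b 1 - a 1) * (c 0 - a 0)

lemma area2_eq_zero_of_collinear {a b c : Plane} (h : Collinear ℝ {a, b, c}) :
    area2 a b c = 0 := by
  obtain ⟨v, hv⟩ := (collinear_iff_of_mem (p₀ := a) (by simp)).1 h
  obtain ⟨s, rfl⟩ := hv b (by simp)
  obtain ⟨t, rfl⟩ := hv c (by simp)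
  simp [area2]; ring

/-- The line through `a` and `c` is a translate of the kernel of a nonzero linear form, that is, of
a proper subspace. -/
lemma volume_area2_eq_zero {a c : Plane} (h : a ≠ c) :
    volume {x | area2 a x c = 0} = 0 := by
  let L : Plane →ₗ[ℝ] ℝ :=
    { toFun := fun x => x 0 * (c 1 - a 1) - x 1 * (c 0 - a 0)
      map_add' := by intro x y; simp; ring
      map_smul' := by intro t x; simp; ring }
  have hL : LinearMap.ker L ≠ ⊤ := by
    intro hk
    rw [LinearMap.ker_eq_top] at hk
    apply h
    have h0 := LinearMap.congr_fun hk (!₂[1, 0] : Plane)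
    have h1 := LinearMap.congr_fun hk (!₂[0, 1] : Plane)
    simp [L] at h0 h1
    ext k; fin_cases k <;> simp <;> linarith
  have e : {x | area2 a x c = 0} = (fun x => x - a) ⁻¹' (LinearMap.ker L : Set Plane) := by
    ext x
    simp [area2, L]
  rw [e, (measurePreserving_sub_right volume a).measure_preimage
    (Submodule.closed_of_finiteDimensional _).measurableSet.nullMeasurableSet]
  exact Measure.addHaar_submodule _ _ hL

/-- No three of the nodes lie on a line. -/
def GenPos {n : ℕ} (X : Fin n → Plane) : Prop :=
  ∀ i k j, k ≠ i → k ≠ j → i ≠ j → ¬ Collinear ℝ {X i, X k, X j}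

/-- With two distinct nodes fixed, a third one avoids the line through them almost surely. The
condition `X i ≠ X j` is kept inside the event so that Fubini applies to every frozen configuration.
-/
lemma ae_genPos (n : ℕ) : ∀ᵐ X ∂nodeLaw n, GenPos X := by
  have h1 : ∀ i k j : Fin n, k ≠ i → k ≠ j → i ≠ j →
      ∀ᵐ X ∂nodeLaw n, ¬ (area2 (X i) (X k) (X j) = 0 ∧ X i ≠ X j) := by
    intro i k j hi hj hij
    rw [ae_iff]
    refine nodeLaw_null_of_update k ?_ fun X => ?_
    · simp only [not_not]
      refine MeasurableSet.inter ?_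
        (measurableSet_eq_fun (measurable_pi_apply i) (measurable_pi_apply j)).compl
      refine measurableSet_eq_fun ?_ measurable_const
      unfold area2
      fun_prop
    · simp only [not_not, Set.mem_ofPred_eq, Function.update_self, Function.update_of_ne hi.symm,
        Function.update_of_ne hj.symm]
      by_cases h : X i = X j
      · simp [h]
      · refine le_antisymm ((sq_le_volume _).trans ?_) zero_le
        rw [← volume_area2_eq_zero h]
        exact measure_mono fun x hx => hx.1
  have h2 : ∀ᵐ X ∂nodeLaw n, ∀ i k j : Fin n, k ≠ i → k ≠ j → i ≠ j →
      ¬ (area2 (X i) (X k) (X j) = 0 ∧ X i ≠ X j) := by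
    simp_rw [ae_all_iff]; exact h1
  filter_upwards [h2, ae_injective n] with X hX hinj i k j hi hj hij hcol
  exact hX i k j hi hj hij ⟨area2_eq_zero_of_collinear hcol, hinj.ne hij⟩

/-- In general position links are symmetric and increase with the range; both fail for `Link` in
general. -/
lemma GenPos.link_iff {n : ℕ} {X : Fin n → Plane} (h : GenPos X) {r : ℝ} {i j : Fin n} :
    Link X r i j ↔ i ≠ j ∧ dist (X i) (X j) ≤ r :=
  ⟨fun hl => ⟨hl.1, hl.2.1⟩, fun hl => ⟨hl.1, hl.2, fun k hi hj _ => h i k j hi hj hl.1⟩⟩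

/-! ### Tiles and their occupation numbers -/

/-- The tile with index `(a, b)` in the division of the unit square into `m × m` tiles. -/
def tile (m a b : ℕ) : Set Plane :=
  rect ((a : ℝ) / m) (((a : ℝ) + 1) / m) ((b : ℝ) / m) (((b : ℝ) + 1) / m)

/-- The index of a point along the coordinate `k`, for tiles of side `1 / m`. -/
def cell (m : ℕ) (p : Plane) (k : Fin 2) : ℕ := ⌊(m : ℝ) * p k⌋₊

lemma measurableSet_tile (m a b : ℕ) : MeasurableSet (tile m a b) := measurableSet_rect _ _ _ _

lemma mem_tile_iff {m a b : ℕ} (hm : 0 < m) {p : Plane} (hp : p ∈ openSquare) :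
    p ∈ tile m a b ↔ cell m p 0 = a ∧ cell m p 1 = b := by
  have hm' : (0:ℝ) < m := by exact_mod_cast hm
  have key : ∀ k (c : ℕ), cell m p k = c ↔ p k ∈ Set.Ico ((c : ℝ) / m) (((c : ℝ) + 1) / m) := by
    intro k c
    rw [cell, Nat.floor_eq_iff (mul_nonneg hm'.le (hp k).1.le), Set.mem_Ico, div_le_iff₀ hm',
      lt_div_iff₀ hm', mul_comm]
  rw [key, key]
  rfl

lemma cell_lt {m : ℕ} (hm : 0 < m) {p : Plane} (hp : p ∈ openSquare) (k : Fin 2) :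
    cell m p k < m := by
  have hm' : (0:ℝ) < m := by exact_mod_cast hm
  rw [cell, Nat.floor_lt (mul_nonneg hm'.le (hp k).1.le)]
  nlinarith [(hp k).2]

lemma cell_le_mul {m : ℕ} {p : Plane} (hp : p ∈ openSquare) (k : Fin 2) :
    (cell m p k : ℝ) ≤ m * p k := Nat.floor_le (mul_nonneg (Nat.cast_nonneg _) (hp k).1.le)

lemma mul_lt_cell {m : ℕ} (p : Plane) (k : Fin 2) :
    m * p k < (cell m p k : ℝ) + 1 := Nat.lt_floor_add_one _

lemma sq_tile_le {m : ℕ} (hm : 0 < m) (a b : ℕ) : sq.real (tile m a b) ≤ 1 / (m : ℝ) ^ 2 := by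
  have hm' : (0:ℝ) < m := by exact_mod_cast hm
  have h1 : volume.real (tile m a b) = 1 / (m : ℝ) ^ 2 := by
    rw [tile, volume_real_rect]
    · field_simp; ring
    · gcongr; linarith
    · gcongr; linarith
  rw [← h1]
  refine ENNReal.toReal_mono ?_ (sq_le_volume _)
  rw [tile, volume_rect]
  exact ENNReal.mul_ne_top ENNReal.ofReal_ne_top ENNReal.ofReal_ne_top

lemma sq_tile {m a b : ℕ} (ha : a < m) (hb : b < m) :
    sq.real (tile m a b) = 1 / (m : ℝ) ^ 2 := by
  have hm' : (0:ℝ) < m := by exact_mod_cast (Nat.zero_le _).trans_lt ha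
  have ha' : (a:ℝ) + 1 ≤ m := by exact_mod_cast ha
  have hb' : (b:ℝ) + 1 ≤ m := by exact_mod_cast hb
  rw [tile, sq_real_of_subset, volume_real_rect]
  · field_simp; ring
  · gcongr; linarith
  · gcongr; linarith
  · refine rect_subset_unitSquare (by positivity) ?_ (by positivity) ?_
    · rwa [div_le_one hm']
    · rwa [div_le_one hm']

lemma disjoint_tile {m a b a' b' : ℕ} (h : (a, b) ≠ (a', b')) :
    Disjoint (tile m a b) (tile m a' b') := by
  rw [Set.disjoint_left]
  intro p hp hp'
  rcases Nat.eq_zero_or_pos m with rfl | hm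
  · simp [tile, rect] at hp
  have hm' : (0:ℝ) < m := by exact_mod_cast hm
  simp only [tile, rect, Set.mem_ofPred_eq, Set.mem_Ico, div_le_iff₀ hm', lt_div_iff₀ hm'] at hp hp'
  apply h
  have e1 : a = a' := by
    have h1 : (a:ℝ) < a' + 1 := by linarith
    have h2 : (a':ℝ) < a + 1 := by linarith
    norm_cast at h1 h2; omega
  have e2 : b = b' := by
    have h1 : (b:ℝ) < b' + 1 := by linarith
    have h2 : (b':ℝ) < b + 1 := by linarith
    norm_cast at h1 h2; omega
  rw [e1, e2]

lemma cnt_biUnion_le {n : ℕ} (X : Fin n → Plane) {ι : Type*} (F : Finset ι) (A : ι → Set Plane) :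
    cnt X (⋃ t ∈ F, A t) ≤ ∑ t ∈ F, cnt X (A t) := by
  unfold cnt
  refine (Finset.card_le_card ?_).trans Finset.card_biUnion_le
  intro i
  simp

/-- If all tiles of `F` are poor, so is their union, whose area is `F.card` times larger. The lower
tail of the union replaces any independence argument and gains the factor `F.card` in the exponent.
-/
lemma all_bad_le {n m : ℕ} (F : Finset (ℕ × ℕ)) (hF : ∀ t ∈ F, t.1 < m ∧ t.2 < m) :
    (nodeLaw n).real {X | ∀ t ∈ F, (cnt X (tile m t.1 t.2) : ℝ) < n / (m : ℝ) ^ 2 / 4}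
      ≤ Real.exp (-(F.card * (n / (m : ℝ) ^ 2)) / 4) := by
  have hA : MeasurableSet (⋃ t ∈ F, tile m t.1 t.2) :=
    Finset.measurableSet_biUnion _ fun t _ => measurableSet_tile _ _ _
  have hv : sq.real (⋃ t ∈ F, tile m t.1 t.2) = F.card * (1 / (m : ℝ) ^ 2) := by
    rw [measureReal_biUnion_finset]
    · rw [Finset.sum_congr rfl fun t ht => sq_tile (hF t ht).1 (hF t ht).2]
      simp
    · intro t _ t' _ h
      exact disjoint_tile h
    · exact fun t _ => measurableSet_tile _ _ _
  have h := lower_tail (n := n) hA hv.ge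
  have e : (n : ℝ) * (F.card * (1 / (m : ℝ) ^ 2)) = F.card * (n / (m : ℝ) ^ 2) := by ring
  rw [e] at h
  refine le_trans (measureReal_mono ?_) h
  intro X hX
  simp only [Set.mem_ofPred_eq] at hX ⊢
  calc (cnt X (⋃ t ∈ F, tile m t.1 t.2) : ℝ) ≤ ∑ t ∈ F, (cnt X (tile m t.1 t.2) : ℝ) := by
        exact_mod_cast cnt_biUnion_le X F _
    _ ≤ ∑ t ∈ F, n / (m : ℝ) ^ 2 / 4 := Finset.sum_le_sum fun t ht => (hX t ht).le
    _ = _ := by rw [Finset.sum_const, nsmul_eq_mul]; ring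

/-- Every tile contains at most `u` nodes. -/
def TilesUpper {n : ℕ} (X : Fin n → Plane) (m : ℕ) (u : ℝ) : Prop :=
  ∀ a < m, ∀ b < m, (cnt X (tile m a b) : ℝ) ≤ u

/-- Among any `k` tiles in a window of `w × w` tiles, one contains at least `l` nodes. -/
def WindowsGood {n : ℕ} (X : Fin n → Plane) (m k w : ℕ) (l : ℝ) : Prop :=
  ∀ a < m, ∀ b < m, ∀ F ⊆ Finset.Ico a (a + w) ×ˢ Finset.Ico b (b + w), F.card = k →
    (∀ t ∈ F, t.1 < m ∧ t.2 < m) → ∃ t ∈ F, l ≤ cnt X (tile m t.1 t.2)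

lemma tilesUpper_compl_le {n m : ℕ} (hm : 0 < m) (u : ℝ) :
    (nodeLaw n).real {X | ¬ TilesUpper X m u}
      ≤ m ^ 2 * Real.exp (2 * (n / (m : ℝ) ^ 2) - u) := by
  have hsub : {X : Fin n → Plane | ¬ TilesUpper X m u}
      ⊆ ⋃ t ∈ Finset.range m ×ˢ Finset.range m, {X | u ≤ cnt X (tile m t.1 t.2)} := by
    intro X hX
    simp only [TilesUpper, Set.mem_ofPred_eq, not_forall, not_le] at hX
    obtain ⟨a, ha, b, hb, h⟩ := hX
    simp only [Set.mem_iUnion, Finset.mem_product, Finset.mem_range]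
    exact ⟨(a, b), ⟨ha, hb⟩, h.le⟩
  refine (measureReal_mono hsub (measure_ne_top _ _)).trans ((measureReal_biUnion_finset_le _ _).trans ?_)
  calc ∑ t ∈ Finset.range m ×ˢ Finset.range m, (nodeLaw n).real {X | u ≤ cnt X (tile m t.1 t.2)}
      ≤ ∑ t ∈ Finset.range m ×ˢ Finset.range m, Real.exp (2 * (n / (m : ℝ) ^ 2) - u) := by
        refine Finset.sum_le_sum fun t _ => (upper_tail (measurableSet_tile _ _ _) u).trans ?_
        refine Real.exp_le_exp.2 ?_
        have := mul_le_mul_of_nonneg_left (sq_tile_le hm t.1 t.2) (Nat.cast_nonneg (α := ℝ) n)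
        rw [mul_one_div] at this
        linarith
    _ = _ := by simp [pow_two]

/-- Union bound over the `m ^ 2` window positions and the at most `2 ^ (w * w)` sets of tiles in a
window. -/
lemma windowsGood_compl_le {n m k w : ℕ} :
    (nodeLaw n).real {X | ¬ WindowsGood X m k w (n / (m : ℝ) ^ 2 / 4)}
      ≤ m ^ 2 * (2 ^ (w * w) * Real.exp (-(k * (n / (m : ℝ) ^ 2)) / 4)) := by
  set W : ℕ × ℕ → Finset (ℕ × ℕ) := fun t =>
    Finset.Ico t.1 (t.1 + w) ×ˢ Finset.Ico t.2 (t.2 + w) with hW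
  have hsub : {X : Fin n → Plane | ¬ WindowsGood X m k w (n / (m : ℝ) ^ 2 / 4)}
      ⊆ ⋃ t ∈ Finset.range m ×ˢ Finset.range m,
        ⋃ F ∈ (W t).powerset.filter fun F => F.card = k ∧ ∀ t ∈ F, t.1 < m ∧ t.2 < m,
          {X | ∀ t ∈ F, (cnt X (tile m t.1 t.2) : ℝ) < n / (m : ℝ) ^ 2 / 4} := by
    intro X hX
    simp only [WindowsGood, Set.mem_ofPred_eq, not_forall, not_exists, not_and, not_le] at hX
    obtain ⟨a, ha, b, hb, F, hF, hk, hFm, h⟩ := hX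
    simp only [Set.mem_iUnion, Finset.mem_product, Finset.mem_range, Finset.mem_filter,
      Finset.mem_powerset]
    exact ⟨(a, b), ⟨ha, hb⟩, F, ⟨hF, hk, hFm⟩, h⟩
  refine (measureReal_mono hsub (measure_ne_top _ _)).trans ((measureReal_biUnion_finset_le _ _).trans ?_)
  calc _ ≤ ∑ t ∈ Finset.range m ×ˢ Finset.range m,
        2 ^ (w * w) * Real.exp (-(k * (n / (m : ℝ) ^ 2)) / 4) := by
        refine Finset.sum_le_sum fun t _ => (measureReal_biUnion_finset_le _ _).trans ?_
        calc _ ≤ ∑ F ∈ (W t).powerset.filter fun F => F.card = k ∧ ∀ t ∈ F, t.1 < m ∧ t.2 < m,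
              Real.exp (-(k * (n / (m : ℝ) ^ 2)) / 4) := by
              refine Finset.sum_le_sum fun F hF => ?_
              simp only [Finset.mem_filter] at hF
              rw [← hF.2.1]
              exact all_bad_le F hF.2.2
          _ ≤ _ := by
              rw [Finset.sum_const, nsmul_eq_mul]
              refine mul_le_mul_of_nonneg_right ?_ (Real.exp_pos _).le
              have h1 := Finset.card_filter_le (W t).powerset
                (fun F => F.card = k ∧ ∀ t ∈ F, t.1 < m ∧ t.2 < m)
              rw [Finset.card_powerset] at h1
              have h2 : (W t).card = w * w := by simp [hW]
              rw [h2] at h1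
              exact_mod_cast h1
    _ = _ := by simp [pow_two]

lemma tendsto_const_div_nat (c : ℝ) : Tendsto (fun n : ℕ => c / (n : ℝ)) atTop (𝓝 0) :=
  tendsto_const_div_atTop_nhds_zero_nat c

/-- For `n ≥ 3` one has `log n ≥ 1`, so the hypothesis bounds the number `m ^ 2` of tiles by `K *
n`. A failure probability `n ^ (-3)` per tile or window is then more than enough. -/
lemma mesh_sq_mul_exp_le {n m : ℕ} {K : ℝ} (hn : 3 ≤ n) (hm : 0 < m)
    (h : Real.log n ≤ K * (n / (m : ℝ) ^ 2)) {x : ℝ} (hx : x ≤ -3 * Real.log n) :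
    (m : ℝ) ^ 2 * Real.exp x ≤ K / n := by
  have hn' : (3:ℝ) ≤ n := by exact_mod_cast hn
  have hm' : (0:ℝ) < m := by exact_mod_cast hm
  have hlog : 1 ≤ Real.log n := by
    rw [Real.le_log_iff_exp_le (by linarith)]
    linarith [Real.exp_one_lt_d9]
  have h1 : (m : ℝ) ^ 2 ≤ K * n := by
    have := hlog.trans h
    rw [← mul_div_assoc, le_div_iff₀ (by positivity)] at this
    linarith
  have h2 : Real.exp x ≤ 1 / (n : ℝ) ^ 2 := by
    have : -3 * Real.log n ≤ -(2 * Real.log n) := by linarith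
    refine (Real.exp_le_exp.2 (hx.trans this)).trans ?_
    rw [Real.exp_neg, one_div]
    refine inv_anti₀ (by positivity) ?_
    have : (2:ℝ) * Real.log n = ((2:ℕ):ℝ) * Real.log n := by norm_num
    rw [this, Real.exp_nat_mul, Real.exp_log (by linarith)]
  calc (m : ℝ) ^ 2 * Real.exp x ≤ K * n * (1 / (n : ℝ) ^ 2) := by
        refine mul_le_mul h1 h2 (Real.exp_pos _).le ?_
        exact (by positivity : (0:ℝ) ≤ (m:ℝ)^2).trans h1
    _ = K / n := by field_simp

/-- The `2` cancels the exponential moment term of `upper_tail`; the `3 * K` leaves the exponent `-3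
* log n`. -/
lemma whp_tilesUpper {m : ℕ → ℕ} {K : ℝ} (hm : ∀ᶠ n in atTop, 0 < m n)
    (h : ∀ᶠ n : ℕ in atTop, Real.log n ≤ K * (n / (m n : ℝ) ^ 2)) :
    Whp nodeLaw fun n X => TilesUpper X (m n) ((2 + 3 * K) * (n / (m n : ℝ) ^ 2)) := by
  refine whp_of_real_le (b := fun n => K / n) ?_ (tendsto_const_div_nat K)
  filter_upwards [hm, h, eventually_ge_atTop 3] with n hm h hn
  refine (tilesUpper_compl_le hm _).trans (mesh_sq_mul_exp_le hn hm h ?_)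
  linarith

/-- With `12 * K ≤ k` the exponent `-k (n / m²) / 4` is at most `-3 * log n`. The window size `w` is
constant, so `2 ^ (w * w)` does no harm. -/
lemma whp_windowsGood {m : ℕ → ℕ} {K : ℝ} {k : ℕ} (w : ℕ) (hk : 12 * K ≤ k)
    (hm : ∀ᶠ n in atTop, 0 < m n)
    (h : ∀ᶠ n : ℕ in atTop, Real.log n ≤ K * (n / (m n : ℝ) ^ 2)) :
    Whp nodeLaw fun n X => WindowsGood X (m n) k w (n / (m n : ℝ) ^ 2 / 4) := by
  refine whp_of_real_le (b := fun n => 2 ^ (w * w) * K / n) ?_ (tendsto_const_div_nat _)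
  filter_upwards [hm, h, eventually_ge_atTop 3] with n hm h hn
  refine windowsGood_compl_le.trans ?_
  have h2 := mesh_sq_mul_exp_le hn hm h (x := -(k * (n / (m n : ℝ) ^ 2)) / 4) (by
    have : 12 * K * (n / (m n : ℝ) ^ 2) ≤ k * (n / (m n : ℝ) ^ 2) := by gcongr
    linarith)
  calc _ = 2 ^ (w * w) * ((m n : ℝ) ^ 2 * Real.exp (-(k * (n / (m n : ℝ) ^ 2)) / 4)) := by ring
    _ ≤ 2 ^ (w * w) * (K / n) := by gcongr
    _ = _ := by ring

/-! ### Mesh size, distances and quarter discs -/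

/-- A number of tiles per side, a multiple of `l`, for which the tiles have side about `r / 4`. -/
def mesh (l : ℕ) (r : ℝ) : ℕ := l * ⌈4 / (l * r)⌉₊

lemma mesh_ge {l : ℕ} (hl : 0 < l) {r : ℝ} (hr : 0 < r) : 4 / r ≤ mesh l r := by
  have hl' : (0:ℝ) < l := by exact_mod_cast hl
  rw [mesh, Nat.cast_mul]
  calc 4 / r = l * (4 / (l * r)) := by field_simp
    _ ≤ _ := by gcongr; exact Nat.le_ceil _

lemma mesh_le {l : ℕ} (hl : 0 < l) {r : ℝ} (hr : 0 < r) (h : l * r ≤ 2) :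
    (mesh l r : ℝ) ≤ 6 / r := by
  have hl' : (0:ℝ) < l := by exact_mod_cast hl
  rw [mesh, Nat.cast_mul]
  calc (l:ℝ) * ⌈4 / (l * r)⌉₊ ≤ l * (4 / (l * r) + 1) := by
        gcongr; exact (Nat.ceil_lt_add_one (by positivity)).le
    _ = 4 / r + l := by field_simp
    _ ≤ 4 / r + 2 / r := by gcongr; rwa [le_div_iff₀ hr]
    _ = 6 / r := by ring

lemma mesh_pos {l : ℕ} (hl : 0 < l) {r : ℝ} (hr : 0 < r) : 0 < mesh l r := by
  have := mesh_ge hl hr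
  have h2 : (0:ℝ) < mesh l r := lt_of_lt_of_le (by positivity) this
  exact_mod_cast h2

lemma dist_sq (x y : Plane) : dist x y ^ 2 = (x 0 - y 0) ^ 2 + (x 1 - y 1) ^ 2 := by
  rw [EuclideanSpace.dist_eq, Real.sq_sqrt (by positivity), Fin.sum_univ_two, Real.dist_eq,
    Real.dist_eq, sq_abs, sq_abs]

lemma dist_le_of_sq_le {x y : Plane} {r : ℝ} (hr : 0 ≤ r)
    (h : (x 0 - y 0) ^ 2 + (x 1 - y 1) ^ 2 ≤ r ^ 2) : dist x y ≤ r := by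
  rw [← dist_sq] at h
  exact le_of_sq_le_sq h hr

lemma abs_sub_le_dist (x y : Plane) (k : Fin 2) : |x k - y k| ≤ dist x y := by
  refine abs_le_of_sq_le_sq ?_ dist_nonneg
  rw [dist_sq]
  fin_cases k <;> simp <;> positivity

lemma dist_le_add (x y : Plane) : dist x y ≤ |x 0 - y 0| + |x 1 - y 1| := by
  refine dist_le_of_sq_le (by positivity) ?_
  rw [← sq_abs (x 0 - y 0), ← sq_abs (x 1 - y 1)]
  nlinarith [abs_nonneg (x 0 - y 0), abs_nonneg (x 1 - y 1)]

/-- The map of the plane acting on the two coordinates separately. -/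
def coordMap (f : Fin 2 → ℝ → ℝ) (z : Plane) : Plane := WithLp.toLp 2 fun k => f k (z k)

lemma measurePreserving_coordMap {f : Fin 2 → ℝ → ℝ} (hf : ∀ k, MeasurePreserving (f k)) :
    MeasurePreserving (coordMap f) :=
  (PiLp.volume_preserving_toLp (Fin 2)).comp
    ((volume_preserving_pi hf).comp (PiLp.volume_preserving_ofLp (Fin 2)))

/-- A quarter of an open disc, with the quadrant given by the signs `s` and `t`. -/
def quarter (s t c₀ c₁ ρ : ℝ) : Set Plane :=
  {z | 0 < s * (z 0 - c₀) ∧ 0 < t * (z 1 - c₁) ∧ (z 0 - c₀) ^ 2 + (z 1 - c₁) ^ 2 < ρ ^ 2}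

lemma measurableSet_quarter (s t c₀ c₁ ρ : ℝ) : MeasurableSet (quarter s t c₀ c₁ ρ) := by
  have h0 : Measurable fun z : Plane => s * (z 0 - c₀) := by fun_prop
  have h1 : Measurable fun z : Plane => t * (z 1 - c₁) := by fun_prop
  have h2 : Measurable fun z : Plane => (z 0 - c₀) ^ 2 + (z 1 - c₁) ^ 2 := by fun_prop
  exact (measurableSet_lt measurable_const h0).inter ((measurableSet_lt measurable_const h1).inter
    (measurableSet_lt h2 measurable_const))

lemma measurePreserving_affine {s : ℝ} (hs : s = 1 ∨ s = -1) (c : ℝ) :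
    MeasurePreserving fun x : ℝ => c + s * x := by
  rcases hs with rfl | rfl
  · simpa using measurePreserving_add_left volume c
  · simpa [sub_eq_add_neg] using Measure.measurePreserving_sub_left volume c

/-- Reflections and translations of the coordinates carry every quarter disc to the standard one, so
each has a quarter of the disc's area. -/
lemma volume_quarter_eq {s t : ℝ} (hs : s = 1 ∨ s = -1) (ht : t = 1 ∨ t = -1) (c₀ c₁ ρ : ℝ) :
    volume (quarter s t c₀ c₁ ρ) = volume (quarter 1 1 0 0 ρ) := by
  have h := measurePreserving_coordMap (f := ![fun x => c₀ + s * x, fun x => c₁ + t * x]) (by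
    intro k
    fin_cases k
    · exact measurePreserving_affine hs c₀
    · exact measurePreserving_affine ht c₁)
  rw [← h.measure_preimage (measurableSet_quarter s t c₀ c₁ ρ).nullMeasurableSet]
  congr 1
  ext z
  have e1 : s * s = 1 := by rcases hs with rfl | rfl <;> norm_num
  have e2 : t * t = 1 := by rcases ht with rfl | rfl <;> norm_num
  have e3 : s * (s * z 0) = z 0 := by rw [← mul_assoc, e1, one_mul]
  have e4 : t * (t * z 1) = z 1 := by rw [← mul_assoc, e2, one_mul]
  have e5 : (s * z 0) ^ 2 = z 0 ^ 2 := by rw [mul_pow, pow_two s, e1, one_mul]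
  have e6 : (t * z 1) ^ 2 = z 1 ^ 2 := by rw [mul_pow, pow_two t, e2, one_mul]
  simp [quarter, coordMap, e3, e4, e5, e6]

lemma volume_axis (k : Fin 2) : volume {z : Plane | z k = 0} = 0 := by
  fin_cases k
  · have : {z : Plane | z 0 = 0} = {z : Plane | z 0 ∈ ({0} : Set ℝ) ∧ z 1 ∈ Set.univ} := by
      ext; simp
    show volume {z : Plane | z 0 = 0} = 0
    rw [this, volume_box _ _ (measurableSet_singleton _) MeasurableSet.univ]
    simp
  · have : {z : Plane | z 1 = 0} = {z : Plane | z 0 ∈ Set.univ ∧ z 1 ∈ ({0} : Set ℝ)} := by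
      ext; simp
    show volume {z : Plane | z 1 = 0} = 0
    rw [this, volume_box _ _ MeasurableSet.univ (measurableSet_singleton _)]
    simp

lemma quarter_subset_ball (s t c₀ c₁ ρ : ℝ) (hρ : 0 ≤ ρ) :
    quarter s t c₀ c₁ ρ ⊆ Metric.closedBall (!₂[c₀, c₁] : Plane) ρ := by
  intro z hz
  exact dist_le_of_sq_le hρ (by simpa using hz.2.2.le)

lemma le_volume_quarter {s t : ℝ} (hs : s = 1 ∨ s = -1) (ht : t = 1 ∨ t = -1) (c₀ c₁ : ℝ) {ρ : ℝ}
    (hρ : 0 ≤ ρ) : Real.pi * ρ ^ 2 / 4 ≤ volume.real (quarter s t c₀ c₁ ρ) := by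
  have hfin : volume (quarter 1 1 0 0 ρ) ≠ ⊤ :=
    ((measure_mono (quarter_subset_ball 1 1 0 0 ρ hρ)).trans_lt measure_closedBall_lt_top).ne
  have hball : volume (Metric.ball (0 : Plane) ρ) ≤ 4 * volume (quarter 1 1 0 0 ρ) := by
    have hsub : Metric.ball (0 : Plane) ρ ⊆ (quarter 1 1 0 0 ρ ∪ quarter (-1) 1 0 0 ρ) ∪
        (quarter 1 (-1) 0 0 ρ ∪ quarter (-1) (-1) 0 0 ρ) ∪
        ({z | z 0 = 0} ∪ {z | z 1 = 0}) := by
      intro z hz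
      rw [Metric.mem_ball] at hz
      have h2 : (z 0) ^ 2 + (z 1) ^ 2 < ρ ^ 2 := by
        have := pow_lt_pow_left₀ hz dist_nonneg two_ne_zero
        rw [dist_sq] at this
        simpa using this
      simp only [quarter, Set.mem_union, Set.mem_ofPred_eq, sub_zero, one_mul, neg_mul,
        Left.neg_pos_iff, h2, and_true]
      rcases lt_trichotomy (z 0) 0 with h | h | h <;>
        rcases lt_trichotomy (z 1) 0 with h' | h' | h' <;> tauto
    refine (measure_mono hsub).trans ((measure_union_le _ _).trans ?_)
    have h0 : volume ({z : Plane | z 0 = 0} ∪ {z : Plane | z 1 = 0}) = 0 :=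
      measure_union_null (volume_axis 0) (volume_axis 1)
    rw [h0, add_zero]
    refine (measure_union_le _ _).trans ((add_le_add (measure_union_le _ _)
      (measure_union_le _ _)).trans ?_)
    rw [volume_quarter_eq (Or.inr rfl) (Or.inl rfl), volume_quarter_eq (Or.inl rfl) (Or.inr rfl),
      volume_quarter_eq (Or.inr rfl) (Or.inr rfl)]
    apply le_of_eq; ring
  rw [Measure.real, volume_quarter_eq hs ht]
  have h3 := ENNReal.toReal_mono (ENNReal.mul_ne_top (by norm_num) hfin) hball
  rw [EuclideanSpace.volume_ball_fin_two, ENNReal.toReal_mul, ENNReal.toReal_mul] at h3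
  simp only [ENNReal.toReal_pow, ENNReal.toReal_ofReal hρ, ENNReal.toReal_ofNat] at h3
  rw [ENNReal.toReal_ofReal Real.pi_pos.le] at h3
  linarith

lemma le_sq_quarter {s t : ℝ} (hs : s = 1 ∨ s = -1) (ht : t = 1 ∨ t = -1) {c₀ c₁ ρ : ℝ}
    (hρ : 0 ≤ ρ) (h0 : c₀ ∈ Set.Icc 0 1) (h0' : c₀ + s * ρ ∈ Set.Icc 0 1)
    (h1 : c₁ ∈ Set.Icc 0 1) (h1' : c₁ + t * ρ ∈ Set.Icc 0 1) :
    Real.pi * ρ ^ 2 / 4 ≤ sq.real (quarter s t c₀ c₁ ρ) := by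
  rw [sq_real_of_subset]
  · exact le_volume_quarter hs ht c₀ c₁ hρ
  · intro z hz
    have a0 : |z 0 - c₀| ≤ ρ := abs_le_of_sq_le_sq (by nlinarith [hz.2.2, sq_nonneg (z 1 - c₁)]) hρ
    have a1 : |z 1 - c₁| ≤ ρ := abs_le_of_sq_le_sq (by nlinarith [hz.2.2, sq_nonneg (z 0 - c₀)]) hρ
    rw [abs_le] at a0 a1
    have key : ∀ {u c s : ℝ}, (s = 1 ∨ s = -1) → 0 < s * (u - c) → -ρ ≤ u - c → u - c ≤ ρ →
        c ∈ Set.Icc (0:ℝ) 1 → c + s * ρ ∈ Set.Icc (0:ℝ) 1 → u ∈ Set.Icc (0:ℝ) 1 := by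
      intro u c s hs h1 h2 h3 h4 h5
      rcases hs with rfl | rfl
      · exact ⟨by linarith [h4.1], by linarith [h5.2]⟩
      · exact ⟨by linarith [h5.1], by linarith [h4.2]⟩
    intro k
    fin_cases k
    · exact key hs hz.1 a0.1 a0.2 h0 h0'
    · exact key ht hz.2.1 a1.1 a1.2 h1 h1'

lemma sq_real_union {A B : Set Plane} (h : Disjoint A B) (hB : MeasurableSet B) :
    sq.real (A ∪ B) = sq.real A + sq.real B := measureReal_union h hB

/-! ### Areas of the regions that a cluster forces to be empty -/

/-- The upper half disc as a union of two quarters. -/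
def upper (c₀ c₁ ρ : ℝ) : Set Plane := quarter 1 1 c₀ c₁ ρ ∪ quarter (-1) 1 c₀ c₁ ρ

/-- The lower half disc as a union of two quarters. -/
def lower (c₀ c₁ ρ : ℝ) : Set Plane := quarter 1 (-1) c₀ c₁ ρ ∪ quarter (-1) (-1) c₀ c₁ ρ

lemma measurableSet_upper (c₀ c₁ ρ : ℝ) : MeasurableSet (upper c₀ c₁ ρ) :=
  (measurableSet_quarter _ _ _ _ _).union (measurableSet_quarter _ _ _ _ _)

lemma measurableSet_lower (c₀ c₁ ρ : ℝ) : MeasurableSet (lower c₀ c₁ ρ) :=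
  (measurableSet_quarter _ _ _ _ _).union (measurableSet_quarter _ _ _ _ _)

lemma le_sq_upper {c₀ c₁ ρ : ℝ} (hρ : 0 ≤ ρ) (h0 : ρ ≤ c₀) (h0' : c₀ ≤ 1 - ρ) (h1 : 0 ≤ c₁)
    (h1' : c₁ ≤ 1 - ρ) : Real.pi * ρ ^ 2 / 2 ≤ sq.real (upper c₀ c₁ ρ) := by
  rw [upper, sq_real_union _ (measurableSet_quarter _ _ _ _ _)]
  · have := le_sq_quarter (s := 1) (t := 1) (Or.inl rfl) (Or.inl rfl) hρ (c₀ := c₀) (c₁ := c₁)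
      ⟨by linarith, by linarith⟩ ⟨by linarith, by linarith⟩ ⟨by linarith, by linarith⟩
      ⟨by linarith, by linarith⟩
    have := le_sq_quarter (s := -1) (t := 1) (Or.inr rfl) (Or.inl rfl) hρ (c₀ := c₀) (c₁ := c₁)
      ⟨by linarith, by linarith⟩ ⟨by linarith, by linarith⟩ ⟨by linarith, by linarith⟩
      ⟨by linarith, by linarith⟩
    linarith
  · rw [Set.disjoint_left]
    intro z h h'
    linarith [h.1, h'.1]

lemma le_sq_lower {c₀ c₁ ρ : ℝ} (hρ : 0 ≤ ρ) (h0 : ρ ≤ c₀) (h0' : c₀ ≤ 1 - ρ) (h1 : ρ ≤ c₁)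
    (h1' : c₁ ≤ 1) : Real.pi * ρ ^ 2 / 2 ≤ sq.real (lower c₀ c₁ ρ) := by
  rw [lower, sq_real_union _ (measurableSet_quarter _ _ _ _ _)]
  · have := le_sq_quarter (s := 1) (t := -1) (Or.inl rfl) (Or.inr rfl) hρ (c₀ := c₀) (c₁ := c₁)
      ⟨by linarith, by linarith⟩ ⟨by linarith, by linarith⟩ ⟨by linarith, by linarith⟩
      ⟨by linarith, by linarith⟩
    have := le_sq_quarter (s := -1) (t := -1) (Or.inr rfl) (Or.inr rfl) hρ (c₀ := c₀) (c₁ := c₁)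
      ⟨by linarith, by linarith⟩ ⟨by linarith, by linarith⟩ ⟨by linarith, by linarith⟩
      ⟨by linarith, by linarith⟩
    linarith
  · rw [Set.disjoint_left]
    intro z h h'
    linarith [h.1, h'.1]

lemma upper_gt {c₀ c₁ ρ : ℝ} {z : Plane} (h : z ∈ upper c₀ c₁ ρ) : c₁ < z 1 := by
  rcases h with h | h <;> linarith [h.2.1]

lemma lower_lt {c₀ c₁ ρ : ℝ} {z : Plane} (h : z ∈ lower c₀ c₁ ρ) : z 1 < c₁ := by
  rcases h with h | h <;> linarith [h.2.1]

lemma upper_sq {c₀ c₁ ρ : ℝ} {z : Plane} (h : z ∈ upper c₀ c₁ ρ) :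
    (z 0 - c₀) ^ 2 + (z 1 - c₁) ^ 2 < ρ ^ 2 := by
  rcases h with h | h <;> exact h.2.2

lemma lower_sq {c₀ c₁ ρ : ℝ} {z : Plane} (h : z ∈ lower c₀ c₁ ρ) :
    (z 0 - c₀) ^ 2 + (z 1 - c₁) ^ 2 < ρ ^ 2 := by
  rcases h with h | h <;> exact h.2.2

/-- An interval of radius `q` about a point of `[u, v]`, clipped to `[u, v]`, keeps at least length
`min (v - u) q`. This is the side of the extra rectangle that measures the extent of a cluster. -/
lemma min_le_clipped_length {u v y q : ℝ} (hu : u ≤ y) (hv : y ≤ v) (hq : 0 ≤ q) :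
    min (v - u) q ≤ min v (y + q) - max u (y - q) := by
  rcases min_cases v (y + q) with h | h <;> rcases max_cases u (y - q) with h' | h' <;>
    rcases min_cases (v - u) q with h'' | h'' <;> linarith

lemma le_sq_rect {x₀ x₁ y₀ y₁ a b : ℝ} (h₀ : 0 ≤ x₀) (h₁ : x₁ ≤ 1) (h₂ : 0 ≤ y₀)
    (h₃ : y₁ ≤ 1) (ha : 0 ≤ a) (hb : 0 ≤ b) (hx : a ≤ x₁ - x₀) (hy : b ≤ y₁ - y₀) :
    a * b ≤ sq.real (rect x₀ x₁ y₀ y₁) := by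
  rw [sq_real_of_subset (rect_subset_unitSquare h₀ h₁ h₂ h₃), volume_real_rect (by linarith)
    (by linarith)]
  exact mul_le_mul hx hy hb (ha.trans hx)

/-- The region forced to be empty by an isolated cluster away from the boundary, with highest
node near `(xi, Y₁)`, lowest node near `(xj, Y₀)` and leftmost node near `(xp, yp)`. -/
def innerRegion (ρ q xi Y₁ xj Y₀ xp yp : ℝ) : Set Plane :=
  (upper xi Y₁ ρ ∪ lower xj Y₀ ρ) ∪ rect (xp - q) xp (max Y₀ (yp - q)) (min Y₁ (yp + q))

/-- The region forced to be empty by an isolated cluster near the bottom side, with highest node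
near `(xi, Y₁)` and leftmost node near `(xp, yp)`. -/
def tallRegion (ρ q xi Y₁ xp yp : ℝ) : Set Plane :=
  upper xi Y₁ ρ ∪ rect (xp - q) xp (max 0 (yp - q)) (min Y₁ (yp + q))

/-- The region forced to be empty by an isolated cluster near the bottom side, with leftmost node
near `(xp, yp)`, rightmost node near `(xq, yq)` and highest node near `(xi, Y₁)`. -/
def wideRegion (ρ q xp yp xq yq xi Y₁ : ℝ) : Set Plane :=
  (quarter (-1) 1 xp yp ρ ∪ quarter 1 1 xq yq ρ) ∪
    rect (max xp (xi - q)) (min xq (xi + q)) Y₁ (Y₁ + q)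

lemma measurableSet_innerRegion (ρ q xi Y₁ xj Y₀ xp yp : ℝ) :
    MeasurableSet (innerRegion ρ q xi Y₁ xj Y₀ xp yp) :=
  ((measurableSet_upper _ _ _).union (measurableSet_lower _ _ _)).union (measurableSet_rect _ _ _ _)

lemma measurableSet_tallRegion (ρ q xi Y₁ xp yp : ℝ) :
    MeasurableSet (tallRegion ρ q xi Y₁ xp yp) :=
  (measurableSet_upper _ _ _).union (measurableSet_rect _ _ _ _)

lemma measurableSet_wideRegion (ρ q xp yp xq yq xi Y₁ : ℝ) :
    MeasurableSet (wideRegion ρ q xp yp xq yq xi Y₁) :=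
  ((measurableSet_quarter _ _ _ _ _).union (measurableSet_quarter _ _ _ _ _)).union
    (measurableSet_rect _ _ _ _)

/-- The half discs lie above `Y₁` and below `Y₀` and the rectangle between these levels, so the
three areas add up. The half discs alone have the area of a full disc, the critical value; the
rectangle gives the summability. -/
lemma le_sq_innerRegion {ρ q xi Y₁ xj Y₀ xp yp : ℝ} (hρ : 0 ≤ ρ) (hq : 0 ≤ q)
    (hi : ρ ≤ xi) (hi' : xi ≤ 1 - ρ) (hj : ρ ≤ xj) (hj' : xj ≤ 1 - ρ) (hY₁ : Y₁ ≤ 1 - ρ)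
    (hY₀ : ρ ≤ Y₀) (hp : q ≤ xp) (hp' : xp ≤ 1) (hy : Y₀ ≤ yp) (hy' : yp ≤ Y₁) :
    Real.pi * ρ ^ 2 + q * min (Y₁ - Y₀) q ≤ sq.real (innerRegion ρ q xi Y₁ xj Y₀ xp yp) := by
  rw [innerRegion, sq_real_union _ (measurableSet_rect _ _ _ _),
    sq_real_union _ (measurableSet_lower _ _ _)]
  · have h1 := le_sq_upper hρ hi hi' (c₁ := Y₁) (by linarith) hY₁
    have h2 := le_sq_lower hρ hj hj' hY₀ (by linarith)
    have h3 := le_sq_rect (x₀ := xp - q) (x₁ := xp) (y₀ := max Y₀ (yp - q)) (y₁ := min Y₁ (yp + q))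
      (a := q) (b := min (Y₁ - Y₀) q) (by linarith) hp' (le_max_of_le_left (by linarith))
      (min_le_of_left_le (by linarith)) hq (le_min (by linarith) hq) (by linarith)
      (min_le_clipped_length hy hy' hq)
    linarith
  · rw [Set.disjoint_left]
    intro z h h'
    linarith [upper_gt h, lower_lt h']
  · rw [Set.disjoint_left]
    rintro z (h | h) h'
    · linarith [upper_gt h, h'.2.2, min_le_left Y₁ (yp + q)]
    · linarith [lower_lt h, h'.2.1, le_max_left Y₀ (yp - q)]

lemma le_sq_tallRegion {ρ q xi Y₁ xp yp : ℝ} (hρ : 0 ≤ ρ) (hq : 0 ≤ q)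
    (hi : ρ ≤ xi) (hi' : xi ≤ 1 - ρ) (hY₁ : Y₁ ≤ 1 - ρ)
    (hp : q ≤ xp) (hp' : xp ≤ 1) (hy : 0 ≤ yp) (hy' : yp ≤ Y₁) :
    Real.pi * ρ ^ 2 / 2 + q * min Y₁ q ≤ sq.real (tallRegion ρ q xi Y₁ xp yp) := by
  rw [tallRegion, sq_real_union _ (measurableSet_rect _ _ _ _)]
  · have h1 := le_sq_upper hρ hi hi' (c₁ := Y₁) (by linarith) hY₁
    have h4 := min_le_clipped_length hy hy' hq
    rw [sub_zero] at h4
    have h3 := le_sq_rect (x₀ := xp - q) (x₁ := xp) (y₀ := max 0 (yp - q)) (y₁ := min Y₁ (yp + q))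
      (a := q) (b := min Y₁ q) (by linarith) hp' (le_max_of_le_left (by linarith))
      (min_le_of_left_le (by linarith)) hq (le_min (by linarith) hq) (by linarith) h4
    linarith
  · rw [Set.disjoint_left]
    rintro z h h'
    linarith [upper_gt h, h'.2.2, min_le_left Y₁ (yp + q)]

/-- Near the bottom side only upward quadrants are sure to stay in the square. The quarters lie left
of `xp` and right of `xq`, the rectangle between these abscissas. -/
lemma le_sq_wideRegion {ρ q xp yp xq yq xi Y₁ : ℝ} (hρ : 0 ≤ ρ) (hq : 0 ≤ q)
    (hp : ρ ≤ xp) (hq' : xq ≤ 1 - ρ) (hyp : 0 ≤ yp) (hyp' : yp ≤ 1 - ρ) (hyq : 0 ≤ yq)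
    (hyq' : yq ≤ 1 - ρ) (hi : xp ≤ xi) (hi' : xi ≤ xq) (hY : 0 ≤ Y₁) (hY' : Y₁ + q ≤ 1) :
    Real.pi * ρ ^ 2 / 2 + q * min (xq - xp) q
      ≤ sq.real (wideRegion ρ q xp yp xq yq xi Y₁) := by
  rw [wideRegion, sq_real_union _ (measurableSet_rect _ _ _ _),
    sq_real_union _ (measurableSet_quarter _ _ _ _ _)]
  · have h1 := le_sq_quarter (s := -1) (t := 1) (Or.inr rfl) (Or.inl rfl) hρ (c₀ := xp) (c₁ := yp)
      ⟨by linarith, by linarith⟩ ⟨by linarith, by linarith⟩ ⟨by linarith, by linarith⟩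
      ⟨by linarith, by linarith⟩
    have h2 := le_sq_quarter (s := 1) (t := 1) (Or.inl rfl) (Or.inl rfl) hρ (c₀ := xq) (c₁ := yq)
      ⟨by linarith, by linarith⟩ ⟨by linarith, by linarith⟩ ⟨by linarith, by linarith⟩
      ⟨by linarith, by linarith⟩
    have h3 := le_sq_rect (x₀ := max xp (xi - q)) (x₁ := min xq (xi + q)) (y₀ := Y₁)
      (y₁ := Y₁ + q) (a := min (xq - xp) q) (b := q) (le_max_of_le_left (by linarith))
      (min_le_of_left_le (by linarith)) hY hY' (le_min (by linarith) hq) hq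
      (min_le_clipped_length hi hi' hq) (by linarith)
    linarith
  · rw [Set.disjoint_left]
    intro z h h'
    linarith [h.1, h'.1]
  · rw [Set.disjoint_left]
    rintro z (h | h) h'
    · linarith [h.1, h'.1.1, le_max_left xp (xi - q)]
    · linarith [h.1, h'.1.2, min_le_left xq (xi + q)]

/-- Replacing a node by a grid point moves it by at most `μ` in each coordinate, hence by less than
`2 * μ` when `μ > 0`. Shrinking the radius by `2 * μ` keeps the disc within range of the true node.
-/
lemma dist_le_of_mem_disc {μ r c₀ c₁ : ℝ} {x z : Plane} (hμ : 0 ≤ μ) (hr : 2 * μ ≤ r)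
    (h0 : |x 0 - c₀| ≤ μ) (h1 : |x 1 - c₁| ≤ μ)
    (hz : (z 0 - c₀) ^ 2 + (z 1 - c₁) ^ 2 < (r - 2 * μ) ^ 2) : dist z x ≤ r := by
  refine dist_le_of_sq_le (by linarith) ?_
  have e0 : |z 0 - x 0| ≤ |z 0 - c₀| + μ := by
    have : z 0 - x 0 = (z 0 - c₀) - (x 0 - c₀) := by ring
    rw [this]; exact (abs_sub _ _).trans (by linarith)
  have e1 : |z 1 - x 1| ≤ |z 1 - c₁| + μ := by
    have : z 1 - x 1 = (z 1 - c₁) - (x 1 - c₁) := by ring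
    rw [this]; exact (abs_sub _ _).trans (by linarith)
  rw [← sq_abs (z 0 - x 0), ← sq_abs (z 1 - x 1)]
  rw [← sq_abs (z 0 - c₀), ← sq_abs (z 1 - c₁)] at hz
  set u := |z 0 - c₀|
  set v := |z 1 - c₁|
  have hu : 0 ≤ u := abs_nonneg _
  have hv : 0 ≤ v := abs_nonneg _
  have s0 : |z 0 - x 0| ^ 2 ≤ (u + μ) ^ 2 := by gcongr
  have s1 : |z 1 - x 1| ^ 2 ≤ (v + μ) ^ 2 := by gcongr
  have huv : u + v ≤ 2 * (r - 2 * μ) := by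
    refine le_of_sq_le_sq ?_ (by linarith)
    linarith [sq_nonneg (u - v), add_sq u v, sub_sq u v, mul_pow (2:ℝ) (r - 2 * μ) 2,
      sq_nonneg (r - 2 * μ)]
  have huv' := mul_le_mul_of_nonneg_left huv hμ
  linarith [add_sq u μ, add_sq v μ, sub_sq r (2 * μ), sq_nonneg μ]

lemma dist_le_of_mem_rect {μ r c₀ c₁ : ℝ} {x z : Plane} (hr : 4 * μ ≤ r)
    (h0 : |x 0 - c₀| ≤ μ) (h1 : |x 1 - c₁| ≤ μ)
    (hz0 : |z 0 - c₀| ≤ r / 4) (hz1 : |z 1 - c₁| ≤ r / 4) : dist z x ≤ r := by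
  refine (dist_le_add _ _).trans ?_
  have : z 0 - x 0 = (z 0 - c₀) - (x 0 - c₀) := by ring
  have e0 : |z 0 - x 0| ≤ r / 4 + μ := by
    rw [this]; exact (abs_sub _ _).trans (by linarith)
  have : z 1 - x 1 = (z 1 - c₁) - (x 1 - c₁) := by ring
  have e1 : |z 1 - x 1| ≤ r / 4 + μ := by
    rw [this]; exact (abs_sub _ _).trans (by linarith)
  linarith

/-! ### First moment bounds for empty regions -/

/-- Some node lies in `Q` and no other node lies in `R`. -/
def Witness {n : ℕ} (X : Fin n → Plane) (Q R : Set Plane) : Prop :=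
  ∃ i, X i ∈ Q ∧ ∀ k, k ≠ i → X k ∉ R

/-- Independence of one node and the other `n - 1`, with `1 - x ≤ exp (-x)`. The `1` in the exponent
pays for `n - 1` in place of `n`, as the area of `R` is at most one. -/
lemma witness_le {n : ℕ} {Q R : Set Plane} (hR : MeasurableSet R) {v A : ℝ}
    (hv : sq.real Q ≤ v) (hA : A ≤ sq.real R) :
    (nodeLaw n).real {X | Witness X Q R} ≤ n * (v * Real.exp (1 - n * A)) := by
  have hsub : {X : Fin n → Plane | Witness X Q R}
      ⊆ ⋃ i ∈ (Finset.univ : Finset (Fin n)), {X | ∀ k, X k ∈ if k = i then Q else Rᶜ} := by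
    rintro X ⟨i, hi, hk⟩
    simp only [Finset.mem_univ, Set.iUnion_true, Set.mem_iUnion]
    refine ⟨i, fun k => ?_⟩
    split_ifs with h
    · rwa [h]
    · exact hk k h
  refine (measureReal_mono hsub (measure_ne_top _ _)).trans
    ((measureReal_biUnion_finset_le _ _).trans ?_)
  have key : ∀ i : Fin n, (nodeLaw n).real {X | ∀ k, X k ∈ if k = i then Q else Rᶜ}
      ≤ v * Real.exp (1 - n * A) := by
    intro i
    rw [nodeLaw_box, ← Finset.mul_prod_erase _ _ (Finset.mem_univ i), if_pos rfl,
      Finset.prod_congr rfl fun k hk => by rw [if_neg (Finset.ne_of_mem_erase hk)],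
      Finset.prod_const, Finset.card_erase_of_mem (Finset.mem_univ i), Finset.card_univ,
      Fintype.card_fin, measureReal_compl hR]
    have hR1 : sq.real R ≤ 1 := measureReal_le_one
    have hv0 : 0 ≤ v := measureReal_nonneg.trans hv
    refine mul_le_mul hv ?_ (by simp [hR1]) hv0
    have hn : ((n - 1 : ℕ) : ℝ) = n - 1 := by
      rw [Nat.cast_sub (by have := i.pos; omega)]; simp
    have h1 : sq.real Set.univ - sq.real R ≤ Real.exp (-sq.real R) := by
      have := Real.add_one_le_exp (-sq.real R)
      rw [probReal_univ]
      linarith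
    refine (pow_le_pow_left₀ (by simp [hR1]) h1 _).trans ?_
    rw [← Real.exp_nat_mul, hn]
    refine Real.exp_le_exp.2 ?_
    have := mul_le_mul_of_nonneg_left hA (Nat.cast_nonneg (α := ℝ) n)
    nlinarith
  refine (Finset.sum_le_sum fun i _ => key i).trans ?_
  simp

/-- The index box used to record the positions of extreme nodes relative to each other. -/
def offsets (f : ℕ) : Finset (Fin 4 → ℕ) := Fintype.piFinset fun _ => Finset.range (2 * f + 5)

/-- A witness occurs for some member of a family of pairs of sets. -/
def WitnessFamily {α : Type*} (P : Finset α) (F : ℕ) (A : ℕ → ℝ)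
    (Q R : α → ℕ → (Fin 4 → ℕ) → Set Plane) {n : ℕ} (X : Fin n → Plane) : Prop :=
  ∃ a ∈ P, ∃ f < F, ∃ g ∈ offsets f, A f ≤ sq.real (R a f g) ∧ Witness X (Q a f g) (R a f g)

/-- The area condition is part of `WitnessFamily`, so parameters whose region sticks out of the
square contribute nothing and need no case analysis here. -/
lemma witnessFamily_le {α : Type*} (P : Finset α) (F : ℕ) (A : ℕ → ℝ)
    (Q R : α → ℕ → (Fin 4 → ℕ) → Set Plane) {n : ℕ} (hR : ∀ a f g, MeasurableSet (R a f g))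
    {v : ℝ} (hv : ∀ a f g, sq.real (Q a f g) ≤ v) :
    (nodeLaw n).real {X | WitnessFamily P F A Q R X}
      ≤ P.card * ∑ f ∈ Finset.range F, (2 * f + 5 : ℝ) ^ 4 * (n * (v * Real.exp (1 - n * A f))) := by
  have hsub : {X : Fin n → Plane | WitnessFamily P F A Q R X}
      ⊆ ⋃ a ∈ P, ⋃ f ∈ Finset.range F, ⋃ g ∈ offsets f,
        {X | A f ≤ sq.real (R a f g) ∧ Witness X (Q a f g) (R a f g)} := by
    rintro X ⟨a, ha, f, hf, g, hg, h⟩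
    simp only [Set.mem_iUnion, Finset.mem_range]
    exact ⟨a, ha, f, hf, g, hg, h⟩
  refine (measureReal_mono hsub (measure_ne_top _ _)).trans
    ((measureReal_biUnion_finset_le _ _).trans ?_)
  rw [← nsmul_eq_mul, ← Finset.sum_const]
  refine Finset.sum_le_sum fun a ha => (measureReal_biUnion_finset_le _ _).trans ?_
  refine Finset.sum_le_sum fun f hf => (measureReal_biUnion_finset_le _ _).trans ?_
  have hcard : ((offsets f).card : ℝ) = (2 * f + 5 : ℝ) ^ 4 := by
    simp [offsets]
  rw [← hcard, ← nsmul_eq_mul, ← Finset.sum_const]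
  refine Finset.sum_le_sum fun g _ => ?_
  by_cases h : A f ≤ sq.real (R a f g)
  · simp only [h, true_and]
    exact witness_le (hR a f g) (hv a f g) h
  · simp only [h, false_and]
    have hv1 : 0 ≤ v := measureReal_nonneg.trans (hv a f g)
    have : {X : Fin n → Plane | False} = ∅ := by ext; simp
    rw [this, measureReal_empty]
    positivity

/-- The first exponential gives a convergent series. The second does not depend on `f`, but there
are only `O(L)` terms, so it contributes `O(L ^ 5 * exp (-L / 16))`. -/
lemma exists_offset_sum_bound (c : ℝ) (hc : 0 ≤ c) : ∃ C : ℝ, 0 ≤ C ∧ ∀ (L : ℝ) (F : ℕ), 1 ≤ L →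
    (F : ℝ) ≤ c * L → ∑ f ∈ Finset.range F, (2 * f + 5 : ℝ) ^ 4 *
      (Real.exp (-((f : ℝ) + 1) / 8) + Real.exp (-L / 16)) ≤ C := by
  have hsum : Summable fun f : ℕ => ((f:ℝ) + 1) ^ 4 * Real.exp (-((f : ℝ) + 1) / 8) := by
    have h := Real.summable_pow_mul_exp_neg_nat_mul 4 (r := 1/8) (by norm_num)
    have h2 := (summable_nat_add_iff 1).2 h
    refine h2.congr fun f => ?_
    push_cast
    congr 2
    ring
  refine ⟨625 * (∑' f : ℕ, ((f:ℝ) + 1) ^ 4 * Real.exp (-((f : ℝ) + 1) / 8))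
    + (7 * (c + 1)) ^ 5 * (16 ^ 5 * 120), ?_, ?_⟩
  · have : 0 ≤ ∑' f : ℕ, ((f:ℝ) + 1) ^ 4 * Real.exp (-((f : ℝ) + 1) / 8) :=
      tsum_nonneg fun f => by positivity
    positivity
  intro L F hL hF
  simp only [mul_add, Finset.sum_add_distrib]
  refine add_le_add ?_ ?_
  · refine le_trans ?_ (mul_le_mul_of_nonneg_left
      (hsum.sum_le_tsum (Finset.range F) fun f _ => by positivity) (by norm_num))
    rw [Finset.mul_sum]
    refine Finset.sum_le_sum fun f _ => ?_
    rw [← mul_assoc]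
    refine mul_le_mul_of_nonneg_right ?_ (Real.exp_pos _).le
    have : (2 * f + 5 : ℝ) ≤ 5 * (f + 1) := by
      have : (0:ℝ) ≤ f := Nat.cast_nonneg f
      linarith
    calc (2 * f + 5 : ℝ) ^ 4 ≤ (5 * (f + 1)) ^ 4 := by gcongr
      _ = _ := by ring
  · have h1 : ∀ f ∈ Finset.range F, (2 * f + 5 : ℝ) ^ 4 * Real.exp (-L / 16)
        ≤ (7 * ((c + 1) * L)) ^ 4 * Real.exp (-L / 16) := by
      intro f hf
      have : (f : ℝ) ≤ F := by exact_mod_cast (Finset.mem_range.1 hf).le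
      refine mul_le_mul_of_nonneg_right ?_ (Real.exp_pos _).le
      refine pow_le_pow_left₀ (by positivity) ?_ 4
      nlinarith
    refine (Finset.sum_le_sum h1).trans ?_
    rw [Finset.sum_const, Finset.card_range, nsmul_eq_mul]
    have h2 : (L / 16) ^ 5 / 120 ≤ Real.exp (L / 16) := by
      have := Real.pow_div_factorial_le_exp (L / 16) (by linarith) 5
      simpa [Nat.factorial] using this
    have h3 : L ^ 5 * Real.exp (-L / 16) ≤ 16 ^ 5 * 120 := by
      rw [neg_div, Real.exp_neg, ← div_eq_mul_inv, div_le_iff₀ (Real.exp_pos _)]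
      have : L ^ 5 = 16 ^ 5 * 120 * ((L / 16) ^ 5 / 120) := by ring
      rw [this]
      gcongr
    have h4 : (F : ℝ) ≤ 7 * ((c + 1) * L) := by nlinarith
    calc (F : ℝ) * ((7 * ((c + 1) * L)) ^ 4 * Real.exp (-L / 16))
        ≤ (7 * ((c + 1) * L)) * ((7 * ((c + 1) * L)) ^ 4 * Real.exp (-L / 16)) := by gcongr
      _ = (7 * (c + 1)) ^ 5 * (L ^ 5 * Real.exp (-L / 16)) := by ring
      _ ≤ (7 * (c + 1)) ^ 5 * (16 ^ 5 * 120) := by gcongr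
      _ = _ := by ring

/-- The exponential of the minimum is at most the sum of the two exponentials. Since `N ≤ 2 n r`,
one cell of extent gains at least `1/8` in the exponent. -/
lemma offset_sum_le {n N : ℕ} {r A₀ C v : ℝ} {F : ℕ} (hN : 0 < N)
    (hNr : (N : ℝ) ≤ 2 * (n * r)) (hv : 0 ≤ v)
    (hC : ∑ f ∈ Finset.range F, (2 * f + 5 : ℝ) ^ 4 *
      (Real.exp (-((f : ℝ) + 1) / 8) + Real.exp (-(n * r ^ 2) / 16)) ≤ C) :
    ∑ f ∈ Finset.range F, (2 * f + 5 : ℝ) ^ 4 *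
      (n * (v * Real.exp (1 - n * (A₀ + r / 4 * min (((f : ℝ) + 1) / N) (r / 4)))))
      ≤ n * v * Real.exp (1 - n * A₀) * C := by
  refine le_trans ?_ (mul_le_mul_of_nonneg_left hC (by positivity))
  rw [Finset.mul_sum]
  refine Finset.sum_le_sum fun f _ => ?_
  have key : Real.exp (1 - n * (A₀ + r / 4 * min (((f : ℝ) + 1) / N) (r / 4)))
      ≤ Real.exp (1 - n * A₀) * (Real.exp (-((f : ℝ) + 1) / 8) + Real.exp (-(n * r ^ 2) / 16)) := by
    have e : 1 - n * (A₀ + r / 4 * min (((f : ℝ) + 1) / N) (r / 4))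
        = (1 - n * A₀) + -(n * (r / 4 * min (((f : ℝ) + 1) / N) (r / 4))) := by ring
    rw [e, Real.exp_add]
    refine mul_le_mul_of_nonneg_left ?_ (Real.exp_pos _).le
    have hN' : (0:ℝ) < N := by exact_mod_cast hN
    rcases min_cases (((f : ℝ) + 1) / N) (r / 4) with h | h <;> rw [h.1]
    · refine le_add_of_le_of_nonneg (Real.exp_le_exp.2 ?_) (Real.exp_pos _).le
      have h2 : ((f:ℝ) + 1) / 8 ≤ n * (r / 4 * (((f : ℝ) + 1) / N)) := by
        have : n * (r / 4 * (((f : ℝ) + 1) / N)) = ((f:ℝ) + 1) / 8 * (2 * (n * r) / N) := by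
          ring
        rw [this]
        refine le_mul_of_one_le_right (by positivity) ?_
        rwa [one_le_div hN']
      linarith
    · refine le_add_of_nonneg_of_le (Real.exp_pos _).le (Real.exp_le_exp.2 ?_)
      apply le_of_eq; ring
  calc _ ≤ (2 * f + 5 : ℝ) ^ 4 * (n * (v * (Real.exp (1 - n * A₀) *
        (Real.exp (-((f : ℝ) + 1) / 8) + Real.exp (-(n * r ^ 2) / 16))))) := by gcongr
    _ = _ := by ring

/-! ### Isolated clusters and their extreme nodes -/

/-- A nonempty set of nodes of small extent, all other nodes being out of range of it. -/
structure IsCluster {n : ℕ} (X : Fin n → Plane) (r D : ℝ) (U : Finset (Fin n)) : Prop where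
  nonempty : U.Nonempty
  isolated : ∀ i ∈ U, ∀ j, j ∉ U → r < dist (X i) (X j)
  extent : ∀ i ∈ U, ∀ j ∈ U, ∀ k, |X i k - X j k| ≤ D * r

/-- The cells of the grid, in reals: the lower end of the cell of a coordinate. -/
lemma cell_div_le {N : ℕ} (hN : 0 < N) {p : Plane} (hp : p ∈ openSquare) (k : Fin 2) :
    (cell N p k : ℝ) / N ≤ p k := by
  have hN' : (0:ℝ) < N := by exact_mod_cast hN
  rw [div_le_iff₀ hN', mul_comm]; exact cell_le_mul hp k

lemma lt_cell_div {N : ℕ} (hN : 0 < N) (p : Plane) (k : Fin 2) :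
    p k < ((cell N p k : ℝ) + 1) / N := by
  have hN' : (0:ℝ) < N := by exact_mod_cast hN
  rw [lt_div_iff₀ hN', mul_comm]; exact mul_lt_cell p k

/-- Here `a` is the cell of the highest node and `f` the height of the cluster in cells. Horizontal
offsets may be negative, so they are stored in `g` shifted by `f + 2`. Extremes are rounded
outwards, which keeps the cluster itself off the region. -/
def innerR (N : ℕ) (r : ℝ) (a : ℕ × ℕ) (f : ℕ) (g : Fin 4 → ℕ) : Set Plane :=
  innerRegion (r - 2 * (1 / N)) (r / 4) ((a.1 : ℝ) / N) (((a.2 : ℝ) + 1) / N)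
    (((a.1 : ℝ) + g 0 - (f + 2)) / N) (((a.2 : ℝ) - f) / N)
    (((a.1 : ℝ) + g 1 - (f + 2)) / N) (((a.2 : ℝ) - f + g 2) / N)

/-- The row of the highest node is `f` itself, counted from the bottom side. Only the column `a` is
free, so side clusters have `N` positions instead of `N ^ 2`. -/
def tallR (N : ℕ) (r : ℝ) (a : ℕ) (f : ℕ) (g : Fin 4 → ℕ) : Set Plane :=
  tallRegion (r - 2 * (1 / N)) (r / 4) ((a : ℝ) / N) (((f : ℝ) + 1) / N)
    (((a : ℝ) + g 0 - (f + 2)) / N) ((g 1 : ℝ) / N)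

/-- Here `a` is the column of the leftmost node and `f` the width in cells. The rows of the three
extreme nodes, counted from the bottom side, are among the offsets `g`. -/
def wideR (N : ℕ) (r : ℝ) (a : ℕ) (f : ℕ) (g : Fin 4 → ℕ) : Set Plane :=
  wideRegion (r - 2 * (1 / N)) (r / 4) ((a : ℝ) / N) (((g 0 : ℝ) + 1) / N)
    (((a : ℝ) + f + 1) / N) (((g 1 : ℝ) + 1) / N) (((a : ℝ) + g 2) / N) (((g 3 : ℝ) + 1) / N)

def cornerR (N : ℕ) (r : ℝ) (a : ℕ × ℕ) : Set Plane :=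
  quarter 1 1 ((a.1 : ℝ) / N) (((a.2 : ℝ) + 1) / N) (r - 2 * (1 / N))

/-- The area bound for the forced empty regions. -/
def areaBound (N : ℕ) (r A₀ : ℝ) (f : ℕ) : ℝ :=
  A₀ + r / 4 * min (((f : ℝ) + 1) / N) (r / 4)

/-- The event containing the presence of an isolated cluster, up to symmetry. -/
def ClusterEvent (N : ℕ) (r : ℝ) (F : ℕ) {n : ℕ} (X : Fin n → Plane) : Prop :=
  WitnessFamily (Finset.range N ×ˢ Finset.range N) F
      (areaBound N r (Real.pi * (r - 2 * (1 / N)) ^ 2))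
      (fun a _ _ => tile N a.1 a.2) (innerR N r) X ∨
    WitnessFamily (Finset.range N) F (areaBound N r (Real.pi * (r - 2 * (1 / N)) ^ 2 / 2))
      (fun a f _ => tile N a f) (tallR N r) X ∨
    WitnessFamily (Finset.range N) F (areaBound N r (Real.pi * (r - 2 * (1 / N)) ^ 2 / 2))
      (fun a _ g => tile N a (g 0)) (wideR N r) X ∨
    ∃ a ∈ Finset.range F ×ˢ Finset.range F,
      Real.pi * (r - 2 * (1 / N)) ^ 2 / 4 ≤ sq.real (cornerR N r a) ∧
      Witness X (tile N a.1 a.2) (cornerR N r a)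

section Extremes

variable {n N F : ℕ} {X : Fin n → Plane} {r D : ℝ} {U : Finset (Fin n)}

lemma IsCluster.not_mem_of_dist_le (hU : IsCluster X r D U) {i k : Fin n} (hi : i ∈ U)
    (hk : k ∉ U) : ¬ dist (X k) (X i) ≤ r := by
  rw [dist_comm]; exact not_le.2 (hU.isolated i hi k hk)

lemma abs_sub_cell (hN : 0 < N) {p : Plane} (hp : p ∈ openSquare) (k : Fin 2) :
    |p k - (cell N p k : ℝ) / N| ≤ 1 / N := by
  have h1 := cell_div_le hN hp k
  have h2 := lt_cell_div hN p k
  rw [add_div] at h2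
  rw [abs_le]; constructor <;> linarith [show (0:ℝ) ≤ 1 / N by positivity]

lemma abs_sub_cell_succ (hN : 0 < N) {p : Plane} (hp : p ∈ openSquare) (k : Fin 2) :
    |p k - ((cell N p k : ℝ) + 1) / N| ≤ 1 / N := by
  have h1 := cell_div_le hN hp k
  have h2 := lt_cell_div hN p k
  rw [add_div] at h2 ⊢
  rw [abs_le]; constructor <;> linarith [show (0:ℝ) ≤ 1 / N by positivity]

lemma cell_mono {p p' : Plane} {k : Fin 2} (h : p k ≤ p' k) : cell N p k ≤ cell N p' k :=
  Nat.floor_mono (by gcongr)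

lemma mem_offsets {f g₀ g₁ g₂ g₃ : ℕ} (h₀ : g₀ < 2 * f + 5) (h₁ : g₁ < 2 * f + 5)
    (h₂ : g₂ < 2 * f + 5) (h₃ : g₃ < 2 * f + 5) : ![g₀, g₁, g₂, g₃] ∈ offsets f := by
  rw [offsets, Fintype.mem_piFinset]
  intro k
  rw [Finset.mem_range]
  fin_cases k <;> assumption

/-- If two coordinates differ by at most the difference of two others, so do the cells, up to
rounding. -/
lemma cell_sub_le (hX : ∀ i, X i ∈ openSquare) {i j k l : Fin n} {c c' : Fin 2}
    (h : X i c - X j c ≤ X k c' - X l c') :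
    cell N (X i) c + cell N (X l) c' < cell N (X j) c + cell N (X k) c' + 2 := by
  have h1 := cell_le_mul (m := N) (hX i) c
  have h2 := mul_lt_cell (m := N) (X j) c
  have h3 := mul_lt_cell (m := N) (X k) c'
  have h4 := cell_le_mul (m := N) (hX l) c'
  have h5 : (N : ℝ) * (X i c - X j c) ≤ N * (X k c' - X l c') := by gcongr
  have : (cell N (X i) c + cell N (X l) c' : ℝ) < cell N (X j) c + cell N (X k) c' + 2 := by
    linarith
  exact_mod_cast this

/-- No node of `U` lies in the region by extremality, and no other node by isolation. The hypotheses
`hwj`, `hwp` bound the horizontal offsets by the height, so that the single parameter `f` controls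
both the number of offsets and the extra area. -/
lemma inner_event (hX : ∀ i, X i ∈ openSquare) (hU : IsCluster X r D U) (hN : 0 < N)
    (hμ : 4 * (1 / (N : ℝ)) ≤ r) (hF : N * (D * r) + 1 ≤ F) {i j p : Fin n} (hi : i ∈ U)
    (hj : j ∈ U) (hp : p ∈ U) (htop : ∀ k ∈ U, X k 1 ≤ X i 1) (hbot : ∀ k ∈ U, X j 1 ≤ X k 1)
    (hleft : ∀ k ∈ U, X p 0 ≤ X k 0) (hwj : |X i 0 - X j 0| ≤ X i 1 - X j 1)
    (hwp : |X i 0 - X p 0| ≤ X i 1 - X j 1) (hin : ∀ k ∈ U, ∀ c, X k c ∈ Set.Icc r (1 - r)) :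
    WitnessFamily (Finset.range N ×ˢ Finset.range N) F
      (areaBound N r (Real.pi * (r - 2 * (1 / N)) ^ 2))
      (fun a _ _ => tile N a.1 a.2) (innerR N r) X := by
  have hN' : (0:ℝ) < N := by exact_mod_cast hN
  have hμ0 : (0:ℝ) < 1 / N := by positivity
  set a := cell N (X i) 0 with ha
  set b := cell N (X i) 1 with hb
  set aj := cell N (X j) 0 with haj
  set bj := cell N (X j) 1 with hbj
  set ap := cell N (X p) 0 with hap
  set bp := cell N (X p) 1 with hbp
  rw [abs_le] at hwj hwp
  -- Rounding to cells costs less than two units; this is the `2` in the shift `f + 2`.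
  have k1 : a + bj < aj + b + 2 := cell_sub_le hX hwj.2
  have k2 : aj + bj < a + b + 2 := cell_sub_le hX (by linarith [hwj.1])
  have k3 : a + bj < ap + b + 2 := cell_sub_le hX hwp.2
  have k4 : ap + bj < a + b + 2 := cell_sub_le hX (by linarith [hwp.1])
  have k5 : bj ≤ bp := cell_mono (hbot p hp)
  have k6 : bp ≤ b := cell_mono (htop p hp)
  have hbb : bj ≤ b := k5.trans k6
  obtain ⟨f, hf⟩ : ∃ f, b = bj + f := ⟨b - bj, by omega⟩
  obtain ⟨g0, hg0⟩ : ∃ g, aj + (f + 2) = a + g := ⟨aj + (f + 2) - a, by omega⟩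
  obtain ⟨g1, hg1⟩ : ∃ g, ap + (f + 2) = a + g := ⟨ap + (f + 2) - a, by omega⟩
  obtain ⟨g2, hg2⟩ : ∃ g, bp = bj + g := ⟨bp - bj, by omega⟩
  have rf : (b:ℝ) = bj + f := by exact_mod_cast hf
  have r0 : (aj:ℝ) + (f + 2) = a + g0 := by exact_mod_cast hg0
  have r1 : (ap:ℝ) + (f + 2) = a + g1 := by exact_mod_cast hg1
  have r2 : (bp:ℝ) = bj + g2 := by exact_mod_cast hg2
  have hR : innerR N r (a, b) f ![g0, g1, g2, 0] = innerRegion (r - 2 * (1 / N)) (r / 4)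
      ((a : ℝ) / N) (((b : ℝ) + 1) / N) ((aj : ℝ) / N) ((bj : ℝ) / N) ((ap : ℝ) / N)
      ((bp : ℝ) / N) := by
    have e0 : (a:ℝ) + g0 - (f + 2) = aj := by linarith
    have e1 : (a:ℝ) + g1 - (f + 2) = ap := by linarith
    have e2 : (b:ℝ) - f = bj := by linarith
    simp [innerR, e0, e1, e2, ← r2]
  have ci := cell_div_le hN (hX i)
  have ci' := fun c => lt_cell_div hN (X i) c
  have cj := cell_div_le hN (hX j)
  have cj' := fun c => lt_cell_div hN (X j) c
  have cp := cell_div_le hN (hX p)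
  have cp' := fun c => lt_cell_div hN (X p) c
  simp only [add_div] at ci' cj' cp'
  have cb : (b : ℝ) / N = bj / N + f / N := by rw [rf, add_div]
  refine ⟨(a, b), ?_, f, ?_, ![g0, g1, g2, 0], ?_, ?_, i, ?_, ?_⟩
  · simp only [Finset.mem_product, Finset.mem_range]
    exact ⟨cell_lt hN (hX i) 0, cell_lt hN (hX i) 1⟩
  · have h1 := cell_le_mul (m := N) (hX i) 1
    have h2 := mul_lt_cell (m := N) (X j) 1
    have h3 : X i 1 - X j 1 ≤ D * r := (le_abs_self _).trans (hU.extent i hi j hj 1)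
    have h4 : (N : ℝ) * (X i 1 - X j 1) ≤ N * (D * r) := by gcongr
    have : (f : ℝ) < F := by
      rw [← hb] at h1; rw [← hbj] at h2
      linarith
    exact_mod_cast this
  · exact mem_offsets (by omega) (by omega) (by omega) (by omega)
  · rw [hR, areaBound]
    have e : ((f : ℝ) + 1) / N = ((b : ℝ) + 1) / N - bj / N := by rw [rf]; ring
    rw [e]
    have h1 := hin i hi 0
    have h2 := hin i hi 1
    have h3 := hin j hj 0
    have h4 := hin j hj 1
    have h5 := hin p hp 0
    refine le_sq_innerRegion (by linarith) (by linarith) ?_ ?_ ?_ ?_ ?_ ?_ ?_ ?_ ?_ ?_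
    · linarith [ci' 0, h1.1]
    · linarith [ci 0, h1.2]
    · linarith [cj' 0, h3.1]
    · linarith [cj 0, h3.2]
    · rw [add_div]; linarith [ci 1, h2.2]
    · linarith [cj' 1, h4.1]
    · linarith [cp' 0, h5.1]
    · linarith [cp 0, h5.2]
    · gcongr
    · gcongr
      have : (bp : ℝ) ≤ b := by exact_mod_cast k6
      linarith
  · exact (mem_tile_iff hN (hX i)).2 ⟨rfl, rfl⟩
  · intro k _ hk
    rw [hR] at hk
    rcases hk with (hk | hk) | hk
    · have hkU : k ∉ U := fun h => by
        have := upper_gt hk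
        rw [add_div] at this
        linarith [htop k h, ci' 1]
      exact hU.not_mem_of_dist_le hi hkU (dist_le_of_mem_disc hμ0.le (by linarith)
        (abs_sub_cell hN (hX i) 0) (abs_sub_cell_succ hN (hX i) 1) (upper_sq hk))
    · have hkU : k ∉ U := fun h => by
        have := lower_lt hk
        linarith [hbot k h, cj 1]
      exact hU.not_mem_of_dist_le hj hkU (dist_le_of_mem_disc hμ0.le (by linarith)
        (abs_sub_cell hN (hX j) 0) (abs_sub_cell hN (hX j) 1) (lower_sq hk))
    · have hkU : k ∉ U := fun h => by
        linarith [hk.1.2, hleft k h, cp 0]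
      refine hU.not_mem_of_dist_le hp hkU (dist_le_of_mem_rect (by linarith)
        (abs_sub_cell hN (hX p) 0) (abs_sub_cell hN (hX p) 1) ?_ ?_)
      · rw [abs_le]; constructor <;> linarith [hk.1.1, hk.1.2]
      · rw [abs_le]
        constructor <;> linarith [hk.2.1, hk.2.2, min_le_right (((b:ℝ) + 1) / N) (bp / N + r / 4),
          le_max_right ((bj:ℝ) / N) (bp / N - r / 4)]

/-- As for `inner_event`, with the bottom side of the square in the role of the lowest node. -/
lemma tall_event (hX : ∀ i, X i ∈ openSquare) (hU : IsCluster X r D U) (hN : 0 < N)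
    (hμ : 4 * (1 / (N : ℝ)) ≤ r) {H : ℝ} (hF : N * H + 1 ≤ F) (hH : H ≤ 1 - r) {i p : Fin n}
    (hi : i ∈ U)
    (hp : p ∈ U) (htop : ∀ k ∈ U, X k 1 ≤ X i 1)
    (hleft : ∀ k ∈ U, X p 0 ≤ X k 0) (hiH : X i 1 ≤ H)
    (hwp : |X i 0 - X p 0| ≤ X i 1) (hin : ∀ k ∈ U, X k 0 ∈ Set.Icc r (1 - r)) :
    WitnessFamily (Finset.range N) F (areaBound N r (Real.pi * (r - 2 * (1 / N)) ^ 2 / 2))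
      (fun a f _ => tile N a f) (tallR N r) X := by
  have hN' : (0:ℝ) < N := by exact_mod_cast hN
  have hμ0 : (0:ℝ) < 1 / N := by positivity
  set a := cell N (X i) 0 with ha
  set f := cell N (X i) 1 with hf
  set ap := cell N (X p) 0 with hap
  set bp := cell N (X p) 1 with hbp
  rw [abs_le] at hwp
  have q1 := cell_le_mul (m := N) (hX i) 0
  have q2 := mul_lt_cell (m := N) (X i) 0
  have q3 := cell_le_mul (m := N) (hX p) 0
  have q4 := mul_lt_cell (m := N) (X p) 0
  have q5 := cell_le_mul (m := N) (hX i) 1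
  have q6 := mul_lt_cell (m := N) (X i) 1
  rw [← ha] at q1 q2
  rw [← hap] at q3 q4
  rw [← hf] at q5 q6
  have q7 : (N : ℝ) * (X i 0 - X p 0) ≤ N * X i 1 := by gcongr; exact hwp.2
  have q8 : (N : ℝ) * (X p 0 - X i 0) ≤ N * X i 1 := by gcongr; linarith [hwp.1]
  have k3 : a < ap + f + 2 := by
    have : (a : ℝ) < ap + f + 2 := by linarith
    exact_mod_cast this
  have k4 : ap < a + f + 2 := by
    have : (ap : ℝ) < a + f + 2 := by linarith
    exact_mod_cast this
  have k6 : bp ≤ f := cell_mono (htop p hp)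
  obtain ⟨g0, hg0⟩ : ∃ g, ap + (f + 2) = a + g := ⟨ap + (f + 2) - a, by omega⟩
  have r0 : (ap:ℝ) + (f + 2) = a + g0 := by exact_mod_cast hg0
  have hR : tallR N r a f ![g0, bp, 0, 0] = tallRegion (r - 2 * (1 / N)) (r / 4)
      ((a : ℝ) / N) (((f : ℝ) + 1) / N) ((ap : ℝ) / N) ((bp : ℝ) / N) := by
    have e0 : (a:ℝ) + g0 - (f + 2) = ap := by linarith
    simp [tallR, e0]
  have ci := cell_div_le hN (hX i)
  have ci' := fun c => lt_cell_div hN (X i) c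
  have cp := cell_div_le hN (hX p)
  have cp' := fun c => lt_cell_div hN (X p) c
  simp only [add_div] at ci' cp'
  refine ⟨a, ?_, f, ?_, ![g0, bp, 0, 0], ?_, ?_, i, ?_, ?_⟩
  · simp only [Finset.mem_range]
    exact cell_lt hN (hX i) 0
  · have h4 : (N : ℝ) * X i 1 ≤ N * H := by gcongr
    have : (f : ℝ) < F := by linarith
    exact_mod_cast this
  · exact mem_offsets (by omega) (by omega) (by omega) (by omega)
  · rw [hR, areaBound]
    have h1 := hin i hi
    have h5 := hin p hp
    refine le_sq_tallRegion (by linarith) (by linarith) ?_ ?_ ?_ ?_ ?_ ?_ ?_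
    · linarith [ci' 0, h1.1]
    · linarith [ci 0, h1.2]
    · rw [add_div]; linarith [ci 1]
    · linarith [cp' 0, h5.1]
    · linarith [cp 0, h5.2]
    · positivity
    · gcongr
      have : (bp : ℝ) ≤ f := by exact_mod_cast k6
      linarith
  · exact (mem_tile_iff hN (hX i)).2 ⟨rfl, rfl⟩
  · intro k _ hk
    rw [hR] at hk
    rcases hk with hk | hk
    · have hkU : k ∉ U := fun h => by
        have := upper_gt hk
        rw [add_div] at this
        linarith [htop k h, ci' 1]
      exact hU.not_mem_of_dist_le hi hkU (dist_le_of_mem_disc hμ0.le (by linarith)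
        (abs_sub_cell hN (hX i) 0) (abs_sub_cell_succ hN (hX i) 1) (upper_sq hk))
    · have hkU : k ∉ U := fun h => by
        linarith [hk.1.2, hleft k h, cp 0]
      refine hU.not_mem_of_dist_le hp hkU (dist_le_of_mem_rect (by linarith)
        (abs_sub_cell hN (hX p) 0) (abs_sub_cell hN (hX p) 1) ?_ ?_)
      · rw [abs_le]; constructor <;> linarith [hk.1.1, hk.1.2]
      · rw [abs_le]
        constructor <;> linarith [hk.2.1, hk.2.2, min_le_right (((f:ℝ) + 1) / N) (bp / N + r / 4),
          le_max_right (0:ℝ) (bp / N - r / 4)]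

/-- The complement of the tall case: by `hw` the width dominates all heights above the bottom side,
so the width in cells controls the offsets. -/
lemma wide_event (hX : ∀ i, X i ∈ openSquare) (hU : IsCluster X r D U) (hN : 0 < N)
    (hμ : 4 * (1 / (N : ℝ)) ≤ r) (hF : N * (D * r) + 1 ≤ F) {H : ℝ} (hH : H ≤ 1 - r)
    {p q i : Fin n} (hp : p ∈ U) (hq : q ∈ U) (hi : i ∈ U)
    (htop : ∀ k ∈ U, X k 1 ≤ X i 1) (hleft : ∀ k ∈ U, X p 0 ≤ X k 0)
    (hright : ∀ k ∈ U, X k 0 ≤ X q 0) (hiH : X i 1 ≤ H)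
    (hw : X i 1 ≤ X q 0 - X p 0) (hin : ∀ k ∈ U, X k 0 ∈ Set.Icc r (1 - r)) :
    WitnessFamily (Finset.range N) F (areaBound N r (Real.pi * (r - 2 * (1 / N)) ^ 2 / 2))
      (fun a _ g => tile N a (g 0)) (wideR N r) X := by
  have hN' : (0:ℝ) < N := by exact_mod_cast hN
  have hμ0 : (0:ℝ) < 1 / N := by positivity
  set a := cell N (X p) 0 with ha
  set bp := cell N (X p) 1 with hbp
  set aq := cell N (X q) 0 with haq
  set bq := cell N (X q) 1 with hbq
  set ai := cell N (X i) 0 with hai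
  set bi := cell N (X i) 1 with hbi
  have q1 := cell_le_mul (m := N) (hX p) 0
  have q2 := mul_lt_cell (m := N) (X p) 0
  have q3 := cell_le_mul (m := N) (hX q) 0
  have q4 := mul_lt_cell (m := N) (X q) 0
  have q5 := cell_le_mul (m := N) (hX i) 1
  rw [← ha] at q1 q2
  rw [← haq] at q3 q4
  rw [← hbi] at q5
  have q7 : (N : ℝ) * X i 1 ≤ N * (X q 0 - X p 0) := by gcongr
  have k1 : bp ≤ bi := cell_mono (htop p hp)
  have k2 : bq ≤ bi := cell_mono (htop q hq)
  have k3 : a ≤ ai := cell_mono (hleft i hi)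
  have k4 : ai ≤ aq := cell_mono (hright i hi)
  have k5 : bi + a < aq + 1 := by
    have : (bi : ℝ) + a < aq + 1 := by linarith
    exact_mod_cast this
  obtain ⟨f, hf⟩ : ∃ f, aq = a + f := ⟨aq - a, by omega⟩
  obtain ⟨g2, hg2⟩ : ∃ g, ai = a + g := ⟨ai - a, by omega⟩
  have rf : (aq:ℝ) = a + f := by exact_mod_cast hf
  have r2 : (ai:ℝ) = a + g2 := by exact_mod_cast hg2
  have hR : wideR N r a f ![bp, bq, g2, bi] = wideRegion (r - 2 * (1 / N)) (r / 4)
      ((a : ℝ) / N) (((bp : ℝ) + 1) / N) (((aq : ℝ) + 1) / N) (((bq : ℝ) + 1) / N)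
      ((ai : ℝ) / N) (((bi : ℝ) + 1) / N) := by
    simp [wideR, rf, r2]
  have ci := cell_div_le hN (hX i)
  have ci' := fun c => lt_cell_div hN (X i) c
  have cq := cell_div_le hN (hX q)
  have cq' := fun c => lt_cell_div hN (X q) c
  have cp := cell_div_le hN (hX p)
  have cp' := fun c => lt_cell_div hN (X p) c
  simp only [add_div] at ci' cp' cq'
  refine ⟨a, ?_, f, ?_, ![bp, bq, g2, bi], ?_, ?_, p, ?_, ?_⟩
  · simp only [Finset.mem_range]
    exact cell_lt hN (hX p) 0
  · have h3 : X q 0 - X p 0 ≤ D * r := (le_abs_self _).trans (hU.extent q hq p hp 0)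
    have h4 : (N : ℝ) * (X q 0 - X p 0) ≤ N * (D * r) := by gcongr
    have : (f : ℝ) < F := by linarith
    exact_mod_cast this
  · exact mem_offsets (by omega) (by omega) (by omega) (by omega)
  · rw [hR, areaBound]
    have e : ((f : ℝ) + 1) / N = ((aq : ℝ) + 1) / N - a / N := by rw [rf]; ring
    rw [e]
    have h1 := hin p hp
    have h5 := hin q hq
    have t1 := htop p hp
    have t2 := htop q hq
    refine le_sq_wideRegion (by linarith) (by linarith) ?_ ?_ ?_ ?_ ?_ ?_ ?_ ?_ ?_ ?_
    · linarith [cp' 0, h1.1]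
    · rw [add_div]; linarith [cq 0, h5.2]
    · positivity
    · rw [add_div]; linarith [cp 1]
    · positivity
    · rw [add_div]; linarith [cq 1]
    · gcongr
    · gcongr
      have : (ai : ℝ) ≤ aq := by exact_mod_cast k4
      linarith
    · positivity
    · rw [add_div]; linarith [ci 1]
  · exact (mem_tile_iff hN (hX p)).2 ⟨rfl, rfl⟩
  · intro k _ hk
    rw [hR] at hk
    rcases hk with (hk | hk) | hk
    · have hkU : k ∉ U := fun h => by
        linarith [hk.1, hleft k h, cp 0]
      exact hU.not_mem_of_dist_le hp hkU (dist_le_of_mem_disc hμ0.le (by linarith)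
        (abs_sub_cell hN (hX p) 0) (abs_sub_cell_succ hN (hX p) 1) hk.2.2)
    · have hkU : k ∉ U := fun h => by
        have := hk.1
        rw [add_div] at this
        linarith [hright k h, cq' 0]
      exact hU.not_mem_of_dist_le hq hkU (dist_le_of_mem_disc hμ0.le (by linarith)
        (abs_sub_cell_succ hN (hX q) 0) (abs_sub_cell_succ hN (hX q) 1) hk.2.2)
    · have hkU : k ∉ U := fun h => by
        have := hk.2.1
        rw [add_div] at this
        linarith [htop k h, ci' 1]
      refine hU.not_mem_of_dist_le hi hkU (dist_le_of_mem_rect (by linarith)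
        (abs_sub_cell hN (hX i) 0) (abs_sub_cell_succ hN (hX i) 1) ?_ ?_)
      · rw [abs_le]
        constructor <;> linarith [hk.1.1, hk.1.2,
          min_le_right (((aq:ℝ) + 1) / N) (ai / N + r / 4), le_max_right ((a:ℝ) / N) (ai / N - r / 4)]
      · rw [abs_le]; constructor <;> linarith [hk.2.1, hk.2.2]

/-- A quarter disc above the highest node suffices. The node lies in one of only `F ^ 2` cells at
the corner, so no extra area is needed. -/
lemma corner_event (hX : ∀ i, X i ∈ openSquare) (hU : IsCluster X r D U) (hN : 0 < N)
    (hμ : 4 * (1 / (N : ℝ)) ≤ r) {H : ℝ} (hF : N * H + 1 ≤ F) (hH : H ≤ 1 - r)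
    {i : Fin n} (hi : i ∈ U) (htop : ∀ k ∈ U, X k 1 ≤ X i 1) (hiH : ∀ c, X i c ≤ H) :
    ∃ a ∈ Finset.range F ×ˢ Finset.range F,
      Real.pi * (r - 2 * (1 / N)) ^ 2 / 4 ≤ sq.real (cornerR N r a) ∧
      Witness X (tile N a.1 a.2) (cornerR N r a) := by
  have hN' : (0:ℝ) < N := by exact_mod_cast hN
  have hμ0 : (0:ℝ) < 1 / N := by positivity
  have ci := cell_div_le hN (hX i)
  have ci' := fun c => lt_cell_div hN (X i) c
  simp only [add_div] at ci'
  have hlt : ∀ c, cell N (X i) c < F := by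
    intro c
    have h1 := cell_le_mul (m := N) (hX i) c
    have h2 : (N : ℝ) * X i c ≤ N * H := by gcongr; exact hiH c
    have : (cell N (X i) c : ℝ) < F := by linarith
    exact_mod_cast this
  refine ⟨(cell N (X i) 0, cell N (X i) 1), ?_, ?_, i, ?_, ?_⟩
  · simp only [Finset.mem_product, Finset.mem_range]
    exact ⟨hlt 0, hlt 1⟩
  · have h1 := hiH 0
    have h2 := hiH 1
    have hz : (0:ℝ) ≤ (cell N (X i) 0 : ℝ) / N := by positivity
    have hz' : (0:ℝ) ≤ (cell N (X i) 1 : ℝ) / N := by positivity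
    refine le_sq_quarter (Or.inl rfl) (Or.inl rfl) (by linarith) ⟨hz, ?_⟩ ⟨?_, ?_⟩
      ⟨by positivity, ?_⟩ ⟨?_, ?_⟩ <;> simp only [add_div] <;> linarith [ci 0, ci 1]
  · exact (mem_tile_iff hN (hX i)).2 ⟨rfl, rfl⟩
  · intro k _ hk
    have hkU : k ∉ U := fun h => by
      have := hk.2.1
      simp only [add_div] at this
      linarith [htop k h, ci' 1]
    exact hU.not_mem_of_dist_le hi hkU (dist_le_of_mem_disc hμ0.le (by linarith)
      (abs_sub_cell hN (hX i) 0) (abs_sub_cell_succ hN (hX i) 1) hk.2.2)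

end Extremes

/-! ### Symmetries of the square -/

/-- A symmetry of the unit square: a permutation of the coordinates, followed by reflections. -/
def symMap (s : Equiv.Perm (Fin 2)) (b : Fin 2 → Bool) (z : Plane) : Plane :=
  WithLp.toLp 2 fun k => if b k then 1 - z (s k) else z (s k)

lemma symMap_apply (s : Equiv.Perm (Fin 2)) (b : Fin 2 → Bool) (z : Plane) (k : Fin 2) :
    symMap s b z k = if b k then 1 - z (s k) else z (s k) := rfl

lemma abs_symMap_sub (s : Equiv.Perm (Fin 2)) (b : Fin 2 → Bool) (z w : Plane) (k : Fin 2) :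
    |symMap s b z k - symMap s b w k| = |z (s k) - w (s k)| := by
  simp only [symMap_apply]
  split_ifs
  · rw [abs_sub_comm]; congr 1; ring
  · rfl

lemma dist_symMap (s : Equiv.Perm (Fin 2)) (b : Fin 2 → Bool) (z w : Plane) :
    dist (symMap s b z) (symMap s b w) = dist z w := by
  rw [EuclideanSpace.dist_eq, EuclideanSpace.dist_eq]
  congr 1
  refine (Finset.sum_congr rfl fun k _ => ?_).trans
    (Equiv.sum_comp s fun k => dist (z k) (w k) ^ 2)
  rw [Real.dist_eq, Real.dist_eq, abs_symMap_sub]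

lemma symMap_mem_openSquare {s : Equiv.Perm (Fin 2)} {b : Fin 2 → Bool} {z : Plane}
    (h : z ∈ openSquare) : symMap s b z ∈ openSquare := by
  intro k
  have := h (s k)
  rw [symMap_apply]
  split_ifs
  · exact ⟨by linarith [this.2], by linarith [this.1]⟩
  · exact this

lemma measurePreserving_symMap (s : Equiv.Perm (Fin 2)) (b : Fin 2 → Bool) :
    MeasurePreserving (symMap s b) sq sq := by
  have h1 : MeasurePreserving (fun z : Plane => (WithLp.toLp 2 fun k => z (s k) : Plane)) :=
    (LinearIsometryEquiv.piLpCongrLeft 2 ℝ ℝ s⁻¹).measurePreserving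
  have h2 := measurePreserving_coordMap (f := fun k x => if b k then 1 - x else x) (by
    intro k
    cases b k
    · simp only [Bool.false_eq_true, if_false]
      exact MeasurePreserving.id volume
    · simpa using Measure.measurePreserving_sub_left volume (1:ℝ))
  have h3 : MeasurePreserving (symMap s b) := h2.comp h1
  have h4 := h3.restrict_preimage measurableSet_unitSquare
  have e : symMap s b ⁻¹' unitSquare = unitSquare := by
    ext z
    simp only [unitSquare, Set.mem_preimage, Set.mem_ofPred_eq, symMap_apply]
    rw [← s.forall_congr_right (q := fun k => z k ∈ Set.Icc (0:ℝ) 1)]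
    refine forall_congr' fun k => ?_
    split_ifs
    · simp only [Set.mem_Icc]
      constructor <;> rintro ⟨h, h'⟩ <;> constructor <;> linarith
    · rfl
  rwa [e] at h4

/-- An inequality is all that invariance gives directly for a set not known to be measurable, and it
is all that is used. -/
lemma nodeLaw_symMap_le {n : ℕ} (s : Equiv.Perm (Fin 2)) (b : Fin 2 → Bool)
    (E : Set (Fin n → Plane)) :
    (nodeLaw n).real {X | (fun i => symMap s b (X i)) ∈ E} ≤ (nodeLaw n).real E := by
  have h : MeasurePreserving (fun X : Fin n → Plane => fun i => symMap s b (X i)) (nodeLaw n)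
      (nodeLaw n) :=
    measurePreserving_pi _ _ fun _ => measurePreserving_symMap s b
  refine ENNReal.toReal_mono (measure_ne_top _ _) ?_
  refine (Measure.le_map_apply h.measurable.aemeasurable E).trans ?_
  rw [h.map_eq]

/-! ### Interior, side and corner clusters -/

section Cluster

variable {n N F : ℕ} {X : Fin n → Plane} {r D : ℝ} {U : Finset (Fin n)}

lemma IsCluster.symMap (hU : IsCluster X r D U) (s : Equiv.Perm (Fin 2)) (b : Fin 2 → Bool) :
    IsCluster (fun i => symMap s b (X i)) r D U where
  nonempty := hU.nonempty
  isolated := fun i hi j hj => by rw [dist_symMap]; exact hU.isolated i hi j hj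
  extent := fun i hi j hj k => by rw [abs_symMap_sub]; exact hU.extent i hi j hj _

/-- Exchanging the coordinates if necessary, the cluster is at least as high as it is wide. -/
lemma inner_cluster (hX : ∀ i, X i ∈ openSquare) (hU : IsCluster X r D U) (hN : 0 < N)
    (hμ : 4 * (1 / (N : ℝ)) ≤ r) (hF : N * (D * r) + 1 ≤ F)
    (hin : ∀ k ∈ U, ∀ c, X k c ∈ Set.Icc r (1 - r)) :
    ∃ s b, ClusterEvent N r F fun i => symMap s b (X i) := by
  obtain ⟨i, hi, htop⟩ := U.exists_max_image (fun k => X k 1) hU.nonempty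
  obtain ⟨j, hj, hbot⟩ := U.exists_min_image (fun k => X k 1) hU.nonempty
  obtain ⟨q, hq, hright⟩ := U.exists_max_image (fun k => X k 0) hU.nonempty
  obtain ⟨p, hp, hleft⟩ := U.exists_min_image (fun k => X k 0) hU.nonempty
  rcases le_total (X q 0 - X p 0) (X i 1 - X j 1) with h | h
  · refine ⟨1, fun _ => false, Or.inl ?_⟩
    refine inner_event (fun k => symMap_mem_openSquare (hX k)) (hU.symMap _ _) hN hμ hF hi hj hp
      ?_ ?_ ?_ ?_ ?_ ?_ <;> simp only [symMap_apply] <;>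
      simp only [Equiv.Perm.coe_one, id_eq, Bool.false_eq_true, if_false]
    · exact htop
    · exact hbot
    · exact hleft
    · rw [abs_le]; constructor <;> linarith [hleft i hi, hright i hi, hleft j hj, hright j hj]
    · rw [abs_le]; constructor <;> linarith [hleft i hi, hright i hi, hleft p hp, hright p hp]
    · exact hin
  · refine ⟨Equiv.swap 0 1, fun _ => false, Or.inl ?_⟩
    refine inner_event (fun k => symMap_mem_openSquare (hX k)) (hU.symMap _ _) hN hμ hF hq hp hj
      ?_ ?_ ?_ ?_ ?_ ?_ <;> simp only [symMap_apply] <;>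
      simp only [Bool.false_eq_true, if_false, Equiv.swap_apply_left, Equiv.swap_apply_right]
    · exact hright
    · exact hleft
    · exact hbot
    · rw [abs_le]; constructor <;> linarith [htop q hq, hbot q hq, htop p hp, hbot p hp]
    · rw [abs_le]; constructor <;> linarith [htop q hq, hbot q hq, htop j hj, hbot j hj]
    · exact fun k hk c => hin k hk _

lemma bottom_cluster (hX : ∀ i, X i ∈ openSquare) (hU : IsCluster X r D U) (hN : 0 < N)
    (hμ : 4 * (1 / (N : ℝ)) ≤ r) (hF : N * ((D + 1) * r) + 1 ≤ F) (hD : (D + 3) * r ≤ 1)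
    (hin : ∀ k ∈ U, X k 0 ∈ Set.Icc r (1 - r)) (hlow : ∃ k ∈ U, X k 1 < r) :
    ClusterEvent N r F X := by
  obtain ⟨i, hi, htop⟩ := U.exists_max_image (fun k => X k 1) hU.nonempty
  obtain ⟨q, hq, hright⟩ := U.exists_max_image (fun k => X k 0) hU.nonempty
  obtain ⟨p, hp, hleft⟩ := U.exists_min_image (fun k => X k 0) hU.nonempty
  obtain ⟨l, hl, hlr⟩ := hlow
  have hr : 0 < r := (hX l 1).1.trans hlr
  have hiH : X i 1 ≤ (D + 1) * r := by
    have := (le_abs_self _).trans (hU.extent i hi l hl 1)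
    linarith
  have hF' : N * (D * r) + 1 ≤ (F : ℝ) := by
    refine le_trans ?_ hF
    gcongr
    linarith
  rcases le_total (X q 0 - X p 0) (X i 1) with h | h
  · refine Or.inr (Or.inl (tall_event hX hU hN hμ hF (by linarith) hi hp htop hleft hiH ?_ hin))
    rw [abs_le]; constructor <;> linarith [hleft i hi, hright i hi, (hX i 1).1]
  · exact Or.inr (Or.inr (Or.inl (wide_event hX hU hN hμ hF' (H := (D + 1) * r) (by linarith) hp hq
      hi htop hleft hright hiH h hin)))

lemma corner_cluster (hX : ∀ i, X i ∈ openSquare) (hU : IsCluster X r D U) (hN : 0 < N)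
    (hμ : 4 * (1 / (N : ℝ)) ≤ r) (hF : N * ((D + 1) * r) + 1 ≤ F) (hD : (D + 3) * r ≤ 1)
    (hlow : ∀ c, ∃ k ∈ U, X k c < r) :
    ClusterEvent N r F X := by
  obtain ⟨i, hi, htop⟩ := U.exists_max_image (fun k => X k 1) hU.nonempty
  have hiH : ∀ c, X i c ≤ (D + 1) * r := by
    intro c
    obtain ⟨l, hl, hlr⟩ := hlow c
    have := (le_abs_self _).trans (hU.extent i hi l hl c)
    linarith
  have hr : 0 < r := by
    obtain ⟨l, hl, hlr⟩ := hlow 0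
    exact (hX l 0).1.trans hlr
  exact Or.inr (Or.inr (Or.inr (corner_event hX hU hN hμ hF (by linarith) hi htop hiH)))

/-- In each coordinate the cluster either keeps distance `r` from the two sides or comes close to
one of them. A symmetry moves that side to the bottom, or the two sides to the corner at the origin.
-/
lemma cluster_event (hX : ∀ i, X i ∈ openSquare) (hU : IsCluster X r D U) (hN : 0 < N)
    (hμ : 4 * (1 / (N : ℝ)) ≤ r) (hF : N * ((D + 1) * r) + 1 ≤ F) (hD : (D + 3) * r ≤ 1) :
    ∃ s b, ClusterEvent N r F fun i => symMap s b (X i) := by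
  have hN' : (0:ℝ) < N := by exact_mod_cast hN
  have hr : 0 < r := lt_of_lt_of_le (by positivity) hμ
  have hF' : N * (D * r) + 1 ≤ (F : ℝ) := by
    refine le_trans ?_ hF
    gcongr
    linarith
  have hout : ∀ c, (¬ ∀ k ∈ U, X k c ∈ Set.Icc r (1 - r)) →
      ∃ β : Bool, ∃ k ∈ U, (if β then 1 - X k c else X k c) < r := by
    intro c h
    push Not at h
    obtain ⟨k, hk, h⟩ := h
    rw [Set.mem_Icc, not_and_or, not_le, not_le] at h
    rcases h with h | h
    · exact ⟨false, k, hk, by simpa using h⟩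
    · exact ⟨true, k, hk, by simp; linarith⟩
  by_cases h0 : ∀ k ∈ U, X k 0 ∈ Set.Icc r (1 - r) <;>
    by_cases h1 : ∀ k ∈ U, X k 1 ∈ Set.Icc r (1 - r)
  · exact inner_cluster hX hU hN hμ hF' fun k hk c => by
      fin_cases c
      · exact h0 k hk
      · exact h1 k hk
  · obtain ⟨β, hβ⟩ := hout 1 h1
    refine ⟨1, ![false, β], bottom_cluster (fun k => symMap_mem_openSquare (hX k)) (hU.symMap _ _)
      hN hμ hF hD ?_ ?_⟩
    · simpa [symMap_apply] using h0
    · simpa [symMap_apply] using hβ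
  · obtain ⟨β, hβ⟩ := hout 0 h0
    refine ⟨Equiv.swap 0 1, ![false, β], bottom_cluster (fun k => symMap_mem_openSquare (hX k))
      (hU.symMap _ _) hN hμ hF hD ?_ ?_⟩
    · simpa [symMap_apply] using h1
    · simpa [symMap_apply] using hβ
  · obtain ⟨β, hβ⟩ := hout 0 h0
    obtain ⟨β', hβ'⟩ := hout 1 h1
    refine ⟨1, ![β, β'], corner_cluster (fun k => symMap_mem_openSquare (hX k)) (hU.symMap _ _)
      hN hμ hF hD ?_⟩
    rw [Fin.forall_fin_two]
    obtain ⟨k, hk, h⟩ := hβ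
    obtain ⟨k', hk', h'⟩ := hβ'
    refine ⟨⟨k, hk, ?_⟩, k', hk', ?_⟩
    · cases β <;> simpa [symMap_apply] using h
    · cases β' <;> simpa [symMap_apply] using h'

end Cluster

/-! ### Absence of isolated clusters -/

lemma measurableSet_cornerR (N : ℕ) (r : ℝ) (a : ℕ × ℕ) : MeasurableSet (cornerR N r a) :=
  measurableSet_quarter _ _ _ _ _

lemma corner_le {n N : ℕ} (hN : 0 < N) (r : ℝ) (F : ℕ) :
    (nodeLaw n).real {X | ∃ a ∈ Finset.range F ×ˢ Finset.range F,
      Real.pi * (r - 2 * (1 / N)) ^ 2 / 4 ≤ sq.real (cornerR N r a) ∧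
      Witness X (tile N a.1 a.2) (cornerR N r a)}
      ≤ (F : ℝ) ^ 2 * (n * (1 / (N : ℝ) ^ 2 *
        Real.exp (1 - n * (Real.pi * (r - 2 * (1 / N)) ^ 2 / 4)))) := by
  set A := Real.pi * (r - 2 * (1 / N)) ^ 2 / 4
  have hsub : {X : Fin n → Plane | ∃ a ∈ Finset.range F ×ˢ Finset.range F,
      A ≤ sq.real (cornerR N r a) ∧ Witness X (tile N a.1 a.2) (cornerR N r a)}
      ⊆ ⋃ a ∈ Finset.range F ×ˢ Finset.range F, {X | A ≤ sq.real (cornerR N r a) ∧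
        Witness X (tile N a.1 a.2) (cornerR N r a)} := by
    rintro X ⟨a, ha, h⟩
    simp only [Set.mem_iUnion]
    exact ⟨a, ha, h⟩
  refine (measureReal_mono hsub (measure_ne_top _ _)).trans
    ((measureReal_biUnion_finset_le _ _).trans ?_)
  have hcard : ((Finset.range F ×ˢ Finset.range F).card : ℝ) = (F : ℝ) ^ 2 := by
    simp [pow_two]
  rw [← hcard, ← nsmul_eq_mul, ← Finset.sum_const]
  refine Finset.sum_le_sum fun a _ => ?_
  by_cases h : A ≤ sq.real (cornerR N r a)
  · simp only [h, true_and]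
    exact witness_le (measurableSet_cornerR N r a) (sq_tile_le hN _ _) h
  · simp only [h, false_and]
    have : {X : Fin n → Plane | False} = ∅ := by ext; simp
    rw [this, measureReal_empty]
    positivity

/-- A cell has area `1 / N ^ 2`. Summation over `N ^ 2` interior positions leaves the factor `n`,
over `N` side positions `n / N`, and over the corner cells `F ^ 2 * n / N ^ 2`. -/
lemma clusterEvent_le {n N F : ℕ} {r C : ℝ} (hN : 0 < N) (hNr : (N : ℝ) ≤ 2 * (n * r))
    (hC : ∑ f ∈ Finset.range F, (2 * f + 5 : ℝ) ^ 4 *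
      (Real.exp (-((f : ℝ) + 1) / 8) + Real.exp (-(n * r ^ 2) / 16)) ≤ C) :
    (nodeLaw n).real {X | ClusterEvent N r F X}
      ≤ n * Real.exp (1 - n * (Real.pi * (r - 2 * (1 / N)) ^ 2)) * C
        + 2 * (n / N * Real.exp (1 - n * (Real.pi * (r - 2 * (1 / N)) ^ 2 / 2)) * C)
        + (F : ℝ) ^ 2 * (n * (1 / (N : ℝ) ^ 2 *
          Real.exp (1 - n * (Real.pi * (r - 2 * (1 / N)) ^ 2 / 4)))) := by
  have hN' : (0:ℝ) < N := by exact_mod_cast hN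
  have hv : (0:ℝ) ≤ 1 / (N:ℝ) ^ 2 := by positivity
  have h1 := (witnessFamily_le (n := n) (Finset.range N ×ˢ Finset.range N) F
    (areaBound N r (Real.pi * (r - 2 * (1 / N)) ^ 2)) (fun a _ _ => tile N a.1 a.2) (innerR N r)
    (fun _ _ _ => measurableSet_innerRegion _ _ _ _ _ _ _ _) (fun a _ _ => sq_tile_le hN _ _)).trans
    (mul_le_mul_of_nonneg_left (offset_sum_le hN hNr hv hC) (Nat.cast_nonneg _))
  have h2 := (witnessFamily_le (n := n) (Finset.range N) F
    (areaBound N r (Real.pi * (r - 2 * (1 / N)) ^ 2 / 2)) (fun a f _ => tile N a f) (tallR N r)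
    (fun _ _ _ => measurableSet_tallRegion _ _ _ _ _ _) (fun a _ _ => sq_tile_le hN _ _)).trans
    (mul_le_mul_of_nonneg_left (offset_sum_le hN hNr hv hC) (Nat.cast_nonneg _))
  have h3 := (witnessFamily_le (n := n) (Finset.range N) F
    (areaBound N r (Real.pi * (r - 2 * (1 / N)) ^ 2 / 2)) (fun a _ g => tile N a (g 0)) (wideR N r)
    (fun _ _ _ => measurableSet_wideRegion _ _ _ _ _ _ _ _) (fun a _ _ => sq_tile_le hN _ _)).trans
    (mul_le_mul_of_nonneg_left (offset_sum_le hN hNr hv hC) (Nat.cast_nonneg _))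
  have h4 := corner_le (n := n) hN r F
  have hcard : ((Finset.range N ×ˢ Finset.range N).card : ℝ) = (N : ℝ) ^ 2 := by
    simp [pow_two]
  rw [hcard] at h1
  rw [Finset.card_range] at h2 h3
  have e1 : ∀ y : ℝ, (N : ℝ) ^ 2 * (n * (1 / (N : ℝ) ^ 2) * y * C) = n * y * C := by
    intro y; field_simp
  have e2 : ∀ y : ℝ, (N : ℝ) * (n * (1 / (N : ℝ) ^ 2) * y * C) = n / N * y * C := by
    intro y; field_simp
  rw [e1] at h1
  rw [e2] at h2 h3
  set E1 := {X : Fin n → Plane | WitnessFamily (Finset.range N ×ˢ Finset.range N) F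
      (areaBound N r (Real.pi * (r - 2 * (1 / N)) ^ 2))
      (fun a _ _ => tile N a.1 a.2) (innerR N r) X}
  set E2 := {X : Fin n → Plane | WitnessFamily (Finset.range N) F
    (areaBound N r (Real.pi * (r - 2 * (1 / N)) ^ 2 / 2)) (fun a f _ => tile N a f) (tallR N r) X}
  set E3 := {X : Fin n → Plane | WitnessFamily (Finset.range N) F
    (areaBound N r (Real.pi * (r - 2 * (1 / N)) ^ 2 / 2)) (fun a _ g => tile N a (g 0))
    (wideR N r) X}
  set E4 := {X : Fin n → Plane | ∃ a ∈ Finset.range F ×ˢ Finset.range F,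
      Real.pi * (r - 2 * (1 / N)) ^ 2 / 4 ≤ sq.real (cornerR N r a) ∧
      Witness X (tile N a.1 a.2) (cornerR N r a)}
  have hsub : {X : Fin n → Plane | ClusterEvent N r F X} ⊆ E1 ∪ (E2 ∪ (E3 ∪ E4)) := fun X hX => hX
  have u1 := measureReal_mono (μ := nodeLaw n) hsub (measure_ne_top _ _)
  have u2 := measureReal_union_le (μ := nodeLaw n) E1 (E2 ∪ (E3 ∪ E4))
  have u3 := measureReal_union_le (μ := nodeLaw n) E2 (E3 ∪ E4)
  have u4 := measureReal_union_le (μ := nodeLaw n) E3 E4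
  linarith

lemma clusterEvent_le_explicit {n N F : ℕ} {r C c ξ : ℝ} (hn : 0 < n) (hr : 0 < r)
    (hN1 : n * r ≤ N) (hNr : (N : ℝ) ≤ 2 * (n * r)) (hL : 1 ≤ n * r ^ 2) (hC0 : 0 ≤ C)
    (hF : (F : ℝ) ≤ c * (n * r ^ 2)) (hξ : Real.pi * r ^ 2 * n = Real.log n + ξ)
    (hC : ∑ f ∈ Finset.range F, (2 * f + 5 : ℝ) ^ 4 *
      (Real.exp (-((f : ℝ) + 1) / 8) + Real.exp (-(n * r ^ 2) / 16)) ≤ C) :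
    (nodeLaw n).real {X | ClusterEvent N r F X}
      ≤ Real.exp (1 + 4 * Real.pi) * C * Real.exp (-ξ)
        + 2 * Real.exp (1 + 4 * Real.pi) * C * Real.exp (-(ξ / 2))
        + c ^ 2 * Real.exp (1 + 4 * Real.pi) * ((n * r ^ 2) ^ 2 * Real.exp (-(n * r ^ 2 / 2))) := by
  have hn' : (0:ℝ) < n := by exact_mod_cast hn
  have hN' : (0:ℝ) < N := lt_of_lt_of_le (by positivity) hN1
  have hN : 0 < N := by exact_mod_cast hN'
  have hpi := Real.pi_pos
  set ρ := r - 2 * (1 / N) with hρ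
  -- The loss in area from shrinking the radius by `2 / N` is at most `4 π r / N`, and `n r ≤ N`
  -- turns it into the constant `4 π`.
  have hA : Real.log n + ξ - 4 * Real.pi ≤ n * (Real.pi * ρ ^ 2) := by
    have h1 : (n:ℝ) * r * (1 / N) ≤ 1 := by
      rw [mul_one_div, div_le_one hN']; exact hN1
    have h2 : n * (Real.pi * ρ ^ 2) = Real.pi * r ^ 2 * n - 4 * Real.pi * (n * r * (1 / N))
        + 4 * Real.pi * n * (1 / N) ^ 2 := by rw [hρ]; ring
    have h3 : 0 ≤ 4 * Real.pi * n * (1 / (N:ℝ)) ^ 2 := by positivity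
    rw [h2, hξ]
    nlinarith
  refine (clusterEvent_le hN hNr hC).trans ?_
  have t1 : n * Real.exp (1 - n * (Real.pi * ρ ^ 2)) ≤ Real.exp (1 + 4 * Real.pi) * Real.exp (-ξ) := by
    calc n * Real.exp (1 - n * (Real.pi * ρ ^ 2))
        = Real.exp (Real.log n + (1 - n * (Real.pi * ρ ^ 2))) := by
          rw [Real.exp_add, Real.exp_log hn']
      _ ≤ Real.exp (1 + 4 * Real.pi + -ξ) := Real.exp_le_exp.2 (by linarith)
      _ = _ := Real.exp_add _ _
  have t2 : n / N * Real.exp (1 - n * (Real.pi * ρ ^ 2 / 2))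
      ≤ Real.exp (1 + 4 * Real.pi) * Real.exp (-(ξ / 2)) := by
    -- Since `n / N ≤ 1 / r ≤ √n`, half the disc area is enough to beat the number of side
    -- positions.
    have h1 : (n:ℝ) / N ≤ Real.exp (Real.log n / 2) := by
      have h2 : Real.exp (Real.log n / 2) ^ 2 = n := by
        rw [← Real.exp_nat_mul]
        push_cast
        rw [mul_div_cancel₀ _ (two_ne_zero), Real.exp_log hn']
      set e := Real.exp (Real.log n / 2) with he
      have he0 : 0 < e := Real.exp_pos _
      have h3 : 1 ≤ e * r := by
        rw [← h2, ← mul_pow] at hL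
        exact (one_le_sq_iff₀ (by positivity)).1 hL
      rw [div_le_iff₀ hN']
      calc (n : ℝ) ≤ n * (e * r) := le_mul_of_one_le_right hn'.le h3
        _ = e * (n * r) := by ring
        _ ≤ e * N := by gcongr
    calc n / N * Real.exp (1 - n * (Real.pi * ρ ^ 2 / 2))
        ≤ Real.exp (Real.log n / 2) * Real.exp (1 - n * (Real.pi * ρ ^ 2 / 2)) := by gcongr
      _ = Real.exp (Real.log n / 2 + (1 - n * (Real.pi * ρ ^ 2 / 2))) := (Real.exp_add _ _).symm
      _ ≤ Real.exp (1 + 4 * Real.pi + -(ξ / 2)) := Real.exp_le_exp.2 (by linarith)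
      _ = _ := Real.exp_add _ _
  have t3 : (F : ℝ) ^ 2 * (n * (1 / (N : ℝ) ^ 2 * Real.exp (1 - n * (Real.pi * ρ ^ 2 / 4))))
      ≤ c ^ 2 * Real.exp (1 + 4 * Real.pi) * ((n * r ^ 2) ^ 2 * Real.exp (-(n * r ^ 2 / 2))) := by
    have h1 : n * (1 / (N : ℝ) ^ 2) ≤ 1 := by
      rw [mul_one_div, div_le_one (by positivity)]
      calc (n : ℝ) ≤ n * (n * r ^ 2) := le_mul_of_one_le_right hn'.le hL
        _ = (n * r) ^ 2 := by ring
        _ ≤ (N:ℝ) ^ 2 := by gcongr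
    have h2 : Real.exp (1 - n * (Real.pi * ρ ^ 2 / 4))
        ≤ Real.exp (1 + 4 * Real.pi) * Real.exp (-(n * r ^ 2 / 2)) := by
      rw [← Real.exp_add]
      refine Real.exp_le_exp.2 ?_
      have : Real.pi * r ^ 2 * n = Real.pi * (n * r ^ 2) := by ring
      nlinarith [Real.pi_gt_three]
    calc (F : ℝ) ^ 2 * (n * (1 / (N : ℝ) ^ 2 * Real.exp (1 - n * (Real.pi * ρ ^ 2 / 4))))
        = (F : ℝ) ^ 2 * ((n * (1 / (N : ℝ) ^ 2)) * Real.exp (1 - n * (Real.pi * ρ ^ 2 / 4))) := by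
          ring
      _ ≤ (c * (n * r ^ 2)) ^ 2 *
          (1 * (Real.exp (1 + 4 * Real.pi) * Real.exp (-(n * r ^ 2 / 2)))) := by gcongr
      _ = _ := by ring
  have t1' := mul_le_mul_of_nonneg_right t1 hC0
  have t2' := mul_le_mul_of_nonneg_right t2 hC0
  linarith

/-- At a connectivity radius there are no isolated clusters of small extent. -/
theorem whp_no_cluster {r ξ : ℕ → ℝ} {D : ℝ} (hD : 0 ≤ D) (hr : ∀ n, 0 < r n)
    (hrξ : ∀ᶠ n : ℕ in atTop, Real.pi * r n ^ 2 * n = Real.log n + ξ n)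
    (hξ : Tendsto ξ atTop atTop) (hr0 : Tendsto r atTop (𝓝 0)) :
    Whp nodeLaw fun n X => ∀ U, ¬ IsCluster X (r n) D U := by
  set L : ℕ → ℝ := fun n => n * r n ^ 2 with hLdef
  have hL : Tendsto L atTop atTop := by
    have h1 : Tendsto (fun n : ℕ => (Real.log n + ξ n) / Real.pi) atTop atTop :=
      Tendsto.atTop_div_const Real.pi_pos
        ((Real.tendsto_log_atTop.comp tendsto_natCast_atTop_atTop).atTop_add_atTop hξ)
    refine h1.congr' ?_
    filter_upwards [hrξ] with n hn
    rw [← hn, hLdef]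
    field_simp [Real.pi_pos.ne']
  obtain ⟨C, hC0, hC⟩ := exists_offset_sum_bound (2 * D + 4) (by linarith)
  set K := Real.exp (1 + 4 * Real.pi)
  set B : ℕ → ℝ := fun n => K * C * Real.exp (-ξ n) + 2 * K * C * Real.exp (-(ξ n / 2))
    + (2 * D + 4) ^ 2 * K * (L n ^ 2 * Real.exp (-(L n / 2))) with hB
  have hB0 : Tendsto B atTop (𝓝 0) := by
    have h1 : Tendsto (fun n => Real.exp (-ξ n)) atTop (𝓝 0) :=
      Real.tendsto_exp_neg_atTop_nhds_zero.comp hξ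
    have h2 : Tendsto (fun n => Real.exp (-(ξ n / 2))) atTop (𝓝 0) :=
      Real.tendsto_exp_neg_atTop_nhds_zero.comp (hξ.atTop_div_const two_pos)
    have h3 : Tendsto (fun n => (L n) ^ 2 * Real.exp (-(L n / 2))) atTop (𝓝 0) := by
      have h4 := (Real.tendsto_pow_mul_exp_neg_atTop_nhds_zero 2).comp (hL.atTop_div_const two_pos)
      have h5 := h4.const_mul 4
      rw [mul_zero] at h5
      refine h5.congr fun n => ?_
      simp only [Function.comp]
      ring
    have := ((h1.const_mul (K * C)).add (h2.const_mul (2 * K * C))).add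
      (h3.const_mul ((2 * D + 4) ^ 2 * K))
    simpa using this
  have hcard : Tendsto (fun n => (Fintype.card (Equiv.Perm (Fin 2) × (Fin 2 → Bool)) : ℝ) * B n)
      atTop (𝓝 0) := by simpa using hB0.const_mul _
  refine whp_of_real_le ?_ hcard
  filter_upwards [hrξ, hL.eventually_ge_atTop 4, eventually_gt_atTop 0,
    hr0.eventually (ge_mem_nhds (show (0:ℝ) < 1 / (D + 3) by positivity)),
    hr0.eventually (ge_mem_nhds one_pos)] with n hn hL4 hn0 hrD hr1
  have hn' : (0:ℝ) < n := by exact_mod_cast hn0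
  have hrn := hr n
  -- Any spacing of order `1 / (n r)` works: a coarser grid would lose more than a constant factor
  -- in the probability, a finer one would give more offsets per unit of extra area.
  set N : ℕ := ⌈n * r n⌉₊ with hNdef
  have hN1 : n * r n ≤ N := Nat.le_ceil _
  have hnr1 : 1 ≤ n * r n := by
    have : n * r n ^ 2 ≤ n * r n := by
      rw [pow_two]; gcongr; exact mul_le_of_le_one_left hrn.le hr1
    simp only [hLdef] at hL4
    linarith
  have hN2 : (N : ℝ) ≤ 2 * (n * r n) := by
    have := (Nat.ceil_lt_add_one (show 0 ≤ n * r n by positivity)).le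
    linarith
  have hN' : (0:ℝ) < N := by linarith
  have hN : 0 < N := by exact_mod_cast hN'
  -- A cluster that comes within `r` of a side stays within `(D + 1) r` of it, so all extents
  -- measured in cells are below `F`.
  set F : ℕ := ⌈N * ((D + 1) * r n) + 1⌉₊ with hFdef
  have hF1 : N * ((D + 1) * r n) + 1 ≤ F := Nat.le_ceil _
  have hF2 : (F : ℝ) ≤ (2 * D + 4) * (n * r n ^ 2) := by
    have h1 := (Nat.ceil_lt_add_one (show 0 ≤ N * ((D + 1) * r n) + 1 by positivity)).le
    have h2 : N * ((D + 1) * r n) ≤ 2 * (n * r n) * ((D + 1) * r n) := by gcongr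
    simp only [hLdef] at hL4
    nlinarith
  have hμ : 4 * (1 / (N:ℝ)) ≤ r n := by
    rw [mul_one_div, div_le_iff₀ hN']
    calc (4:ℝ) ≤ n * r n ^ 2 := hL4
      _ = r n * (n * r n) := by ring
      _ ≤ r n * N := by gcongr
  have hD3 : (D + 3) * r n ≤ 1 := by
    rw [le_div_iff₀ (by linarith)] at hrD; linarith
  have hL1 : 1 ≤ n * r n ^ 2 := by simp only [hLdef] at hL4; linarith
  have hev := clusterEvent_le_explicit hn0 hrn hN1 hN2 hL1 hC0 hF2 hn (hC _ _ hL1 hF2)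
  have hsub : {X : Fin n → Plane | ¬ ∀ U, ¬ IsCluster X (r n) D U}
      ⊆ {X | ¬ ∀ i, X i ∈ openSquare} ∪
        ⋃ t ∈ (Finset.univ : Finset (Equiv.Perm (Fin 2) × (Fin 2 → Bool))),
          {X | (fun i => symMap t.1 t.2 (X i)) ∈ {X | ClusterEvent N (r n) F X}} := by
    intro X hX
    simp only [Set.mem_ofPred_eq, not_forall, not_not] at hX
    obtain ⟨U, hU⟩ := hX
    by_cases ho : ∀ i, X i ∈ openSquare
    · obtain ⟨s, b, h⟩ := cluster_event ho hU hN hμ hF1 hD3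
      refine Or.inr ?_
      simp only [Finset.mem_univ, Set.iUnion_true, Set.mem_iUnion]
      exact ⟨(s, b), h⟩
    · exact Or.inl ho
  have hz : (nodeLaw n).real {X | ¬ ∀ i, X i ∈ openSquare} = 0 := by
    rw [Measure.real, ae_iff.1 (ae_forall_mem ae_openSquare)]
    rfl
  refine (measureReal_mono hsub (measure_ne_top _ _)).trans
    ((measureReal_union_le _ _).trans ?_)
  rw [hz, zero_add]
  refine (measureReal_biUnion_finset_le _ _).trans ?_
  rw [← nsmul_eq_mul, ← Finset.card_univ, ← Finset.sum_const]
  exact Finset.sum_le_sum fun t _ => (nodeLaw_symMap_le _ _ _).trans hev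

/-! ### Flows between distributions of nodes -/

section Flow

variable {n : ℕ} {link : Fin n → Fin n → Prop}

/-- A flow along the links that transports the mass distribution `μ` to the distribution `ν`. -/
structure Flow (link : Fin n → Fin n → Prop) (g : Fin n → Fin n → ℝ) (μ ν : Fin n → ℝ) : Prop where
  nonneg : ∀ u v, 0 ≤ g u v
  support : ∀ u v, ¬ link u v → g u v = 0
  balance : ∀ u, ∑ v, g u v - ∑ v, g v u = μ u - ν u

lemma Flow.zero (μ : Fin n → ℝ) : Flow link (fun _ _ => 0) μ μ where
  nonneg := fun _ _ => le_rfl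
  support := fun _ _ _ => rfl
  balance := fun _ => by simp

lemma Flow.add {g h : Fin n → Fin n → ℝ} {μ ν ρ : Fin n → ℝ} (hg : Flow link g μ ν)
    (hh : Flow link h ν ρ) : Flow link (fun u v => g u v + h u v) μ ρ where
  nonneg := fun u v => add_nonneg (hg.nonneg u v) (hh.nonneg u v)
  support := fun u v huv => by simp [hg.support u v huv, hh.support u v huv]
  balance := fun u => by
    have h1 := hg.balance u
    have h2 := hh.balance u
    simp only [Finset.sum_add_distrib]
    linarith

lemma Flow.reverse (hsymm : ∀ u v, link u v → link v u) {g : Fin n → Fin n → ℝ} {μ ν : Fin n → ℝ}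
    (hg : Flow link g μ ν) : Flow link (fun u v => g v u) ν μ where
  nonneg := fun u v => hg.nonneg v u
  support := fun u v huv => hg.support v u fun h => huv (hsymm v u h)
  balance := fun u => by
    have h1 := hg.balance u
    linarith

/-- The uniform distribution on a finite set of nodes. -/
def unif (T : Finset (Fin n)) (u : Fin n) : ℝ := if u ∈ T then 1 / (T.card : ℝ) else 0

/-- The flow that spreads evenly over all pairs of nodes of two sets. -/
def spread (T T' : Finset (Fin n)) (u v : Fin n) : ℝ :=
  if u ∈ T ∧ v ∈ T' then 1 / ((T.card : ℝ) * T'.card) else 0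

lemma spread_sum_right (T T' : Finset (Fin n)) (hT' : T'.Nonempty) (u : Fin n) :
    ∑ v, spread T T' u v = unif T u := by
  have h : (T'.card : ℝ) ≠ 0 := by exact_mod_cast hT'.card_pos.ne'
  by_cases hu : u ∈ T
  · simp [spread, unif, hu]
    field_simp
  · simp [spread, unif, hu]

lemma spread_comm (T T' : Finset (Fin n)) (u v : Fin n) : spread T T' u v = spread T' T v u := by
  simp only [spread, and_comm, mul_comm]

lemma spread_nonneg (T T' : Finset (Fin n)) (u v : Fin n) : 0 ≤ spread T T' u v := by
  unfold spread
  split_ifs <;> positivity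

/-- Using all pairs equally keeps the load of each link at `1 / (|T| |T'|)`; this gain is what makes
many narrow beams useful. -/
lemma Flow.spread {T T' : Finset (Fin n)} (hT : T.Nonempty) (hT' : T'.Nonempty)
    (hlink : ∀ u ∈ T, ∀ v ∈ T', link u v) : Flow link (spread T T') (unif T) (unif T') where
  nonneg := spread_nonneg T T'
  support := fun u v huv => by
    unfold BeamNetwork.spread
    rw [if_neg]
    exact fun h => huv (hlink u h.1 v h.2)
  balance := fun u => by
    rw [spread_sum_right T T' hT' u]
    simp only [spread_comm T T' _ u]
    rw [spread_sum_right T' T hT u]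

lemma spread_le {T T' : Finset (Fin n)} {a : ℝ} (ha : 0 < a) (hT : a ≤ T.card) (hT' : a ≤ T'.card)
    (u v : Fin n) : BeamNetwork.spread T T' u v ≤ 1 / a ^ 2 := by
  unfold BeamNetwork.spread
  split_ifs
  · rw [pow_two]; gcongr
  · positivity

lemma Flow.sum {ν : ℕ → Fin n → ℝ} {g : ℕ → Fin n → Fin n → ℝ} {a b : ℕ} (hab : a ≤ b)
    (hg : ∀ x, a ≤ x → x < b → Flow link (g x) (ν x) (ν (x + 1))) :
    Flow link (fun u v => ∑ x ∈ Finset.Ico a b, g x u v) (ν a) (ν b) := by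
  induction b, hab using Nat.le_induction with
  | base => simpa using Flow.zero (ν a)
  | succ b hab ih =>
    have h1 := (ih fun x h h' => hg x h (h'.trans (Nat.lt_succ_self b))).add
      (hg b hab (Nat.lt_succ_self b))
    simpa only [Finset.sum_Ico_succ_top hab] using h1

/-- Traffic may run along the chain in either direction, by reversal. The bound does not depend on
the end points, so all commodities on a row can be treated alike. -/
lemma Flow.chain (hsymm : ∀ u v, link u v → link v u) {ν : ℕ → Fin n → ℝ}
    {g : ℕ → Fin n → Fin n → ℝ} {lo hi : ℕ}
    (hg : ∀ x, lo ≤ x → x < hi → Flow link (g x) (ν x) (ν (x + 1))) {a b : ℕ}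
    (ha : lo ≤ a) (ha' : a ≤ hi) (hb : lo ≤ b) (hb' : b ≤ hi) :
    ∃ h, Flow link h (ν a) (ν b) ∧
      ∀ u v, h u v ≤ ∑ x ∈ Finset.Ico lo hi, (g x u v + g x v u) := by
  have key : ∀ a b u v, lo ≤ a → b ≤ hi →
      ∑ x ∈ Finset.Ico a b, g x u v ≤ ∑ x ∈ Finset.Ico lo hi, g x u v := by
    intro a b u v ha hb
    refine Finset.sum_le_sum_of_subset_of_nonneg (Finset.Ico_subset_Ico ha hb) fun x hx _ => ?_
    rw [Finset.mem_Ico] at hx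
    exact (hg x hx.1 hx.2).nonneg u v
  have hnn : ∀ u v, 0 ≤ ∑ x ∈ Finset.Ico lo hi, g x u v := fun u v =>
    Finset.sum_nonneg fun x hx => by
      rw [Finset.mem_Ico] at hx
      exact (hg x hx.1 hx.2).nonneg u v
  rcases le_total a b with hab | hab
  · refine ⟨_, Flow.sum hab fun x h h' => hg x (ha.trans h) (h'.trans_le hb'), fun u v => ?_⟩
    rw [Finset.sum_add_distrib]
    linarith [key a b u v ha hb', hnn v u]
  · refine ⟨_, (Flow.sum hab fun x h h' => hg x (hb.trans h) (h'.trans_le ha')).reverse hsymm,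
      fun u v => ?_⟩
    rw [Finset.sum_add_distrib]
    linarith [key b a v u hb ha', hnn u v]

/-- Grouping the commodities by their row or column, each of which is shared by at most `R` of them.
-/
lemma sum_comp_le {M : ℕ} {R : ℝ} (b : Fin n → ℕ) (hb : ∀ k, b k < M)
    (hR : ∀ y, ((Finset.univ.filter fun k => b k = y).card : ℝ) ≤ R) (φ : ℕ → ℝ)
    (hφ : ∀ y < M, 0 ≤ φ y) : ∑ k, φ (b k) ≤ R * ∑ y ∈ Finset.range M, φ y := by
  rw [← Finset.sum_fiberwise_of_maps_to (t := Finset.range M) (g := b)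
    (fun k _ => Finset.mem_range.2 (hb k)), Finset.mul_sum]
  refine Finset.sum_le_sum fun y hy => ?_
  rw [Finset.sum_congr rfl (g := fun _ => φ y) fun k hk => by rw [(Finset.mem_filter.1 hk).2],
    Finset.sum_const, nsmul_eq_mul]
  exact mul_le_mul_of_nonneg_right (hR y) (hφ y (Finset.mem_range.1 hy))

/-- Routing over a grid of hubs: commodities travel from their source to a hub, then along the
row of this hub and the column of the hub of the destination, and then to the destination. -/
theorem exists_feasibleFlow_of_hubs (hsymm : ∀ u v, link u v → link v u) {σ : Equiv.Perm (Fin n)}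
    (hσ : ∀ k, σ k ≠ k) {M : ℕ} (b₁ b₂ : Fin n → ℕ) (hb₁ : ∀ k, b₁ k < M) (hb₂ : ∀ k, b₂ k < M)
    (μ : ℕ → ℕ → Fin n → ℝ) (gH gV : ℕ → ℕ → Fin n → Fin n → ℝ)
    (hH : ∀ x y, x + 1 < M → y < M → Flow link (gH x y) (μ x y) (μ (x + 1) y))
    (hV : ∀ x y, x < M → y + 1 < M → Flow link (gV x y) (μ x y) (μ x (y + 1)))
    (acc : Fin n → Fin n → Fin n → ℝ)
    (hacc : ∀ k, Flow link (acc k) (unif {k}) (μ (b₁ k) (b₂ k)))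
    {R Λ₁ Λ₂ cap l : ℝ} (hΛ₁ : ∀ u v, ∑ k, acc k u v ≤ Λ₁)
    (hR₁ : ∀ x, ((Finset.univ.filter fun k => b₁ k = x).card : ℝ) ≤ R)
    (hR₂ : ∀ y, ((Finset.univ.filter fun k => b₂ k = y).card : ℝ) ≤ R)
    (hΛH : ∀ u v, ∑ y ∈ Finset.range M, ∑ x ∈ Finset.Ico 0 (M - 1), gH x y u v ≤ Λ₂)
    (hΛV : ∀ u v, ∑ x ∈ Finset.range M, ∑ y ∈ Finset.Ico 0 (M - 1), gV x y u v ≤ Λ₂)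
    (hl : 0 ≤ l) (hcap : l * (2 * Λ₁ + 4 * (R * Λ₂)) ≤ cap) :
    ∃ f, IsFeasibleFlow link σ cap l f := by
  have hrow : ∀ k, ∃ h, Flow link h (μ (b₁ k) (b₂ k)) (μ (b₁ (σ k)) (b₂ k)) ∧
      ∀ u v, h u v ≤ ∑ x ∈ Finset.Ico 0 (M - 1), (gH x (b₂ k) u v + gH x (b₂ k) v u) := fun k =>
    Flow.chain hsymm (ν := fun x => μ x (b₂ k)) (g := fun x => gH x (b₂ k))
      (fun x _ hx => hH x _ (by omega) (hb₂ k)) (Nat.zero_le _) (by have := hb₁ k; omega)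
      (Nat.zero_le _) (by have := hb₁ (σ k); omega)
  have hcol : ∀ k, ∃ h, Flow link h (μ (b₁ (σ k)) (b₂ k)) (μ (b₁ (σ k)) (b₂ (σ k))) ∧
      ∀ u v, h u v ≤ ∑ y ∈ Finset.Ico 0 (M - 1), (gV (b₁ (σ k)) y u v + gV (b₁ (σ k)) y v u) :=
    fun k => Flow.chain hsymm (ν := fun y => μ (b₁ (σ k)) y) (g := fun y => gV (b₁ (σ k)) y)
      (fun y _ hy => hV _ y (hb₁ _) (by omega)) (Nat.zero_le _) (by have := hb₂ k; omega)
      (Nat.zero_le _) (by have := hb₂ (σ k); omega)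
  choose hr hr1 hr2 using hrow
  choose hc hc1 hc2 using hcol
  -- The last leg is the access flow of the destination run backwards.
  have htot : ∀ k, Flow link
      (fun u v => acc k u v + hr k u v + hc k u v + acc (σ k) v u) (unif {k}) (unif {σ k}) :=
    fun k => (((hacc k).add (hr1 k)).add (hc1 k)).add ((hacc (σ k)).reverse hsymm)
  have hnnH : ∀ u v, ∀ y < M, 0 ≤ ∑ x ∈ Finset.Ico 0 (M - 1), (gH x y u v + gH x y v u) :=
    fun u v y hy => Finset.sum_nonneg fun x hx => by
      rw [Finset.mem_Ico] at hx
      have h := hH x y (by omega) hy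
      exact add_nonneg (h.nonneg u v) (h.nonneg v u)
  have hnnV : ∀ u v, ∀ x < M, 0 ≤ ∑ y ∈ Finset.Ico 0 (M - 1), (gV x y u v + gV x y v u) :=
    fun u v x hx => Finset.sum_nonneg fun y hy => by
      rw [Finset.mem_Ico] at hy
      have h := hV x y hx (by omega)
      exact add_nonneg (h.nonneg u v) (h.nonneg v u)
  have hload : ∀ u v, ∑ k, (acc k u v + hr k u v + hc k u v + acc (σ k) v u)
      ≤ 2 * Λ₁ + 4 * (R * Λ₂) := by
    intro u v
    have hR0 : 0 ≤ R := (Nat.cast_nonneg _).trans (hR₁ 0)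
    have e1 : ∑ k, hr k u v ≤ R * (2 * Λ₂) := by
      refine (Finset.sum_le_sum fun k _ => hr2 k u v).trans ?_
      refine (sum_comp_le b₂ hb₂ hR₂
        (fun y => ∑ x ∈ Finset.Ico 0 (M - 1), (gH x y u v + gH x y v u)) (hnnH u v)).trans ?_
      refine mul_le_mul_of_nonneg_left ?_ hR0
      simp only [Finset.sum_add_distrib]
      linarith [hΛH u v, hΛH v u]
    have e2 : ∑ k, hc k u v ≤ R * (2 * Λ₂) := by
      refine (Finset.sum_le_sum fun k _ => hc2 k u v).trans ?_
      -- The column used is that of the destination. Since `σ` is a bijection, columns are shared no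
      -- more heavily by destinations than by sources.
      rw [Equiv.sum_comp σ fun k => ∑ y ∈ Finset.Ico 0 (M - 1), (gV (b₁ k) y u v + gV (b₁ k) y v u)]
      refine (sum_comp_le b₁ hb₁ hR₁
        (fun x => ∑ y ∈ Finset.Ico 0 (M - 1), (gV x y u v + gV x y v u)) (hnnV u v)).trans ?_
      refine mul_le_mul_of_nonneg_left ?_ hR0
      simp only [Finset.sum_add_distrib]
      linarith [hΛV u v, hΛV v u]
    have e3 : ∑ k, acc (σ k) v u ≤ Λ₁ := by
      rw [Equiv.sum_comp σ fun k => acc k v u]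
      exact hΛ₁ v u
    simp only [Finset.sum_add_distrib]
    linarith [hΛ₁ u v]
  refine ⟨fun k u v => l * (acc k u v + hr k u v + hc k u v + acc (σ k) v u), ?_, ?_, ?_, ?_, ?_⟩
  · exact fun k u v => mul_nonneg hl ((htot k).nonneg u v)
  · exact fun k u v h => by rw [(htot k).support u v h, mul_zero]
  · intro u v
    rw [← Finset.mul_sum]
    exact (mul_le_mul_of_nonneg_left (hload u v) hl).trans hcap
  · intro k u h1 h2
    have h := (htot k).balance u
    simp only [unif, Finset.mem_singleton, h1, h2, if_false, sub_zero] at h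
    rw [← Finset.mul_sum, ← Finset.mul_sum, sub_eq_zero.1 h]
  · intro k
    have h := (htot k).balance k
    simp only [unif, Finset.mem_singleton, (hσ k).symm, if_true, if_false,
      Finset.card_singleton, Nat.cast_one, div_one, sub_zero] at h
    rw [← Finset.mul_sum, ← Finset.mul_sum, ← mul_sub, h, mul_one]

lemma IsFeasibleFlow.mono {link' : Fin n → Fin n → Prop} (h : ∀ u v, link u v → link' u v)
    {σ : Equiv.Perm (Fin n)} {cap l : ℝ} {f : Fin n → Fin n → Fin n → ℝ}
    (hf : IsFeasibleFlow link σ cap l f) : IsFeasibleFlow link' σ cap l f where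
  nonneg := hf.nonneg
  support := fun k u v huv => hf.support k u v fun h' => huv (h u v h')
  capacity := hf.capacity
  conservation := hf.conservation
  rate := hf.rate

/-- A crude bound from the links leaving one source; it makes the set in the definition of
`throughput` bounded, so that its supremum is meaningful. -/
lemma IsFeasibleFlow.le_card_mul {σ : Equiv.Perm (Fin n)} {cap l : ℝ}
    {f : Fin n → Fin n → Fin n → ℝ} (hf : IsFeasibleFlow link σ cap l f) (k : Fin n) :
    l ≤ n * cap := by
  rw [← hf.rate k]
  have h1 : 0 ≤ ∑ v, f k v k := Finset.sum_nonneg fun v _ => hf.nonneg _ _ _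
  have h2 : ∑ v, f k k v ≤ ∑ v : Fin n, cap := Finset.sum_le_sum fun v _ =>
    (Finset.single_le_sum (f := fun j => f j k v) (fun j _ => hf.nonneg _ _ _)
      (Finset.mem_univ k)).trans (hf.capacity k v)
  simp at h2
  linarith

lemma IsFeasibleFlow.le_throughput {X : Fin n → Plane} {r : ℝ} {σ : Equiv.Perm (Fin n)}
    {cap l : ℝ} {f : Fin n → Fin n → Fin n → ℝ} (hn : 0 < n)
    (hf : IsFeasibleFlow (Link X r) σ cap l f) : l ≤ throughput X r σ cap := by
  refine le_csSup ⟨n * cap, ?_⟩ ⟨f, hf⟩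
  rintro l' ⟨f', hf'⟩
  exact hf'.le_card_mul ⟨0, hn⟩

lemma IsFeasibleFlow.zero {σ : Equiv.Perm (Fin n)} {cap : ℝ} (hcap : 0 ≤ cap) :
    IsFeasibleFlow link σ cap 0 fun _ _ _ => 0 where
  nonneg := fun _ _ _ => le_rfl
  support := fun _ _ _ _ => rfl
  capacity := fun _ _ => by simpa using hcap
  conservation := fun _ _ _ _ => rfl
  rate := fun _ => by simp

/-- The commodities that have to cross a cut are bounded by the capacity of the cut. -/
lemma IsFeasibleFlow.cut_bound {σ : Equiv.Perm (Fin n)} {cap l : ℝ}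
    {f : Fin n → Fin n → Fin n → ℝ} (hf : IsFeasibleFlow link σ cap l f) (A : Finset (Fin n)) :
    ((Finset.univ.filter fun k => k ∈ A ∧ σ k ∉ A).card : ℝ) * l
      ≤ cap * ((A ×ˢ Aᶜ).filter fun e => link e.1 e.2).card := by
  have h1 : ∀ k ∈ Finset.univ.filter fun k => k ∈ A ∧ σ k ∉ A,
      l ≤ ∑ u ∈ A, ∑ v ∈ Aᶜ, f k u v := by
    intro k hk
    obtain ⟨-, hkA, hσA⟩ := Finset.mem_filter.1 hk
    -- Only the source contributes to the net outflow of `A`, as the destination is outside.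
    have e1 : ∑ u ∈ A, (∑ v, f k u v - ∑ v, f k v u) = l := by
      rw [Finset.sum_eq_single_of_mem k hkA, hf.rate k]
      intro u hu huk
      rw [hf.conservation k u huk (fun h => hσA (h ▸ hu)), sub_self]
    have e2 : ∑ u ∈ A, (∑ v, f k u v - ∑ v, f k v u)
        = ∑ u ∈ A, ∑ v ∈ Aᶜ, f k u v - ∑ u ∈ A, ∑ v ∈ Aᶜ, f k v u := by
      have e3 : ∀ g : Fin n → ℝ, ∑ v, g v = ∑ v ∈ A, g v + ∑ v ∈ Aᶜ, g v := fun g =>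
        (Finset.sum_add_sum_compl A g).symm
      rw [Finset.sum_sub_distrib]
      simp only [e3 (fun v => f k _ v), e3 (fun v => f k v _), Finset.sum_add_distrib]
      rw [Finset.sum_comm (s := A) (t := A)]
      ring
    have e4 : 0 ≤ ∑ u ∈ A, ∑ v ∈ Aᶜ, f k v u :=
      Finset.sum_nonneg fun _ _ => Finset.sum_nonneg fun _ _ => hf.nonneg _ _ _
    linarith
  have h2 : ∀ u v, ∑ k ∈ Finset.univ.filter (fun k => k ∈ A ∧ σ k ∉ A), f k u v
      ≤ if link u v then cap else 0 := by
    intro u v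
    split_ifs with h
    · refine le_trans ?_ (hf.capacity u v)
      exact Finset.sum_le_sum_of_subset_of_nonneg (Finset.subset_univ _)
        fun _ _ _ => hf.nonneg _ _ _
    · exact (Finset.sum_eq_zero fun k _ => hf.support k u v h).le
  calc ((Finset.univ.filter fun k => k ∈ A ∧ σ k ∉ A).card : ℝ) * l
      = ∑ k ∈ Finset.univ.filter (fun k => k ∈ A ∧ σ k ∉ A), l := by simp
    _ ≤ ∑ k ∈ Finset.univ.filter (fun k => k ∈ A ∧ σ k ∉ A), ∑ u ∈ A, ∑ v ∈ Aᶜ, f k u v :=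
        Finset.sum_le_sum h1
    _ = ∑ u ∈ A, ∑ v ∈ Aᶜ, ∑ k ∈ Finset.univ.filter (fun k => k ∈ A ∧ σ k ∉ A), f k u v := by
        rw [Finset.sum_comm]
        exact Finset.sum_congr rfl fun u _ => Finset.sum_comm
    _ ≤ ∑ u ∈ A, ∑ v ∈ Aᶜ, if link u v then cap else 0 :=
        Finset.sum_le_sum fun u _ => Finset.sum_le_sum fun v _ => h2 u v
    _ = _ := by
        rw [← Finset.sum_product', ← Finset.sum_filter]
        simp [mul_comm]

end Flow

/-! ### Nodes in tiles and routing through well filled tiles -/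

section TileNodes

variable {n m : ℕ} {X : Fin n → Plane} {r : ℝ}

/-- Distinct nodes within range of each other. -/
def Near (X : Fin n → Plane) (r : ℝ) (i j : Fin n) : Prop := i ≠ j ∧ dist (X i) (X j) ≤ r

lemma Near.symm {i j : Fin n} (h : Near X r i j) : Near X r j i :=
  ⟨h.1.symm, by rw [dist_comm]; exact h.2⟩

lemma GenPos.near_imp_link (h : GenPos X) {r' : ℝ} (hr : r ≤ r') {i j : Fin n}
    (hij : Near X r i j) : Link X r' i j :=
  h.link_iff.2 ⟨hij.1, hij.2.trans hr⟩

/-- The set of nodes in a tile. -/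
def tileNodes (X : Fin n → Plane) (m a b : ℕ) : Finset (Fin n) :=
  Finset.univ.filter fun i => X i ∈ tile m a b

lemma card_tileNodes (a b : ℕ) : (tileNodes X m a b).card = cnt X (tile m a b) := rfl

lemma mem_tileNodes (hm : 0 < m) (hX : ∀ i, X i ∈ openSquare) {a b : ℕ} {i : Fin n} :
    i ∈ tileNodes X m a b ↔ cell m (X i) 0 = a ∧ cell m (X i) 1 = b := by
  rw [tileNodes, Finset.mem_filter, mem_tile_iff hm (hX i)]
  simp

lemma mem_tileNodes_self (hm : 0 < m) (hX : ∀ i, X i ∈ openSquare) (i : Fin n) :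
    i ∈ tileNodes X m (cell m (X i) 0) (cell m (X i) 1) :=
  (mem_tileNodes hm hX).2 ⟨rfl, rfl⟩

lemma abs_coord_sub_le (hm : 0 < m) (hX : ∀ i, X i ∈ openSquare) {i j : Fin n} {k : Fin 2} {d : ℕ}
    (h1 : cell m (X i) k ≤ cell m (X j) k + d) (h2 : cell m (X j) k ≤ cell m (X i) k + d) :
    |X i k - X j k| ≤ ((d : ℝ) + 1) / m := by
  have hm' : (0:ℝ) < m := by exact_mod_cast hm
  have a1 := cell_le_mul (m := m) (hX i) k
  have a2 := mul_lt_cell (m := m) (X i) k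
  have a3 := cell_le_mul (m := m) (hX j) k
  have a4 := mul_lt_cell (m := m) (X j) k
  have b1 : (cell m (X i) k : ℝ) ≤ cell m (X j) k + d := by exact_mod_cast h1
  have b2 : (cell m (X j) k : ℝ) ≤ cell m (X i) k + d := by exact_mod_cast h2
  rw [le_div_iff₀ hm']
  rw [show |X i k - X j k| * m = |(X i k - X j k) * m| by rw [abs_mul, Nat.abs_cast], abs_le]
  constructor <;> linarith

lemma cell_lt_of_dist_le (hX : ∀ i, X i ∈ openSquare) (hmr : m * r ≤ 6) {i j : Fin n}
    (h : dist (X i) (X j) ≤ r) (k : Fin 2) : cell m (X i) k < cell m (X j) k + 7 := by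
  have a1 := cell_le_mul (m := m) (hX i) k
  have a4 := mul_lt_cell (m := m) (X j) k
  have h1 : X i k - X j k ≤ r := (le_abs_self _).trans ((abs_sub_le_dist _ _ k).trans h)
  have h2 : m * (X i k - X j k) ≤ m * r := by gcongr
  have : (cell m (X i) k : ℝ) < cell m (X j) k + 7 := by linarith
  exact_mod_cast this

/-- The condition `4 ≤ m * r` is exactly what the crude bound `2 / m + 2 / m` on the distance needs.
-/
lemma near_of_cell_le_one (hm : 0 < m) (hX : ∀ i, X i ∈ openSquare) (hmr : 4 ≤ m * r) {i j : Fin n}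
    (hne : i ≠ j) (k : Fin 2)
    (h1 : cell m (X i) k ≤ cell m (X j) k + 1) (h2 : cell m (X j) k ≤ cell m (X i) k + 1)
    (h3 : ∀ k', k' ≠ k → cell m (X i) k' = cell m (X j) k') : Near X r i j := by
  have hm' : (0:ℝ) < m := by exact_mod_cast hm
  refine ⟨hne, (dist_le_add _ _).trans ?_⟩
  have key : ∀ k', |X i k' - X j k'| ≤ ((1:ℕ) + 1 : ℝ) / m := by
    intro k'
    by_cases h : k' = k
    · exact abs_coord_sub_le hm hX (h ▸ h1) (h ▸ h2)
    · exact abs_coord_sub_le hm hX (by rw [h3 k' h]; omega) (by rw [h3 k' h]; omega)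
  have : ((1:ℕ) + 1 : ℝ) / m + ((1:ℕ) + 1 : ℝ) / m ≤ r := by
    rw [← add_div, div_le_iff₀ hm']; push_cast; linarith
  linarith [key 0, key 1]

lemma near_right (hm : 0 < m) (hX : ∀ i, X i ∈ openSquare) (hmr : 4 ≤ m * r) {a b : ℕ} {i j : Fin n}
    (hi : i ∈ tileNodes X m a b) (hj : j ∈ tileNodes X m (a + 1) b) : Near X r i j := by
  rw [mem_tileNodes hm hX] at hi hj
  refine near_of_cell_le_one hm hX hmr (fun h => ?_) 0 (by omega) (by omega) fun k' hk' => ?_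
  · subst h; omega
  · have : k' = 1 := by fin_cases k' <;> simp_all
    rw [this]; omega

lemma near_up (hm : 0 < m) (hX : ∀ i, X i ∈ openSquare) (hmr : 4 ≤ m * r) {a b : ℕ} {i j : Fin n}
    (hi : i ∈ tileNodes X m a b) (hj : j ∈ tileNodes X m a (b + 1)) : Near X r i j := by
  rw [mem_tileNodes hm hX] at hi hj
  refine near_of_cell_le_one hm hX hmr (fun h => ?_) 1 (by omega) (by omega) fun k' hk' => ?_
  · subst h; omega
  · have : k' = 0 := by fin_cases k' <;> simp_all
    rw [this]; omega

/-- The nodes whose tile lies in a given box are few if every tile has few nodes. -/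
lemma card_cell_mem_le (hm : 0 < m) (hX : ∀ i, X i ∈ openSquare) {u : ℝ} (hu : TilesUpper X m u)
    (I J : Finset ℕ) :
    ((Finset.univ.filter fun i => cell m (X i) 0 ∈ I ∧ cell m (X i) 1 ∈ J).card : ℝ)
      ≤ I.card * J.card * u := by
  have hu0 : 0 ≤ u := (Nat.cast_nonneg _).trans (hu 0 hm 0 hm)
  have hsub : (Finset.univ.filter fun i => cell m (X i) 0 ∈ I ∧ cell m (X i) 1 ∈ J)
      ⊆ (I ×ˢ J).biUnion fun t => tileNodes X m t.1 t.2 := by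
    intro i hi
    simp only [Finset.mem_filter, Finset.mem_univ, true_and] at hi
    rw [Finset.mem_biUnion]
    exact ⟨(cell m (X i) 0, cell m (X i) 1), Finset.mem_product.2 hi, mem_tileNodes_self hm hX i⟩
  have h1 : ((Finset.univ.filter fun i => cell m (X i) 0 ∈ I ∧ cell m (X i) 1 ∈ J).card : ℝ)
      ≤ ∑ t ∈ I ×ˢ J, ((tileNodes X m t.1 t.2).card : ℝ) := by
    exact_mod_cast (Finset.card_le_card hsub).trans Finset.card_biUnion_le
  refine h1.trans ?_
  calc _ ≤ ∑ t ∈ I ×ˢ J, u := by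
        refine Finset.sum_le_sum fun t _ => ?_
        by_cases ht : t.1 < m ∧ t.2 < m
        · exact hu _ ht.1 _ ht.2
        · have : tileNodes X m t.1 t.2 = ∅ := by
            rw [Finset.eq_empty_iff_forall_notMem]
            intro i hi
            rw [mem_tileNodes hm hX] at hi
            exact ht ⟨hi.1 ▸ cell_lt hm (hX i) 0, hi.2 ▸ cell_lt hm (hX i) 1⟩
          simpa [this] using hu0
    _ = _ := by simp

lemma card_cell_mem_zero_le (hm : 0 < m) (hX : ∀ i, X i ∈ openSquare) {u : ℝ}
    (hu : TilesUpper X m u) (I : Finset ℕ) :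
    ((Finset.univ.filter fun i => cell m (X i) 0 ∈ I).card : ℝ) ≤ I.card * m * u := by
  have h := card_cell_mem_le hm hX hu I (Finset.range m)
  rw [Finset.card_range] at h
  refine le_trans ?_ h
  refine Nat.cast_le.2 (Finset.card_le_card fun i hi => ?_)
  simp only [Finset.mem_filter, Finset.mem_univ, true_and, Finset.mem_range] at hi ⊢
  exact ⟨hi, cell_lt hm (hX i) 1⟩

lemma card_cell_mem_one_le (hm : 0 < m) (hX : ∀ i, X i ∈ openSquare) {u : ℝ}
    (hu : TilesUpper X m u) (J : Finset ℕ) :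
    ((Finset.univ.filter fun i => cell m (X i) 1 ∈ J).card : ℝ) ≤ J.card * m * u := by
  have h := card_cell_mem_le hm hX hu (Finset.range m) J
  rw [Finset.card_range] at h
  refine le_trans ?_ (h.trans (by rw [mul_comm (m:ℝ)]))
  refine Nat.cast_le.2 (Finset.card_le_card fun i hi => ?_)
  simp only [Finset.mem_filter, Finset.mem_univ, true_and, Finset.mem_range] at hi ⊢
  exact ⟨cell_lt hm (hX i) 0, hi⟩

lemma spread_le_ite {T T' : Finset (Fin n)} {a : ℝ} (ha : 0 < a) (hT : a ≤ T.card)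
    (hT' : a ≤ T'.card) (u v : Fin n) :
    spread T T' u v ≤ if u ∈ T then 1 / a ^ 2 else 0 := by
  split_ifs with h
  · exact spread_le ha hT hT' u v
  · simp [spread, h]

/-- If every tile contains many nodes, all traffic can be routed through the grid of tiles. -/
theorem exists_feasibleFlow_of_full_tiles (hm : 2 ≤ m) (hX : ∀ i, X i ∈ openSquare)
    (hmr : 4 ≤ m * r) {A u : ℝ} (hA : 0 < A)
    (hgood : ∀ a < m, ∀ b < m, A ≤ cnt X (tile m a b)) (hu : TilesUpper X m u)
    {σ : Equiv.Perm (Fin n)} (hσ : ∀ k, σ k ≠ k) {cap l : ℝ} (hl : 0 ≤ l)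
    (hcap : l * (2 * (1 / A) + 4 * (2 * m * u * (1 / A ^ 2))) ≤ cap) :
    ∃ f, IsFeasibleFlow (Near X r) σ cap l f := by
  have hm0 : 0 < m := by omega
  have hu0 : 0 ≤ u := (Nat.cast_nonneg _).trans (hu 0 hm0 0 hm0)
  have hne : ∀ a < m, ∀ b < m, (tileNodes X m a b).Nonempty := fun a ha b hb => by
    rw [← Finset.card_pos]
    have := hA.trans_le (hgood a ha b hb)
    rw [← card_tileNodes] at this
    exact_mod_cast this
  -- The hub of a node is a horizontally adjacent tile rather than its own one: spreading over its
  -- own tile would need a link from the node to itself.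
  set b₁ : Fin n → ℕ := fun k =>
    if cell m (X k) 0 + 1 < m then cell m (X k) 0 + 1 else cell m (X k) 0 - 1 with hb₁
  have hc0 : ∀ k, cell m (X k) 0 < m := fun k => cell_lt hm0 (hX k) 0
  have hc1 : ∀ k, cell m (X k) 1 < m := fun k => cell_lt hm0 (hX k) 1
  have hb₁m : ∀ k, b₁ k < m := fun k => by
    have := hc0 k
    simp only [hb₁]; split_ifs <;> omega
  have hlink : ∀ k, ∀ u ∈ ({k} : Finset (Fin n)),
      ∀ v ∈ tileNodes X m (b₁ k) (cell m (X k) 1), Near X r u v := by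
    intro k u hu v hv
    rw [Finset.mem_singleton] at hu
    subst hu
    simp only [hb₁] at hv
    have hself := mem_tileNodes_self hm0 hX u
    split_ifs at hv with h
    · exact near_right hm0 hX hmr hself hv
    · have : cell m (X u) 0 = (cell m (X u) 0 - 1) + 1 := by have := hc0 u; omega
      rw [this] at hself
      exact (near_right hm0 hX hmr hv hself).symm
  refine exists_feasibleFlow_of_hubs (fun u v h => h.symm) hσ (M := m) b₁
    (fun k => cell m (X k) 1) hb₁m hc1 (fun x y => unif (tileNodes X m x y))
    (fun x y => spread (tileNodes X m x y) (tileNodes X m (x + 1) y))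
    (fun x y => spread (tileNodes X m x y) (tileNodes X m x (y + 1)))
    (fun x y hx hy => Flow.spread (hne _ (by omega) _ hy) (hne _ hx _ hy)
      fun u hu v hv => near_right hm0 hX hmr hu hv)
    (fun x y hx hy => Flow.spread (hne _ hx _ (by omega)) (hne _ hx _ hy)
      fun u hu v hv => near_up hm0 hX hmr hu hv)
    (fun k => spread {k} (tileNodes X m (b₁ k) (cell m (X k) 1)))
    (fun k => Flow.spread (Finset.singleton_nonempty k) (hne _ (hb₁m k) _ (hc1 k)) (hlink k))
    ?_ ?_ ?_ ?_ ?_ hl hcap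
  · intro u v
    rw [Finset.sum_eq_single_of_mem u (Finset.mem_univ u)]
    · unfold spread
      split_ifs
      · rw [Finset.card_singleton, Nat.cast_one, one_mul]
        have := hgood _ (hb₁m u) _ (hc1 u)
        rw [← card_tileNodes] at this
        gcongr
      · positivity
    · intro k _ hk
      simp [spread, hk.symm]
  · intro x
    -- The nodes with hub column `x` lie in the two neighbouring columns, whence the factor `2`.
    have h := card_cell_mem_zero_le hm0 hX hu {x - 1, x + 1}
    refine (Nat.cast_le.2 (Finset.card_le_card fun k hk => ?_)).trans (h.trans ?_)
    · simp only [Finset.mem_filter, Finset.mem_univ, true_and, hb₁, Finset.mem_insert,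
        Finset.mem_singleton] at hk ⊢
      have := hc0 k
      split_ifs at hk <;> omega
    · have : ((({x - 1, x + 1} : Finset ℕ).card : ℕ) : ℝ) ≤ 2 := by
        exact_mod_cast Finset.card_le_two
      gcongr
  · intro y
    have h := card_cell_mem_one_le hm0 hX hu {y}
    simp only [Finset.mem_singleton, Finset.card_singleton, Nat.cast_one, one_mul] at h
    refine h.trans ?_
    have : 0 ≤ m * u := by positivity
    linarith
  · intro u v
    -- Only the step that starts in the tile of `u` uses links out of `u`, so the double sum has at
    -- most one nonzero term.
    calc _ ≤ ∑ y ∈ Finset.range m, ∑ x ∈ Finset.Ico 0 (m - 1),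
          (if x = cell m (X u) 0 then (if y = cell m (X u) 1 then 1 / A ^ 2 else 0) else 0) := by
          refine Finset.sum_le_sum fun y hy => Finset.sum_le_sum fun x hx => ?_
          rw [Finset.mem_range] at hy
          rw [Finset.mem_Ico] at hx
          refine (spread_le_ite (T := tileNodes X m x y) (T' := tileNodes X m (x + 1) y) hA
            (hgood x (by omega) y hy) (hgood (x + 1) (by omega) y hy) u v).trans ?_
          simp only [mem_tileNodes hm0 hX]
          split_ifs <;> first | exact le_rfl | positivity | omega
      _ ≤ ∑ y ∈ Finset.range m, (if y = cell m (X u) 1 then 1 / A ^ 2 else 0) := by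
          refine Finset.sum_le_sum fun y _ => ?_
          rw [Finset.sum_ite_eq']
          split_ifs <;> first | exact le_rfl | positivity
      _ ≤ 1 / A ^ 2 := by
          rw [Finset.sum_ite_eq']
          split_ifs <;> first | exact le_rfl | positivity
  · intro u v
    calc _ ≤ ∑ x ∈ Finset.range m, ∑ y ∈ Finset.Ico 0 (m - 1),
          (if y = cell m (X u) 1 then (if x = cell m (X u) 0 then 1 / A ^ 2 else 0) else 0) := by
          refine Finset.sum_le_sum fun x hx => Finset.sum_le_sum fun y hy => ?_
          rw [Finset.mem_range] at hx
          rw [Finset.mem_Ico] at hy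
          refine (spread_le_ite (T := tileNodes X m x y) (T' := tileNodes X m x (y + 1)) hA
            (hgood x hx y (by omega)) (hgood x hx (y + 1) (by omega)) u v).trans ?_
          simp only [mem_tileNodes hm0 hX]
          split_ifs <;> first | exact le_rfl | positivity | omega
      _ ≤ ∑ x ∈ Finset.range m, (if x = cell m (X u) 0 then 1 / A ^ 2 else 0) := by
          refine Finset.sum_le_sum fun y _ => ?_
          rw [Finset.sum_ite_eq']
          split_ifs <;> first | exact le_rfl | positivity
      _ ≤ 1 / A ^ 2 := by
          rw [Finset.sum_ite_eq']
          split_ifs <;> first | exact le_rfl | positivity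

end TileNodes

/-! ### Flows inside a region with bounded load per link -/

section Reach

variable {n : ℕ} {link : Fin n → Fin n → Prop} {Z Z' : Set (Fin n)} {b b' : ℝ}
  {μ ν ρ : Fin n → ℝ}

/-- There is a flow from `μ` to `ν` inside `Z` that uses each link at most to the extent `b`. -/
def Reach (link : Fin n → Fin n → Prop) (Z : Set (Fin n)) (b : ℝ) (μ ν : Fin n → ℝ) : Prop :=
  ∃ g, Flow link g μ ν ∧ ∀ u v, g u v ≤ if u ∈ Z ∧ v ∈ Z then b else 0

lemma Reach.refl (μ : Fin n → ℝ) (hb : 0 ≤ b) : Reach link Z b μ μ :=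
  ⟨_, Flow.zero μ, fun u v => by split_ifs <;> first | exact hb | exact le_rfl⟩

lemma Reach.trans (h : Reach link Z b μ ν) (h' : Reach link Z b' ν ρ) :
    Reach link Z (b + b') μ ρ := by
  obtain ⟨g, hg, hg'⟩ := h
  obtain ⟨f, hf, hf'⟩ := h'
  refine ⟨_, hg.add hf, fun u v => (add_le_add (hg' u v) (hf' u v)).trans ?_⟩
  split_ifs <;> simp

lemma Reach.mono (h : Reach link Z b μ ν) (hZ : Z ⊆ Z') (hb : b ≤ b') (hb0 : 0 ≤ b') :
    Reach link Z' b' μ ν := by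
  obtain ⟨g, hg, hg'⟩ := h
  refine ⟨g, hg, fun u v => (hg' u v).trans ?_⟩
  by_cases h1 : u ∈ Z ∧ v ∈ Z
  · rw [if_pos h1, if_pos ⟨hZ h1.1, hZ h1.2⟩]; exact hb
  · rw [if_neg h1]; split_ifs <;> first | exact hb0 | exact le_rfl

lemma Reach.spread {T T' : Finset (Fin n)} {a : ℝ} (ha : 0 < a) (hT : a ≤ T.card)
    (hT' : a ≤ T'.card) (hlink : ∀ u ∈ T, ∀ v ∈ T', link u v) (hTZ : ∀ u ∈ T, u ∈ Z)
    (hTZ' : ∀ u ∈ T', u ∈ Z) : Reach link Z (1 / a ^ 2) (unif T) (unif T') := by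
  have h1 : T.Nonempty := by
    rw [← Finset.card_pos]; exact_mod_cast ha.trans_le hT
  have h2 : T'.Nonempty := by
    rw [← Finset.card_pos]; exact_mod_cast ha.trans_le hT'
  refine ⟨_, Flow.spread h1 h2 hlink, fun u v => ?_⟩
  by_cases h : u ∈ T ∧ v ∈ T'
  · rw [if_pos ⟨hTZ u h.1, hTZ' v h.2⟩]
    exact spread_le ha hT hT' u v
  · rw [BeamNetwork.spread, if_neg h]
    split_ifs <;> positivity

lemma Reach.edge {u v : Fin n} (h : u = v ∨ link u v) (hu : u ∈ Z) (hv : v ∈ Z) :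
    Reach link Z 1 (unif {u}) (unif {v}) := by
  rcases h with rfl | h
  · exact Reach.refl _ zero_le_one
  · have := Reach.spread (link := link) (Z := Z) (T := {u}) (T' := {v}) one_pos (by simp) (by simp)
      (by simpa using h) (by simpa using hu) (by simpa using hv)
    simpa using this

/-- Inside a bounded region there is no need to tell the steps apart: the load is the number of
steps times `b`, doubled for the two directions. -/
lemma Reach.chain (hsymm : ∀ u v, link u v → link v u) {ν : ℕ → Fin n → ℝ} {lo hi : ℕ} {b : ℝ}
    (hg : ∀ x, lo ≤ x → x < hi → Reach link Z b (ν x) (ν (x + 1))) {x y : ℕ}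
    (hx : lo ≤ x) (hx' : x ≤ hi) (hy : lo ≤ y) (hy' : y ≤ hi) :
    Reach link Z (2 * (hi - lo : ℕ) * b) (ν x) (ν y) := by
  have : ∀ x, ∃ g, lo ≤ x → x < hi → Flow link g (ν x) (ν (x + 1)) ∧
      ∀ u v, g u v ≤ if u ∈ Z ∧ v ∈ Z then b else 0 := by
    intro x
    by_cases h : lo ≤ x ∧ x < hi
    · obtain ⟨g, hg⟩ := hg x h.1 h.2
      exact ⟨g, fun _ _ => hg⟩
    · exact ⟨fun _ _ => 0, fun h1 h2 => absurd ⟨h1, h2⟩ h⟩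
  choose g hg using this
  obtain ⟨h, h1, h2⟩ := Flow.chain hsymm (ν := ν) (g := g) (fun x h h' => (hg x h h').1) hx hx' hy
    hy'
  refine ⟨h, h1, fun u v => (h2 u v).trans ?_⟩
  calc ∑ x ∈ Finset.Ico lo hi, (g x u v + g x v u)
      ≤ ∑ x ∈ Finset.Ico lo hi, (if u ∈ Z ∧ v ∈ Z then 2 * b else 0) := by
        refine Finset.sum_le_sum fun x hx => ?_
        rw [Finset.mem_Ico] at hx
        have e1 := (hg x hx.1 hx.2).2 u v
        have e2 := (hg x hx.1 hx.2).2 v u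
        simp only [and_comm (a := v ∈ Z)] at e2
        split_ifs at e1 e2 ⊢ <;> linarith
    _ = _ := by
        rw [Finset.sum_const, Nat.card_Ico, nsmul_eq_mul]
        split_ifs <;> ring

/-- A path visits each node once, so the load stays `1` however long it is. A walk would not do, as
it may repeat links. -/
lemma Reach.path {G : SimpleGraph (Fin n)} (hG : ∀ u v, G.Adj u v → link u v) {u v : Fin n}
    (p : G.Walk u v) (hp : p.IsPath) :
    Reach link {w | w ∈ p.support} 1 (unif {u}) (unif {v}) := by
  induction p with
  | nil => exact Reach.refl _ zero_le_one
  | @cons u w v h p ih =>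
    rw [SimpleGraph.Walk.cons_isPath_iff] at hp
    obtain ⟨g, hg, hg'⟩ := ih hp.1
    have hf : Flow link (BeamNetwork.spread {u} {w}) (unif {u}) (unif {w}) :=
      Flow.spread (by simp) (by simp) (by simpa using hG _ _ h)
    refine ⟨_, hf.add hg, fun x y => ?_⟩
    have h1 := hg' x y
    simp only [Set.mem_ofPred_eq, SimpleGraph.Walk.support_cons, List.mem_cons] at h1 ⊢
    by_cases hx : x = u
    · subst hx
      -- The remaining path does not return to `u`, so its flow vanishes on links out of `u`.
      rw [if_neg (fun h => hp.2 h.1)] at h1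
      by_cases hy : y = w
      · subst hy
        simpa [BeamNetwork.spread] using h1
      · simp only [BeamNetwork.spread, Finset.mem_singleton, hy, and_false, if_false, zero_add]
        refine h1.trans ?_
        split_ifs <;> norm_num
    · simp only [BeamNetwork.spread, Finset.mem_singleton, hx, false_and, if_false, zero_add,
        false_or]
      refine h1.trans ?_
      split_ifs <;> first | exact le_rfl | exact zero_le_one | tauto

end Reach

/-! ### Blocks of tiles, well filled rows and columns -/

section Blocks

variable {n m ℓ q k : ℕ} {X : Fin n → Plane} {r A u : ℝ}

/-- The range of the cells that belong to a block of length `ℓ` or to one of its neighbours. -/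
def win (ℓ m B : ℕ) : Finset ℕ := Finset.Ico (ℓ * B - ℓ) (min (ℓ * B + 2 * ℓ) m)

lemma mem_win {B c : ℕ} : c ∈ win ℓ m B ↔ ℓ * B ≤ c + ℓ ∧ c < ℓ * B + 2 * ℓ ∧ c < m := by
  rw [win, Finset.mem_Ico, lt_min_iff]
  omega

/-- The tiles of the row `y` near a block column are well filled. -/
def RowGood (X : Fin n → Plane) (m ℓ : ℕ) (A : ℝ) (B y : ℕ) : Prop :=
  ∀ c ∈ win ℓ m B, A ≤ cnt X (tile m c y)

/-- The tiles of the column `x` near a block row are well filled. -/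
def ColGood (X : Fin n → Plane) (m ℓ : ℕ) (A : ℝ) (B x : ℕ) : Prop :=
  ∀ c ∈ win ℓ m B, A ≤ cnt X (tile m x c)

/-- Otherwise each of `k` rows would contribute a poor tile, giving `k` poor tiles in one window. -/
lemma exists_rowGood (hw : WindowsGood X m k (3 * ℓ) A) (hmq : m = ℓ * q) {B₁ B₂ : ℕ}
    (h₁ : B₁ < q) (h₂ : B₂ < q) (hℓ : 0 < ℓ) {S : Finset ℕ} (hS : S ⊆ win ℓ m B₂)
    (hk : k ≤ S.card) : ∃ y ∈ S, RowGood X m ℓ A B₁ y := by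
  by_contra! hcon
  simp only [RowGood, not_forall, not_le, exists_prop] at hcon
  choose! c hc hc' using hcon
  obtain ⟨T, hTS, hT⟩ := Finset.exists_subset_card_eq hk
  have e1 : ℓ * B₁ < m := by rw [hmq]; exact Nat.mul_lt_mul_of_pos_left h₁ hℓ
  have e2 : ℓ * B₂ < m := by rw [hmq]; exact Nat.mul_lt_mul_of_pos_left h₂ hℓ
  obtain ⟨t, ht, ht'⟩ := hw (ℓ * B₁ - ℓ) (by omega) (ℓ * B₂ - ℓ) (by omega)
    (T.image fun y => (c y, y)) (by
      intro t ht
      rw [Finset.mem_image] at ht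
      obtain ⟨y, hy, rfl⟩ := ht
      have h1 := mem_win.1 (hc y (hTS hy))
      have h2 := mem_win.1 (hS (hTS hy))
      simp only [Finset.mem_product, Finset.mem_Ico]
      omega)
    (by rw [Finset.card_image_of_injective _ (fun a b h => (Prod.mk.inj h).2), hT]) (by
      intro t ht
      rw [Finset.mem_image] at ht
      obtain ⟨y, hy, rfl⟩ := ht
      exact ⟨(mem_win.1 (hc y (hTS hy))).2.2, (mem_win.1 (hS (hTS hy))).2.2⟩)
  rw [Finset.mem_image] at ht
  obtain ⟨y, hy, rfl⟩ := ht
  exact absurd ht' (not_le.2 (hc' y (hTS hy)))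

lemma exists_colGood (hw : WindowsGood X m k (3 * ℓ) A) (hmq : m = ℓ * q) {B₁ B₂ : ℕ}
    (h₁ : B₁ < q) (h₂ : B₂ < q) (hℓ : 0 < ℓ) {S : Finset ℕ} (hS : S ⊆ win ℓ m B₁)
    (hk : k ≤ S.card) : ∃ x ∈ S, ColGood X m ℓ A B₂ x := by
  by_contra! hcon
  simp only [ColGood, not_forall, not_le, exists_prop] at hcon
  choose! c hc hc' using hcon
  obtain ⟨T, hTS, hT⟩ := Finset.exists_subset_card_eq hk
  have e1 : ℓ * B₁ < m := by rw [hmq]; exact Nat.mul_lt_mul_of_pos_left h₁ hℓ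
  have e2 : ℓ * B₂ < m := by rw [hmq]; exact Nat.mul_lt_mul_of_pos_left h₂ hℓ
  obtain ⟨t, ht, ht'⟩ := hw (ℓ * B₁ - ℓ) (by omega) (ℓ * B₂ - ℓ) (by omega)
    (T.image fun y => (y, c y)) (by
      intro t ht
      rw [Finset.mem_image] at ht
      obtain ⟨y, hy, rfl⟩ := ht
      have h1 := mem_win.1 (hc y (hTS hy))
      have h2 := mem_win.1 (hS (hTS hy))
      simp only [Finset.mem_product, Finset.mem_Ico]
      omega)
    (by rw [Finset.card_image_of_injective _ (fun a b h => (Prod.mk.inj h).1), hT]) (by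
      intro t ht
      rw [Finset.mem_image] at ht
      obtain ⟨y, hy, rfl⟩ := ht
      exact ⟨(mem_win.1 (hS (hTS hy))).2.2, (mem_win.1 (hc y (hTS hy))).2.2⟩)
  rw [Finset.mem_image] at ht
  obtain ⟨y, hy, rfl⟩ := ht
  exact absurd ht' (not_le.2 (hc' y (hTS hy)))

/-- The nodes in a block and its neighbours. -/
def zone (X : Fin n → Plane) (m ℓ B₁ B₂ : ℕ) : Set (Fin n) :=
  {v | cell m (X v) 0 ∈ win ℓ m B₁ ∧ cell m (X v) 1 ∈ win ℓ m B₂}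

lemma mem_zone_of_mem_tileNodes (hm : 0 < m) (hX : ∀ i, X i ∈ openSquare) {B₁ B₂ a b : ℕ}
    (ha : a ∈ win ℓ m B₁) (hb : b ∈ win ℓ m B₂) {v : Fin n} (hv : v ∈ tileNodes X m a b) :
    v ∈ zone X m ℓ B₁ B₂ := by
  rw [mem_tileNodes hm hX] at hv
  exact ⟨hv.1 ▸ ha, hv.2 ▸ hb⟩

/-- A window is at most `3 ℓ` tiles wide, and `Reach.chain` doubles the load `1 / A ^ 2` of each
step. -/
lemma reach_row (hm : 0 < m) (hX : ∀ i, X i ∈ openSquare) (hmr : 4 ≤ m * r) (hA : 0 < A)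
    {B₁ B₂ y : ℕ} (hy : y ∈ win ℓ m B₂) (hgood : RowGood X m ℓ A B₁ y) {x x' : ℕ}
    (hx : x ∈ win ℓ m B₁) (hx' : x' ∈ win ℓ m B₁) :
    Reach (Near X r) (zone X m ℓ B₁ B₂) (6 * ℓ / A ^ 2) (unif (tileNodes X m x y))
      (unif (tileNodes X m x' y)) := by
  have hmem : ∀ c, ℓ * B₁ - ℓ ≤ c → c ≤ min (ℓ * B₁ + 2 * ℓ) m - 1 → c ∈ win ℓ m B₁ := by
    intro c h1 h2
    have := mem_win.1 hx
    rw [win, Finset.mem_Ico]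
    omega
  have e1 := mem_win.1 hx
  have e2 := mem_win.1 hx'
  have hch := Reach.chain (Z := zone X m ℓ B₁ B₂) (b := 1 / A ^ 2) (fun u v h => Near.symm h)
    (ν := fun x => unif (tileNodes X m x y))
    (lo := ℓ * B₁ - ℓ) (hi := min (ℓ * B₁ + 2 * ℓ) m - 1) (x := x) (y := x')
    (fun c h1 h2 => by
      have hc := hmem c h1 h2.le
      have hc' := hmem (c + 1) (by omega) h2
      exact Reach.spread hA (hgood c hc) (hgood _ hc') (fun u hu v hv => near_right hm hX hmr hu hv)
        (fun u hu => mem_zone_of_mem_tileNodes hm hX hc hy hu)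
        (fun u hu => mem_zone_of_mem_tileNodes hm hX hc' hy hu))
    (by omega) (by omega) (by omega) (by omega)
  refine hch.mono subset_rfl ?_ (by positivity)
  have h3 : ((min (ℓ * B₁ + 2 * ℓ) m - 1 - (ℓ * B₁ - ℓ) : ℕ) : ℝ) ≤ 3 * ℓ := by
    have : min (ℓ * B₁ + 2 * ℓ) m - 1 - (ℓ * B₁ - ℓ) ≤ 3 * ℓ := by omega
    exact_mod_cast this
  rw [← mul_one_div (6 * ℓ : ℝ)]
  have : 0 < 1 / A ^ 2 := by positivity
  nlinarith

lemma reach_col (hm : 0 < m) (hX : ∀ i, X i ∈ openSquare) (hmr : 4 ≤ m * r) (hA : 0 < A)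
    {B₁ B₂ x : ℕ} (hx : x ∈ win ℓ m B₁) (hgood : ColGood X m ℓ A B₂ x) {y y' : ℕ}
    (hy : y ∈ win ℓ m B₂) (hy' : y' ∈ win ℓ m B₂) :
    Reach (Near X r) (zone X m ℓ B₁ B₂) (6 * ℓ / A ^ 2) (unif (tileNodes X m x y))
      (unif (tileNodes X m x y')) := by
  have hmem : ∀ c, ℓ * B₂ - ℓ ≤ c → c ≤ min (ℓ * B₂ + 2 * ℓ) m - 1 → c ∈ win ℓ m B₂ := by
    intro c h1 h2
    have := mem_win.1 hy
    rw [win, Finset.mem_Ico]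
    omega
  have e1 := mem_win.1 hy
  have e2 := mem_win.1 hy'
  have hch := Reach.chain (Z := zone X m ℓ B₁ B₂) (b := 1 / A ^ 2) (fun u v h => Near.symm h)
    (ν := fun y => unif (tileNodes X m x y))
    (lo := ℓ * B₂ - ℓ) (hi := min (ℓ * B₂ + 2 * ℓ) m - 1) (x := y) (y := y')
    (fun c h1 h2 => by
      have hc := hmem c h1 h2.le
      have hc' := hmem (c + 1) (by omega) h2
      exact Reach.spread hA (hgood c hc) (hgood _ hc') (fun u hu v hv => near_up hm hX hmr hu hv)
        (fun u hu => mem_zone_of_mem_tileNodes hm hX hx hc hu)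
        (fun u hu => mem_zone_of_mem_tileNodes hm hX hx hc' hu))
    (by omega) (by omega) (by omega) (by omega)
  refine hch.mono subset_rfl ?_ (by positivity)
  have h3 : ((min (ℓ * B₂ + 2 * ℓ) m - 1 - (ℓ * B₂ - ℓ) : ℕ) : ℝ) ≤ 3 * ℓ := by
    have : min (ℓ * B₂ + 2 * ℓ) m - 1 - (ℓ * B₂ - ℓ) ≤ 3 * ℓ := by omega
    exact_mod_cast this
  rw [← mul_one_div (6 * ℓ : ℝ)]
  have : 0 < 1 / A ^ 2 := by positivity
  nlinarith

/-- If two nodes within range lie on different sides of a row or column of tiles, then one of them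
is within range of the tile of this row or column that is level with it. -/
lemma near_of_crossing (hm : 0 < m) (hX : ∀ i, X i ∈ openSquare) (hmr : 4 ≤ m * r)
    {i j v w : Fin n} (hij : dist (X i) (X j) ≤ r) (c : Fin 2)
    (hi : cell m (X i) c < cell m (X v) c) (hj : cell m (X v) c < cell m (X j) c)
    (hvw : cell m (X v) c = cell m (X w) c)
    (hvi : ∀ c', c' ≠ c → cell m (X v) c' = cell m (X i) c')
    (hwj : ∀ c', c' ≠ c → cell m (X w) c' = cell m (X j) c') :
    Near X r i v ∨ Near X r j w := by
  have hm' : (0:ℝ) < m := by exact_mod_cast hm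
  have key : ∀ {p s : Fin n} {g : ℕ}, p ≠ s → ((g:ℝ) + 1 ≤ (m * r + 3) / 2) →
      cell m (X p) c ≤ cell m (X s) c + g → cell m (X s) c ≤ cell m (X p) c + g →
      (∀ c', c' ≠ c → cell m (X s) c' = cell m (X p) c') → Near X r p s := by
    intro p s g hps hg h1 h2 h3
    refine ⟨hps, dist_le_of_sq_le (by nlinarith) ?_⟩
    have d1 := abs_coord_sub_le hm hX h1 h2
    have d2 : ∀ c', c' ≠ c → |X p c' - X s c'| ≤ ((0:ℕ) + 1 : ℝ) / m := fun c' hc' =>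
      abs_coord_sub_le hm hX (by rw [h3 c' hc']; omega) (by rw [h3 c' hc']; omega)
    have hsq : ∀ {x y : ℝ}, |x| ≤ y / m → (m * x) ^ 2 ≤ y ^ 2 := by
      intro x y h
      rw [le_div_iff₀ hm'] at h
      refine sq_le_sq' ?_ ?_ <;> cases abs_cases x <;> nlinarith
    have s1 := hsq d1
    have s1' : (m * (X p c - X s c)) ^ 2 ≤ ((m * r + 3) / 2) ^ 2 :=
      s1.trans (by gcongr)
    have main : (m * (X p 0 - X s 0)) ^ 2 + (m * (X p 1 - X s 1)) ^ 2 ≤ (m * r) ^ 2 := by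
      -- Measured in tile sides, the points differ by at most `(m r + 3) / 2` in the direction `c`
      -- and by at most `1` in the other. The inequality holds for `m r ≥ 4`.
      have e : ((m * r + 3) / 2) ^ 2 + 1 ≤ (m * r) ^ 2 := by nlinarith
      fin_cases c
      · have s2 := hsq (d2 1 (by simp))
        simp only [Fin.zero_eta, Nat.cast_zero, zero_add, one_pow] at s1' s2
        linarith
      · have s2 := hsq (d2 0 (by simp))
        simp only [Fin.mk_one, Nat.cast_zero, zero_add, one_pow] at s1' s2
        linarith
    have : (m:ℝ) ^ 2 * ((X p 0 - X s 0) ^ 2 + (X p 1 - X s 1) ^ 2) ≤ (m:ℝ) ^ 2 * r ^ 2 := by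
      nlinarith
    exact le_of_mul_le_mul_left this (by positivity)
  have hd : (cell m (X j) c : ℝ) < cell m (X i) c + m * r + 1 := by
    have a1 := cell_le_mul (m := m) (hX j) c
    have a4 := mul_lt_cell (m := m) (X i) c
    have h1 : X j c - X i c ≤ r := by
      have := (abs_sub_le_dist (X i) (X j) c).trans hij
      rw [abs_sub_comm] at this
      exact (le_abs_self _).trans this
    have h2 : m * (X j c - X i c) ≤ m * r := by gcongr
    linarith
  -- The link spans fewer than `m r + 1` cells, so the end nearer to the row or column is at most
  -- half of that away from it.
  rcases le_total (cell m (X v) c - cell m (X i) c) (cell m (X j) c - cell m (X v) c) with h | h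
  · left
    refine key (g := cell m (X v) c - cell m (X i) c) (fun h => by subst h; omega) ?_
      (by omega) (by omega) hvi
    have : 2 * (cell m (X v) c - cell m (X i) c) + cell m (X i) c ≤ cell m (X j) c := by omega
    have : 2 * ((cell m (X v) c - cell m (X i) c : ℕ) : ℝ) + cell m (X i) c ≤ cell m (X j) c := by
      exact_mod_cast this
    linarith
  · right
    refine key (g := cell m (X j) c - cell m (X v) c) (fun h => by subst h; omega) ?_
      (by omega) (by omega) hwj
    have : 2 * (cell m (X j) c - cell m (X v) c) + cell m (X i) c ≤ cell m (X j) c := by omega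
    have : 2 * ((cell m (X j) c - cell m (X v) c : ℕ) : ℝ) + cell m (X i) c ≤ cell m (X j) c := by
      exact_mod_cast this
    linarith

end Blocks

/-! ### Access of the nodes to the grid of well filled rows and columns -/

section Access

variable {n m ℓ q k : ℕ} {X : Fin n → Plane} {r A : ℝ} {B₁ B₂ : ℕ}

/-- The node lies on a well filled row or column, or within range of a node on one. -/
def Attached (X : Fin n → Plane) (r : ℝ) (m ℓ : ℕ) (A : ℝ) (B₁ B₂ : ℕ) (v : Fin n) : Prop :=
  ∃ a ∈ win ℓ m B₁, ∃ b ∈ win ℓ m B₂, (RowGood X m ℓ A B₁ b ∨ ColGood X m ℓ A B₂ a) ∧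
    ∃ w ∈ tileNodes X m a b, v = w ∨ Near X r v w

/-- The load is `1` for the link to the node `w` on the grid, `1` for spreading from `w` over an
adjacent tile, and `6 ℓ / A ^ 2` each for one row and one column. -/
lemma Attached.reach (hm : 0 < m) (hX : ∀ i, X i ∈ openSquare) (hmr : 4 ≤ m * r) (hA : 1 ≤ A)
    (hmq : m = ℓ * q) (h₁ : B₁ < q) (h₂ : B₂ < q) (hℓ : 2 ≤ ℓ) {κ ρ : ℕ}
    (hκ : κ ∈ win ℓ m B₁) (hρ : ρ ∈ win ℓ m B₂) (hκg : ColGood X m ℓ A B₂ κ)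
    (hρg : RowGood X m ℓ A B₁ ρ) {v : Fin n} (hv : Attached X r m ℓ A B₁ B₂ v)
    (hvz : v ∈ zone X m ℓ B₁ B₂) :
    Reach (Near X r) (zone X m ℓ B₁ B₂) (2 + 12 * ℓ) (unif {v}) (unif (tileNodes X m κ ρ)) := by
  have hA0 : 0 < A := one_pos.trans_le hA
  obtain ⟨a, ha, b, hb, hg, w, hw, hvw⟩ := hv
  have hwz := mem_zone_of_mem_tileNodes hm hX ha hb hw
  have step1 := Reach.edge (link := Near X r) hvw hvz hwz
  have ha' := mem_win.1 ha
  have hb' := mem_win.1 hb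
  have e1 : ℓ * B₁ + ℓ ≤ m := by
    rw [hmq, ← Nat.mul_succ]; exact Nat.mul_le_mul_left _ h₁
  have e2 : ℓ * B₂ + ℓ ≤ m := by
    rw [hmq, ← Nat.mul_succ]; exact Nat.mul_le_mul_left _ h₂
  have hstar : ∀ {a' b'}, a' ∈ win ℓ m B₁ → b' ∈ win ℓ m B₂ → A ≤ cnt X (tile m a' b') →
      (∀ x ∈ tileNodes X m a' b', Near X r w x) →
      Reach (Near X r) (zone X m ℓ B₁ B₂) 1 (unif {w}) (unif (tileNodes X m a' b')) := by
    intro a' b' h1 h2 h3 h4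
    have := Reach.spread (link := Near X r) (Z := zone X m ℓ B₁ B₂) (T := {w})
      (T' := tileNodes X m a' b') one_pos (by simp) (hA.trans h3) (by simpa using h4)
      (by simpa using hwz) (fun u hu => mem_zone_of_mem_tileNodes hm hX h1 h2 hu)
    simpa using this
  have hle : (6 * ℓ / A ^ 2 : ℝ) ≤ 6 * ℓ :=
    div_le_self (by positivity) (one_le_pow₀ hA)
  have hfin : ∀ {a' b'}, a' ∈ win ℓ m B₁ → b' ∈ win ℓ m B₂ → A ≤ cnt X (tile m a' b') →
      (∀ x ∈ tileNodes X m a' b', Near X r w x) →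
      Reach (Near X r) (zone X m ℓ B₁ B₂) (6 * ℓ / A ^ 2 + 6 * ℓ / A ^ 2)
        (unif (tileNodes X m a' b')) (unif (tileNodes X m κ ρ)) →
      Reach (Near X r) (zone X m ℓ B₁ B₂) (2 + 12 * ℓ) (unif {v}) (unif (tileNodes X m κ ρ)) := by
    intro a' b' h1 h2 h3 h4 h5
    exact ((step1.trans (hstar h1 h2 h3 h4)).trans h5).mono subset_rfl (by linarith)
      (by positivity)
  rcases hg with hg | hg
  -- The next tile of the row, or the previous one at the end of the window; not the tile of `w`,
  -- since there are no self-links.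
  · obtain ⟨a', ha'w, hnear⟩ : ∃ a' ∈ win ℓ m B₁, ∀ x ∈ tileNodes X m a' b, Near X r w x := by
      by_cases h : a + 1 ∈ win ℓ m B₁
      · exact ⟨a + 1, h, fun x hx => near_right hm hX hmr hw hx⟩
      · rw [mem_win] at h
        obtain ⟨a', rfl⟩ : ∃ a', a = a' + 1 := ⟨a - 1, by omega⟩
        exact ⟨a', mem_win.2 (by omega), fun x hx => (near_right hm hX hmr hx hw).symm⟩
    exact hfin ha'w hb (hg _ ha'w) hnear ((reach_row hm hX hmr hA0 hb hg ha'w hκ).trans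
      (reach_col hm hX hmr hA0 hκ hκg hb hρ))
  · obtain ⟨b', hb'w, hnear⟩ : ∃ b' ∈ win ℓ m B₂, ∀ x ∈ tileNodes X m a b', Near X r w x := by
      by_cases h : b + 1 ∈ win ℓ m B₂
      · exact ⟨b + 1, h, fun x hx => near_up hm hX hmr hw hx⟩
      · rw [mem_win] at h
        obtain ⟨b', rfl⟩ : ∃ b', b = b' + 1 := ⟨b - 1, by omega⟩
        exact ⟨b', mem_win.2 (by omega), fun x hx => (near_up hm hX hmr hx hw).symm⟩
    exact hfin ha hb'w (hg _ hb'w) hnear ((reach_col hm hX hmr hA0 ha hg hb'w hρ).trans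
      (reach_row hm hX hmr hA0 hρ hρg ha hκ))

/-- Nodes within range of each other on different sides of a well filled row are attached. -/
lemma attached_of_row_between (hm : 0 < m) (hX : ∀ i, X i ∈ openSquare) (hmr : 4 ≤ m * r)
    (hA : 0 < A) {i j : Fin n} (hij : dist (X i) (X j) ≤ r) (hi : i ∈ zone X m ℓ B₁ B₂)
    (hj : j ∈ zone X m ℓ B₁ B₂) {b : ℕ} (hb : b ∈ win ℓ m B₂) (hg : RowGood X m ℓ A B₁ b)
    (h1 : cell m (X i) 1 ≤ b) (h2 : b ≤ cell m (X j) 1) :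
    Attached X r m ℓ A B₁ B₂ i ∨ Attached X r m ℓ A B₁ B₂ j := by
  rcases h1.eq_or_lt with h1 | h1
  · exact Or.inl ⟨_, hi.1, b, hb, Or.inl hg, i, (mem_tileNodes hm hX).2 ⟨rfl, h1⟩, Or.inl rfl⟩
  rcases h2.eq_or_lt with h2 | h2
  · exact Or.inr ⟨_, hj.1, b, hb, Or.inl hg, j, (mem_tileNodes hm hX).2 ⟨rfl, h2.symm⟩, Or.inl rfl⟩
  have hne : ∀ c ∈ win ℓ m B₁, ∃ v, v ∈ tileNodes X m c b := fun c hc => by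
    have := hA.trans_le (hg c hc)
    rw [← card_tileNodes] at this
    exact Finset.card_pos.1 (by exact_mod_cast this)
  obtain ⟨v, hv⟩ := hne _ hi.1
  obtain ⟨w, hw⟩ := hne _ hj.1
  have hv' := (mem_tileNodes hm hX).1 hv
  have hw' := (mem_tileNodes hm hX).1 hw
  have h01 : ∀ c : Fin 2, c ≠ 1 → c = 0 := by decide
  rcases near_of_crossing hm hX hmr hij 1 (v := v) (w := w) (by omega) (by omega) (by omega)
    (fun c hc => by rw [h01 c hc]; omega) (fun c hc => by rw [h01 c hc]; omega) with h | h
  · exact Or.inl ⟨_, hi.1, b, hb, Or.inl hg, v, hv, Or.inr h⟩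
  · exact Or.inr ⟨_, hj.1, b, hb, Or.inl hg, w, hw, Or.inr h⟩

lemma attached_of_col_between (hm : 0 < m) (hX : ∀ i, X i ∈ openSquare) (hmr : 4 ≤ m * r)
    (hA : 0 < A) {i j : Fin n} (hij : dist (X i) (X j) ≤ r) (hi : i ∈ zone X m ℓ B₁ B₂)
    (hj : j ∈ zone X m ℓ B₁ B₂) {a : ℕ} (ha : a ∈ win ℓ m B₁) (hg : ColGood X m ℓ A B₂ a)
    (h1 : cell m (X i) 0 ≤ a) (h2 : a ≤ cell m (X j) 0) :
    Attached X r m ℓ A B₁ B₂ i ∨ Attached X r m ℓ A B₁ B₂ j := by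
  rcases h1.eq_or_lt with h1 | h1
  · exact Or.inl ⟨a, ha, _, hi.2, Or.inr hg, i, (mem_tileNodes hm hX).2 ⟨h1, rfl⟩, Or.inl rfl⟩
  rcases h2.eq_or_lt with h2 | h2
  · exact Or.inr ⟨a, ha, _, hj.2, Or.inr hg, j, (mem_tileNodes hm hX).2 ⟨h2.symm, rfl⟩, Or.inl rfl⟩
  have hne : ∀ c ∈ win ℓ m B₂, ∃ v, v ∈ tileNodes X m a c := fun c hc => by
    have := hA.trans_le (hg c hc)
    rw [← card_tileNodes] at this
    exact Finset.card_pos.1 (by exact_mod_cast this)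
  obtain ⟨v, hv⟩ := hne _ hi.2
  obtain ⟨w, hw⟩ := hne _ hj.2
  have hv' := (mem_tileNodes hm hX).1 hv
  have hw' := (mem_tileNodes hm hX).1 hw
  have h01 : ∀ c : Fin 2, c ≠ 0 → c = 1 := by decide
  rcases near_of_crossing hm hX hmr hij 0 (v := v) (w := w) (by omega) (by omega) (by omega)
    (fun c hc => by rw [h01 c hc]; omega) (fun c hc => by rw [h01 c hc]; omega) with h | h
  · exact Or.inl ⟨a, ha, _, hi.2, Or.inr hg, v, hv, Or.inr h⟩
  · exact Or.inr ⟨a, ha, _, hj.2, Or.inr hg, w, hw, Or.inr h⟩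

/-- Without isolated clusters every node reaches the hub of its block. -/
theorem reach_hub (hm : 0 < m) (hX : ∀ i, X i ∈ openSquare) (hmr : 4 ≤ m * r) (hmr' : m * r ≤ 6)
    (hA : 1 ≤ A) (hw : WindowsGood X m k (3 * ℓ) A) (hmq : m = ℓ * q) (hk : 1 ≤ k)
    (hℓ : k + 10 ≤ ℓ) {D : ℝ} (hD : 2 * k + 1 ≤ D) (hcl : ∀ U, ¬ IsCluster X r D U) (s : Fin n)
    (hB₁ : B₁ = cell m (X s) 0 / ℓ) (hB₂ : B₂ = cell m (X s) 1 / ℓ) {κ ρ : ℕ}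
    (hκ : κ ∈ win ℓ m B₁) (hρ : ρ ∈ win ℓ m B₂) (hκg : ColGood X m ℓ A B₂ κ)
    (hρg : RowGood X m ℓ A B₁ ρ) :
    Reach (Near X r) (zone X m ℓ B₁ B₂) (4 + 12 * ℓ) (unif {s}) (unif (tileNodes X m κ ρ)) := by
  have hm' : (0:ℝ) < m := by exact_mod_cast hm
  have hr : 0 < r := by by_contra h; nlinarith
  have hA0 : 0 < A := one_pos.trans_le hA
  have hℓ0 : 0 < ℓ := by omega
  have hB : ∀ {c}, c < m → c / ℓ < q := fun {c} hc => by
    rw [Nat.div_lt_iff_lt_mul hℓ0, mul_comm, ← hmq]; exact hc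
  have h₁ : B₁ < q := hB₁ ▸ hB (cell_lt hm (hX s) 0)
  have h₂ : B₂ < q := hB₂ ▸ hB (cell_lt hm (hX s) 1)
  have f1 : ℓ * B₁ ≤ cell m (X s) 0 ∧ cell m (X s) 0 < ℓ * B₁ + ℓ := by
    subst hB₁; exact ⟨Nat.mul_div_le _ _, Nat.lt_mul_div_succ _ hℓ0⟩
  have f2 : ℓ * B₂ ≤ cell m (X s) 1 ∧ cell m (X s) 1 < ℓ * B₂ + ℓ := by
    subst hB₂; exact ⟨Nat.mul_div_le _ _, Nat.lt_mul_div_succ _ hℓ0⟩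
  have hzone : ∀ v, (∀ c, cell m (X v) c < cell m (X s) c + k + 7) →
      (∀ c, cell m (X s) c < cell m (X v) c + k + 7) → v ∈ zone X m ℓ B₁ B₂ := by
    intro v h1 h2
    have := h1 0; have := h1 1; have := h2 0; have := h2 1
    have := cell_lt hm (hX v) 0; have := cell_lt hm (hX v) 1
    exact ⟨mem_win.2 (by omega), mem_win.2 (by omega)⟩
  have hsz : s ∈ zone X m ℓ B₁ B₂ := hzone s (fun c => by omega) fun c => by omega
  by_cases hs : Attached X r m ℓ A B₁ B₂ s
  · exact (hs.reach hm hX hmr hA hmq h₁ h₂ (by omega) hκ hρ hκg hρg hsz).mono subset_rfl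
      (by linarith) (by positivity)
  -- The component of `s` in the graph of unattached nodes: either it has a link to an attached
  -- node, or it is an isolated cluster.
  let G : SimpleGraph (Fin n) :=
    { Adj := fun u v => Near X r u v ∧ ¬ Attached X r m ℓ A B₁ B₂ u ∧ ¬ Attached X r m ℓ A B₁ B₂ v
      symm := ⟨fun u v h => ⟨h.1.symm, h.2.2, h.2.1⟩⟩
      loopless := ⟨fun u h => h.1.1 rfl⟩ }
  have hcard : ∀ a b d : ℕ, (Finset.uIcc a b).card < d → a < b + d ∧ b < a + d := by
    intro a b d h
    rw [Nat.card_uIcc] at h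
    omega
  -- Two linked unattached nodes never lie on different sides of a good row or column. Hence no row
  -- or column between `s` and a node of its component is good. Carrying the bound `k` along keeps
  -- the component inside the zone, where goodness is defined.
  have inv : ∀ v, G.Reachable s v → ¬ Attached X r m ℓ A B₁ B₂ v ∧
      ((∀ c, cell m (X v) c < cell m (X s) c + k ∧ cell m (X s) c < cell m (X v) c + k) ∧
      (∀ b ∈ Finset.uIcc (cell m (X s) 1) (cell m (X v) 1), ¬ RowGood X m ℓ A B₁ b) ∧
      (∀ a ∈ Finset.uIcc (cell m (X s) 0) (cell m (X v) 0), ¬ ColGood X m ℓ A B₂ a)) := by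
    intro v hv
    rw [SimpleGraph.reachable_iff_reflTransGen] at hv
    induction hv with
    | refl =>
      refine ⟨hs, fun c => by omega, fun b hb hg => hs ?_, fun a ha hg => hs ?_⟩
      · rw [Finset.uIcc_self, Finset.mem_singleton] at hb
        exact ⟨_, hsz.1, b, hb ▸ hsz.2, Or.inl hg, s, (mem_tileNodes hm hX).2 ⟨rfl, hb.symm⟩,
          Or.inl rfl⟩
      · rw [Finset.uIcc_self, Finset.mem_singleton] at ha
        exact ⟨a, ha ▸ hsz.1, _, hsz.2, Or.inr hg, s, (mem_tileNodes hm hX).2 ⟨ha.symm, rfl⟩,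
          Or.inl rfl⟩
    | @tail u v _ huv ih =>
      obtain ⟨hu, hc, hrow, hcol⟩ := ih
      have hv := huv.2.2
      have c1 := fun c => cell_lt_of_dist_le (m := m) hX hmr' huv.1.2 c
      have c2 := fun c => cell_lt_of_dist_le (m := m) hX hmr' huv.1.symm.2 c
      have huz : u ∈ zone X m ℓ B₁ B₂ :=
        hzone u (fun c => by have := hc c; omega) fun c => by have := hc c; omega
      have hvz : v ∈ zone X m ℓ B₁ B₂ :=
        hzone v (fun c => by have := hc c; have := c2 c; omega)
          fun c => by have := hc c; have := c1 c; omega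
      have e1 := mem_win.1 hsz.1
      have e2 := mem_win.1 hsz.2
      have e3 := mem_win.1 hvz.1
      have e4 := mem_win.1 hvz.2
      have hw1 : Finset.uIcc (cell m (X s) 0) (cell m (X v) 0) ⊆ win ℓ m B₁ := fun a ha => by
        rw [Finset.mem_uIcc'] at ha
        exact mem_win.2 (by omega)
      have hw2 : Finset.uIcc (cell m (X s) 1) (cell m (X v) 1) ⊆ win ℓ m B₂ := fun a ha => by
        rw [Finset.mem_uIcc'] at ha
        exact mem_win.2 (by omega)
      have hrow' : ∀ b ∈ Finset.uIcc (cell m (X s) 1) (cell m (X v) 1), ¬ RowGood X m ℓ A B₁ b := by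
        intro b hb hg
        by_cases hb' : b ∈ Finset.uIcc (cell m (X s) 1) (cell m (X u) 1)
        · exact hrow b hb' hg
        have hbw := hw2 hb
        rw [Finset.mem_uIcc'] at hb hb'
        rcases le_total (cell m (X u) 1) b with h | h
        · rcases attached_of_row_between hm hX hmr hA0 huv.1.2 huz hvz hbw hg h (by omega)
            with h | h
          exacts [hu h, hv h]
        · rcases attached_of_row_between hm hX hmr hA0 huv.1.symm.2 hvz huz hbw hg (by omega) h
            with h | h
          exacts [hv h, hu h]
      have hcol' : ∀ a ∈ Finset.uIcc (cell m (X s) 0) (cell m (X v) 0), ¬ ColGood X m ℓ A B₂ a := by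
        intro b hb hg
        by_cases hb' : b ∈ Finset.uIcc (cell m (X s) 0) (cell m (X u) 0)
        · exact hcol b hb' hg
        have hbw := hw1 hb
        rw [Finset.mem_uIcc'] at hb hb'
        rcases le_total (cell m (X u) 0) b with h | h
        · rcases attached_of_col_between hm hX hmr hA0 huv.1.2 huz hvz hbw hg h (by omega)
            with h | h
          exacts [hu h, hv h]
        · rcases attached_of_col_between hm hX hmr hA0 huv.1.symm.2 hvz huz hbw hg (by omega) h
            with h | h
          exacts [hv h, hu h]
      refine ⟨hv, ?_, hrow', hcol'⟩
      -- One more link moves by at most `6` cells, so the new node is still in the zone; there `k`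
      -- rows would include a good one.
      have k1 : (Finset.uIcc (cell m (X s) 1) (cell m (X v) 1)).card < k := by
        by_contra! h
        obtain ⟨y, hy, hg⟩ := exists_rowGood hw hmq h₁ h₂ hℓ0 hw2 h
        exact hrow' y hy hg
      have k0 : (Finset.uIcc (cell m (X s) 0) (cell m (X v) 0)).card < k := by
        by_contra! h
        obtain ⟨y, hy, hg⟩ := exists_colGood hw hmq h₁ h₂ hℓ0 hw1 h
        exact hcol' y hy hg
      intro c
      fin_cases c
      · exact (hcard _ _ _ k0).symm
      · exact (hcard _ _ _ k1).symm
  -- The component has extent at most `(2 k + 1) / m ≤ D r`, so it cannot be isolated. The node `j`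
  -- outside it must be attached, as otherwise it would belong to the component.
  obtain ⟨i, hi, j, hj, hij⟩ : ∃ i, G.Reachable s i ∧ ∃ j, ¬ G.Reachable s j ∧
      dist (X i) (X j) ≤ r := by
    by_contra! hcon
    refine hcl (Finset.univ.filter fun v => G.Reachable s v) ⟨⟨s, by simp⟩, ?_, ?_⟩
    · intro i hi j hj
      simp only [Finset.mem_filter, Finset.mem_univ, true_and] at hi hj
      exact hcon i hi j hj
    · intro i hi j hj c
      simp only [Finset.mem_filter, Finset.mem_univ, true_and] at hi hj
      have a1 := (inv i hi).2.1 c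
      have a2 := (inv j hj).2.1 c
      refine (abs_coord_sub_le hm hX (d := 2 * k) (by omega) (by omega)).trans ?_
      rw [div_le_iff₀ hm']
      have : (0:ℝ) ≤ 2 * k + 1 := by positivity
      push_cast
      nlinarith
  have hnear : Near X r i j := ⟨fun h => hj (h ▸ hi), hij⟩
  have hjA : Attached X r m ℓ A B₁ B₂ j := by
    by_contra h
    exact hj (hi.trans (SimpleGraph.Adj.reachable (G := G) ⟨hnear, (inv i hi).1, h⟩))
  have hreachzone : ∀ v, G.Reachable s v → v ∈ zone X m ℓ B₁ B₂ := fun v hv =>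
    hzone v (fun c => by have := (inv v hv).2.1 c; omega)
      fun c => by have := (inv v hv).2.1 c; omega
  have hjz : j ∈ zone X m ℓ B₁ B₂ := by
    refine hzone j (fun c => ?_) fun c => ?_
    · have := (inv i hi).2.1 c
      have := cell_lt_of_dist_le (m := m) hX hmr' hnear.symm.2 c
      omega
    · have := (inv i hi).2.1 c
      have := cell_lt_of_dist_le (m := m) hX hmr' hij c
      omega
  obtain ⟨p, hp⟩ := hi.exists_isPath
  have hpath : Reach (Near X r) (zone X m ℓ B₁ B₂) 1 (unif {s}) (unif {i}) :=
    (Reach.path (link := Near X r) (G := G) (fun u v h => h.1) p hp).mono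
      (fun w hw => hreachzone w (p.takeUntil w hw).reachable) le_rfl zero_le_one
  exact ((hpath.trans (Reach.edge (Or.inr hnear) (hreachzone i hi) hjz)).trans
    (hjA.reach hm hX hmr hA hmq h₁ h₂ (by omega) hκ hρ hκg hρg hjz)).mono subset_rfl
      (by linarith) (by positivity)

end Access

/-! ### Routing along well filled rows and columns -/

section Blocks

variable {n m ℓ q k : ℕ} {X : Fin n → Plane} {r A u : ℝ}

lemma mem_Ico_of_mem_win (hℓ : 0 < ℓ) {B c : ℕ} (h : c ∈ win ℓ m B) :
    B ∈ Finset.Ico (c / ℓ - 1) (c / ℓ + 2) := by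
  rw [mem_win] at h
  have h1 := Nat.mul_div_le c ℓ
  have h2 := Nat.lt_mul_div_succ c hℓ
  rw [Finset.mem_Ico]
  constructor
  · have : c / ℓ < B + 2 := by
      refine lt_of_mul_lt_mul_left (a := ℓ) ?_ (Nat.zero_le _)
      rw [mul_add]; omega
    omega
  · refine lt_of_mul_lt_mul_left (a := ℓ) ?_ (Nat.zero_le _)
    rw [mul_add] at h2 ⊢
    omega

/-- A cell lies in the windows of at most three blocks, its own and the two neighbours. -/
lemma sum_win_le (hℓ : 0 < ℓ) (S : Finset ℕ) (c : ℕ) {b : ℝ} (hb : 0 ≤ b) :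
    ∑ B ∈ S, (if c ∈ win ℓ m B then b else 0) ≤ 3 * b := by
  rw [← Finset.sum_filter, Finset.sum_const, nsmul_eq_mul]
  refine mul_le_mul_of_nonneg_right ?_ hb
  have : (S.filter fun B => c ∈ win ℓ m B).card ≤ (Finset.Ico (c / ℓ - 1) (c / ℓ + 2)).card :=
    Finset.card_le_card fun B hB => mem_Ico_of_mem_win hℓ (Finset.mem_filter.1 hB).2
  rw [Nat.card_Ico] at this
  exact_mod_cast this.trans (by omega)

lemma sum_zone_le (hℓ : 0 < ℓ) (S T : Finset ℕ) (v : Fin n) {b : ℝ} (hb : 0 ≤ b) :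
    ∑ B₂ ∈ T, ∑ B₁ ∈ S, (if v ∈ zone X m ℓ B₁ B₂ then b else 0) ≤ 9 * b := by
  calc _ = ∑ B₂ ∈ T, if cell m (X v) 1 ∈ win ℓ m B₂ then
        ∑ B₁ ∈ S, (if cell m (X v) 0 ∈ win ℓ m B₁ then b else 0) else 0 := by
        refine Finset.sum_congr rfl fun B₂ _ => ?_
        split_ifs with h <;> simp [zone, h]
    _ ≤ 3 * (∑ B₁ ∈ S, (if cell m (X v) 0 ∈ win ℓ m B₁ then b else 0)) := by
        refine sum_win_le hℓ _ _ (Finset.sum_nonneg fun _ _ => ?_)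
        split_ifs <;> simp [hb]
    _ ≤ 3 * (3 * b) := by gcongr; exact sum_win_le hℓ _ _ hb
    _ = 9 * b := by ring

/-- Only nodes from the nine blocks around `v` have `v` in their zone. This limits the access load
of a link, whatever paths the nodes take. -/
lemma card_zone_le (hm : 0 < m) (hX : ∀ i, X i ∈ openSquare) (hu : TilesUpper X m u) (hℓ : 0 < ℓ)
    (v : Fin n) :
    ((Finset.univ.filter fun s => v ∈ zone X m ℓ (cell m (X s) 0 / ℓ) (cell m (X s) 1 / ℓ)).card
      : ℝ) ≤ 9 * ℓ ^ 2 * u := by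
  have hu0 : 0 ≤ u := (Nat.cast_nonneg _).trans (hu 0 hm 0 hm)
  set I : ℕ → Finset ℕ := fun c => Finset.Ico (ℓ * (c / ℓ - 1)) (ℓ * (c / ℓ + 2)) with hI
  have hIc : ∀ c, ((I c).card : ℝ) ≤ 3 * ℓ := fun c => by
    rw [hI]
    simp only [Nat.card_Ico, ← Nat.mul_sub]
    have : ℓ * (c / ℓ + 2 - (c / ℓ - 1)) ≤ ℓ * 3 := Nat.mul_le_mul_left _ (by omega)
    rw [mul_comm 3]
    exact_mod_cast this
  have hmem : ∀ c c', c ∈ win ℓ m (c' / ℓ) → c' ∈ I c := by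
    intro c c' h
    have h1 := Finset.mem_Ico.1 (mem_Ico_of_mem_win hℓ h)
    rw [hI, Finset.mem_Ico]
    constructor
    · exact (Nat.mul_le_mul_left _ h1.1).trans (Nat.mul_div_le _ _)
    · exact (Nat.lt_mul_div_succ c' hℓ).trans_le (Nat.mul_le_mul_left _ h1.2)
  refine (Nat.cast_le.2 (Finset.card_le_card fun s hs => ?_)).trans ((card_cell_mem_le hm hX hu
    (I (cell m (X v) 0)) (I (cell m (X v) 1))).trans ?_)
  · simp only [Finset.mem_filter, Finset.mem_univ, true_and] at hs ⊢
    exact ⟨hmem _ _ hs.1, hmem _ _ hs.2⟩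
  · calc _ ≤ (3 * ℓ : ℝ) * (3 * ℓ) * u := by gcongr <;> exact hIc _
      _ = _ := by ring

/-- If there are no isolated clusters and the poorly filled tiles are locally few, all traffic can
be routed along well filled rows and columns. -/
theorem exists_feasibleFlow_of_windows (hm : 0 < m) (hX : ∀ i, X i ∈ openSquare)
    (hmr : 4 ≤ m * r) (hmr' : m * r ≤ 6) (hA : 1 ≤ A) (hw : WindowsGood X m k (3 * ℓ) A)
    (hmq : m = ℓ * q) (hk : 1 ≤ k) (hℓ : k + 10 ≤ ℓ) (hu : TilesUpper X m u) {D : ℝ}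
    (hD : 2 * k + 1 ≤ D) (hcl : ∀ U, ¬ IsCluster X r D U) {σ : Equiv.Perm (Fin n)}
    (hσ : ∀ k, σ k ≠ k) {cap l : ℝ} (hl : 0 ≤ l)
    (hcap : l * (2 * ((4 + 12 * ℓ) * (9 * ℓ ^ 2 * u)) +
      4 * (ℓ * m * u * (9 * (12 * ℓ / A ^ 2)))) ≤ cap) :
    ∃ f, IsFeasibleFlow (Near X r) σ cap l f := by
  have hA0 : 0 < A := one_pos.trans_le hA
  have hℓ0 : 0 < ℓ := by omega
  have hu0 : 0 ≤ u := (Nat.cast_nonneg _).trans (hu 0 hm 0 hm)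
  have hB : ∀ {c}, c < m → c / ℓ < q := fun {c} hc => by
    rw [Nat.div_lt_iff_lt_mul hℓ0, mul_comm, ← hmq]; exact hc
  have hBm : ∀ {B}, B < q → ℓ * B + ℓ ≤ m := fun {B} h => by
    rw [hmq, ← Nat.mul_succ]; exact Nat.mul_le_mul_left _ h
  have hIco : ∀ {B}, B < q → Finset.Ico (ℓ * B) (ℓ * B + ℓ) ⊆ win ℓ m B := fun {B} h c hc => by
    have := hBm h
    rw [Finset.mem_Ico] at hc
    exact mem_win.2 (by omega)
  -- Every block receives a good row `ρ` and a good column `κ`, whose common tile is its hub.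
  -- Outside the range the value is the dummy `0`.
  have hρ : ∀ x y, ∃ ρ, x < q → y < q → ρ ∈ Finset.Ico (ℓ * y) (ℓ * y + ℓ) ∧
      RowGood X m ℓ A x ρ := by
    intro x y
    by_cases h : x < q ∧ y < q
    · obtain ⟨ρ, h1, h2⟩ := exists_rowGood hw hmq h.1 h.2 hℓ0 (hIco h.2)
        (by rw [Nat.card_Ico]; omega)
      exact ⟨ρ, fun _ _ => ⟨h1, h2⟩⟩
    · exact ⟨0, fun h1 h2 => absurd ⟨h1, h2⟩ h⟩
  have hκ : ∀ x y, ∃ κ, x < q → y < q → κ ∈ Finset.Ico (ℓ * x) (ℓ * x + ℓ) ∧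
      ColGood X m ℓ A y κ := by
    intro x y
    by_cases h : x < q ∧ y < q
    · obtain ⟨ρ, h1, h2⟩ := exists_colGood hw hmq h.1 h.2 hℓ0 (hIco h.1)
        (by rw [Nat.card_Ico]; omega)
      exact ⟨ρ, fun _ _ => ⟨h1, h2⟩⟩
    · exact ⟨0, fun h1 h2 => absurd ⟨h1, h2⟩ h⟩
  choose ρ hρ using hρ
  choose κ hκ using hκ
  have hb : 6 * ℓ / A ^ 2 + 6 * ℓ / A ^ 2 = 12 * ℓ / A ^ 2 := by ring
  have hb0 : 0 ≤ 12 * ℓ / A ^ 2 := by positivity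
  set μ : ℕ → ℕ → Fin n → ℝ := fun x y => unif (tileNodes X m (κ x y) (ρ x y)) with hμ
  have hH : ∀ x y, ∃ g, (x + 1 < q → y < q → Flow (Near X r) g (μ x y) (μ (x + 1) y)) ∧
      ∀ u v, g u v ≤ if u ∈ zone X m ℓ x y then 12 * ℓ / A ^ 2 else 0 := by
    intro x y
    by_cases h : x + 1 < q ∧ y < q
    · obtain ⟨r1, r2⟩ := hρ x y (by omega) h.2
      obtain ⟨r3, r4⟩ := hρ (x + 1) y h.1 h.2
      obtain ⟨c1, c2⟩ := hκ x y (by omega) h.2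
      obtain ⟨c3, c4⟩ := hκ (x + 1) y h.1 h.2
      -- Windows extend to the neighbouring blocks, so the good row of block `x` continues up to the
      -- good column of block `x + 1`, where the flow turns.
      have hc3 : κ (x + 1) y ∈ win ℓ m x := by
        have := hBm h.1
        rw [Finset.mem_Ico, mul_add] at c3
        rw [mul_add] at this
        exact mem_win.2 (by omega)
      obtain ⟨g, hg, hg'⟩ := (reach_row hm hX hmr hA0 (hIco h.2 r1) r2
        (hIco (by omega) c1) hc3).trans
        (reach_col hm hX hmr hA0 hc3 c4 (hIco h.2 r1) (hIco h.2 r3))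
      refine ⟨g, fun _ _ => hg, fun u v => (hg' u v).trans ?_⟩
      rw [hb]
      split_ifs <;> first | exact le_rfl | exact hb0 | tauto
    · exact ⟨fun _ _ => 0, fun h1 h2 => absurd ⟨h1, h2⟩ h, fun u v => by
        split_ifs <;> first | exact le_rfl | exact hb0⟩
  have hV : ∀ x y, ∃ g, (x < q → y + 1 < q → Flow (Near X r) g (μ x y) (μ x (y + 1))) ∧
      ∀ u v, g u v ≤ if u ∈ zone X m ℓ x y then 12 * ℓ / A ^ 2 else 0 := by
    intro x y
    by_cases h : x < q ∧ y + 1 < q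
    · obtain ⟨r1, r2⟩ := hρ x y h.1 (by omega)
      obtain ⟨r3, r4⟩ := hρ x (y + 1) h.1 h.2
      obtain ⟨c1, c2⟩ := hκ x y h.1 (by omega)
      obtain ⟨c3, c4⟩ := hκ x (y + 1) h.1 h.2
      have hr3 : ρ x (y + 1) ∈ win ℓ m y := by
        have := hBm h.2
        rw [Finset.mem_Ico, mul_add] at r3
        rw [mul_add] at this
        exact mem_win.2 (by omega)
      obtain ⟨g, hg, hg'⟩ := (reach_col hm hX hmr hA0 (hIco h.1 c1) c2
        (hIco (by omega) r1) hr3).trans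
        (reach_row hm hX hmr hA0 hr3 r4 (hIco h.1 c1) (hIco h.1 c3))
      refine ⟨g, fun _ _ => hg, fun u v => (hg' u v).trans ?_⟩
      rw [hb]
      split_ifs <;> first | exact le_rfl | exact hb0 | tauto
    · exact ⟨fun _ _ => 0, fun h1 h2 => absurd ⟨h1, h2⟩ h, fun u v => by
        split_ifs <;> first | exact le_rfl | exact hb0⟩
  choose gH hgH hgH' using hH
  choose gV hgV hgV' using hV
  have hq : ∀ s c, cell m (X s) c / ℓ < q := fun s c => hB (cell_lt hm (hX s) c)
  have hacc : ∀ s, Reach (Near X r) (zone X m ℓ (cell m (X s) 0 / ℓ) (cell m (X s) 1 / ℓ))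
      (4 + 12 * ℓ) (unif {s}) (μ (cell m (X s) 0 / ℓ) (cell m (X s) 1 / ℓ)) := by
    intro s
    obtain ⟨r1, r2⟩ := hρ _ _ (hq s 0) (hq s 1)
    obtain ⟨c1, c2⟩ := hκ _ _ (hq s 0) (hq s 1)
    exact reach_hub hm hX hmr hmr' hA hw hmq hk hℓ hD hcl s rfl rfl (hIco (hq s 0) c1)
      (hIco (hq s 1) r1) c2 r2
  choose acc hacc hacc' using hacc
  have hcard : ∀ (f : Fin n → ℕ) (x : ℕ),
      (Finset.univ.filter fun s => f s / ℓ = x)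
        ⊆ Finset.univ.filter fun s => f s ∈ Finset.Ico (ℓ * x) (ℓ * x + ℓ) := by
    intro f x s hs
    simp only [Finset.mem_filter, Finset.mem_univ, true_and, Finset.mem_Ico] at hs ⊢
    subst hs
    exact ⟨Nat.mul_div_le _ _, Nat.lt_mul_div_succ _ hℓ0⟩
  refine exists_feasibleFlow_of_hubs (fun u v h => h.symm) hσ (M := q)
    (fun s => cell m (X s) 0 / ℓ) (fun s => cell m (X s) 1 / ℓ) (fun s => hq s 0) (fun s => hq s 1)
    μ gH gV hgH hgV acc hacc ?_ ?_ ?_ ?_ ?_ hl hcap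
  · intro v w
    calc ∑ s, acc s v w ≤ ∑ s, (if v ∈ zone X m ℓ (cell m (X s) 0 / ℓ) (cell m (X s) 1 / ℓ) then
          (4 + 12 * ℓ : ℝ) else 0) := by
          refine Finset.sum_le_sum fun s _ => (hacc' s v w).trans ?_
          split_ifs <;> first | exact le_rfl | positivity | tauto
      _ = (4 + 12 * ℓ : ℝ) * ((Finset.univ.filter fun s =>
          v ∈ zone X m ℓ (cell m (X s) 0 / ℓ) (cell m (X s) 1 / ℓ)).card : ℝ) := by
          rw [← Finset.sum_filter, Finset.sum_const, nsmul_eq_mul, mul_comm]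
      _ ≤ _ := by gcongr; exact card_zone_le hm hX hu hℓ0 v
  · intro x
    refine (Nat.cast_le.2 (Finset.card_le_card (hcard _ x))).trans
      ((card_cell_mem_zero_le hm hX hu _).trans ?_)
    rw [Nat.card_Ico, Nat.add_sub_cancel_left]
  · intro x
    refine (Nat.cast_le.2 (Finset.card_le_card (hcard _ x))).trans
      ((card_cell_mem_one_le hm hX hu _).trans ?_)
    rw [Nat.card_Ico, Nat.add_sub_cancel_left]
  · intro v w
    exact (Finset.sum_le_sum fun y _ => Finset.sum_le_sum fun x _ => hgH' x y v w).trans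
      (sum_zone_le hℓ0 _ _ v hb0)
  · intro v w
    refine (Finset.sum_le_sum fun x _ => Finset.sum_le_sum fun y _ => hgV' x y v w).trans ?_
    rw [Finset.sum_comm]
    exact sum_zone_le hℓ0 _ _ v hb0

end Blocks

/-! ### Rates supported at the two scales -/

section Rates

/-- At range `r` and beyond, every demand pattern can be served at rate `l` times the capacity. -/
def SupportsRate {n : ℕ} (X : Fin n → Plane) (r l : ℝ) : Prop :=
  ∀ ⦃r'⦄, r ≤ r' → ∀ σ : Equiv.Perm (Fin n), (∀ k, σ k ≠ k) → ∀ cap, 0 ≤ cap →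
    cap * l ≤ throughput X r' σ cap

/-- In general position all links of range `r` survive at any larger range, so one flow serves all
these ranges. Here `B` is the load of a link per unit rate. -/
lemma supportsRate_of_near {n : ℕ} (hn : 0 < n) {X : Fin n → Plane} (hX : GenPos X) {r l B : ℝ}
    (hl : 0 ≤ l) (hB : l * B ≤ 1)
    (h : ∀ σ : Equiv.Perm (Fin n), (∀ k, σ k ≠ k) → ∀ cap l : ℝ, 0 ≤ l → l * B ≤ cap →
      ∃ f, IsFeasibleFlow (Near X r) σ cap l f) : SupportsRate X r l := by
  intro r' hr σ hσ cap hcap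
  obtain ⟨f, hf⟩ := h σ hσ cap (cap * l) (by positivity) (by
    rw [mul_assoc]; exact mul_le_of_le_one_right hcap hB)
  exact (hf.mono fun u v huv => hX.near_imp_link hr huv).le_throughput hn

lemma mesh_mul_ge {l : ℕ} (hl : 0 < l) {r : ℝ} (hr : 0 < r) : 4 ≤ mesh l r * r := by
  have := mesh_ge hl hr
  rwa [div_le_iff₀ hr] at this

lemma mesh_mul_le {l : ℕ} (hl : 0 < l) {r : ℝ} (hr : 0 < r) (h : l * r ≤ 2) :
    mesh l r * r ≤ 6 := by
  have := mesh_le hl hr h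
  rwa [le_div_iff₀ hr] at this

lemma le_div_mesh_sq {l : ℕ} (hl : 0 < l) {r : ℝ} (hr : 0 < r) (h : l * r ≤ 2) (n : ℕ) :
    n * r ^ 2 / 36 ≤ n / (mesh l r : ℝ) ^ 2 := by
  have h0 : (0:ℝ) < mesh l r := by exact_mod_cast mesh_pos hl hr
  have h1 := mesh_mul_le hl hr h
  rw [div_le_div_iff₀ (by norm_num) (by positivity), mul_assoc]
  have : r ^ 2 * (mesh l r : ℝ) ^ 2 ≤ 36 := by
    rw [← mul_pow, mul_comm]
    have : (0:ℝ) ≤ mesh l r * r := by positivity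
    nlinarith
  gcongr

lemma div_mesh_sq_le {l : ℕ} (hl : 0 < l) {r : ℝ} (hr : 0 < r) (n : ℕ) :
    n / (mesh l r : ℝ) ^ 2 ≤ n * r ^ 2 / 16 := by
  have h0 : (0:ℝ) < mesh l r := by exact_mod_cast mesh_pos hl hr
  have h1 := mesh_mul_ge hl hr
  rw [div_le_div_iff₀ (by positivity) (by norm_num), mul_assoc]
  have : 16 ≤ r ^ 2 * (mesh l r : ℝ) ^ 2 := by
    rw [← mul_pow, mul_comm]
    nlinarith
  gcongr

/-- With `a = n / m²` nodes per tile, `m / a` is the order of the load from row and column traffic;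
this identifies the rate `n r ^ 3`. -/
lemma mesh_mul_div_le {l : ℕ} (hl : 0 < l) {r : ℝ} (hr : 0 < r) (h : l * r ≤ 2) {n : ℕ}
    (hn : 0 < n) : mesh l r * ((mesh l r : ℝ) ^ 2 / n) ≤ 216 / (n * r ^ 3) := by
  have h0 : (0:ℝ) < mesh l r := by exact_mod_cast mesh_pos hl hr
  have hn' : (0:ℝ) < n := by exact_mod_cast hn
  have h1 := mesh_mul_le hl hr h
  have h3 : (mesh l r * r : ℝ) ^ 3 ≤ 6 ^ 3 := by gcongr
  rw [le_div_iff₀ (by positivity)]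
  calc _ = (mesh l r * r : ℝ) ^ 3 := by field_simp
    _ ≤ 216 := by norm_num at h3 ⊢; exact h3

lemma tendsto_const_mul_rpow {K s : ℝ} (hs : s < 0) :
    Tendsto (fun n : ℕ => K * (n : ℝ) ^ s) atTop (𝓝 0) := by
  have h := (tendsto_rpow_neg_atTop (y := -s) (by linarith)).comp tendsto_natCast_atTop_atTop
  simp only [neg_neg] at h
  simpa using h.const_mul K

lemma eventually_log_le {c s : ℝ} (hc : 0 < c) (hs : 0 < s) :
    ∀ᶠ n : ℕ in atTop, Real.log n ≤ c * (n : ℝ) ^ s := by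
  have h := ((isLittleO_log_rpow_atTop hs).bound hc)
  filter_upwards [tendsto_natCast_atTop_atTop.eventually h] with n hn
  refine (le_abs_self _).trans (hn.trans_eq ?_)
  rw [Real.norm_of_nonneg (Real.rpow_nonneg (Nat.cast_nonneg n) s)]

/-- At a radius of order `n ^ (-1/3)` all tiles are well filled. -/
theorem whp_supportsRate_cbrt {K : ℝ} (hK : 0 < K) :
    Whp nodeLaw fun n X => SupportsRate X (K * (n : ℝ) ^ (-(1 / 3) : ℝ)) (K ^ 3 / 100000) := by
  set r : ℕ → ℝ := fun n => K * (n : ℝ) ^ (-(1 / 3) : ℝ) with hr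
  set m : ℕ → ℕ := fun n => mesh 1 (r n) with hm
  have hr0 : Tendsto r atTop (𝓝 0) := tendsto_const_mul_rpow (by norm_num)
  have hpos : ∀ n : ℕ, 0 < n → 0 < r n := fun n hn => by
    have : (0:ℝ) < n := by exact_mod_cast hn
    positivity
  have hsmall : ∀ᶠ n in atTop, ((1:ℕ):ℝ) * r n ≤ 2 := by
    filter_upwards [hr0.eventually (gt_mem_nhds (show (0:ℝ) < 2 by norm_num))] with n hn
    rw [Nat.cast_one, one_mul]; exact hn.le
  have hmpos : ∀ᶠ n in atTop, 0 < m n := by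
    filter_upwards [eventually_gt_atTop 0] with n hn using mesh_pos one_pos (hpos n hn)
  -- With the constant `1 / 12` the condition `12 * K ≤ k` holds for `k = 1`: windows of one tile,
  -- so every single tile is well filled.
  have hlog : ∀ᶠ n : ℕ in atTop, Real.log n ≤ 1 / 12 * (n / (m n : ℝ) ^ 2) := by
    filter_upwards [eventually_gt_atTop 0, hsmall,
      eventually_log_le (c := K ^ 2 / 432) (s := 1 / 3) (by positivity) (by norm_num)]
      with n hn h1 h2
    have hn' : (0:ℝ) < n := by exact_mod_cast hn
    have h3 := le_div_mesh_sq one_pos (hpos n hn) h1 n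
    have h4 : (n:ℝ) * r n ^ 2 = K ^ 2 * (n : ℝ) ^ (1 / 3 : ℝ) := by
      rw [hr, mul_pow, ← Real.rpow_natCast ((n:ℝ) ^ _), ← Real.rpow_mul hn'.le]
      calc (n:ℝ) * (K ^ 2 * (n:ℝ) ^ (-(1 / 3) * ((2:ℕ):ℝ) : ℝ))
          = K ^ 2 * ((n:ℝ) ^ (1:ℝ) * (n:ℝ) ^ (-(1 / 3) * ((2:ℕ):ℝ) : ℝ)) := by
            rw [Real.rpow_one]; ring
        _ = _ := by rw [← Real.rpow_add hn']; norm_num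
    rw [h4] at h3
    linarith
  have hup := whp_tilesUpper hmpos hlog
  have hwin := whp_windowsGood (k := 1) 1 (by norm_num) hmpos hlog
  refine ((hup.and hwin).and ((whp_of_ae (G := fun n X => ∀ i, X i ∈ openSquare)
    (Eventually.of_forall fun n => ae_forall_mem ae_openSquare)).and
    (whp_of_ae (G := fun n X => GenPos X) (Eventually.of_forall ae_genPos)))).mono ?_
  filter_upwards [eventually_gt_atTop 0, hsmall] with n hn h1
  rintro X ⟨⟨hu, hw⟩, hX, hG⟩
  have hn' : (0:ℝ) < n := by exact_mod_cast hn
  have hrn := hpos n hn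
  have hmn : 0 < m n := mesh_pos one_pos hrn
  have hmn' : (0:ℝ) < m n := by exact_mod_cast hmn
  have hmr : 4 ≤ m n * r n := mesh_mul_ge one_pos hrn
  have hm2 : 2 ≤ m n := by
    rw [Nat.cast_one, one_mul] at h1
    have : (2:ℝ) ≤ m n := by nlinarith
    exact_mod_cast this
  have hr3 : (n:ℝ) * r n ^ 3 = K ^ 3 := by
    rw [hr, mul_pow, ← Real.rpow_natCast ((n:ℝ) ^ _), ← Real.rpow_mul hn'.le]
    norm_num
    rw [Real.rpow_neg_one]
    field_simp
  have hkey := mesh_mul_div_le one_pos hrn h1 hn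
  rw [hr3] at hkey
  change (m n : ℝ) * ((m n : ℝ) ^ 2 / n) ≤ 216 / K ^ 3 at hkey
  set a : ℝ := n / (m n : ℝ) ^ 2 with ha
  have ha0 : 0 < a := by positivity
  refine supportsRate_of_near hn hG (by positivity) (B := 2 * (1 / (a / 4)) +
    4 * (2 * m n * ((2 + 3 * (1 / 12)) * a) * (1 / (a / 4) ^ 2))) ?_
    fun σ hσ cap l hl hcap => exists_feasibleFlow_of_full_tiles hm2 hX hmr (by positivity)
      (fun x hx y hy => ?_) hu hσ hl hcap
  · have e1 : (m n : ℝ) ^ 2 / n = 1 / a := by rw [ha]; field_simp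
    rw [e1] at hkey
    have e2 : 2 * (1 / (a / 4)) + 4 * (2 * m n * ((2 + 3 * (1 / 12)) * a) * (1 / (a / 4) ^ 2))
        = 8 * (1 / a) + 288 * (m n * (1 / a)) := by field_simp; ring
    rw [e2]
    have e3 : 1 / a ≤ m n * (1 / a) := by
      refine le_mul_of_one_le_left (by positivity) ?_
      exact_mod_cast hmn
    calc K ^ 3 / 100000 * (8 * (1 / a) + 288 * (m n * (1 / a)))
        ≤ K ^ 3 / 100000 * (296 * (216 / K ^ 3)) := by
          gcongr
          linarith
      _ ≤ 1 := by field_simp; norm_num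
  · obtain ⟨t, ht, ht'⟩ := hw x hx y hy {(x, y)} (by simp) (by simp) (by simp [hx, hy])
    rw [Finset.mem_singleton] at ht
    rw [ht] at ht'
    exact ht'

/-- At a connectivity radius of minimal order the rate `n * r ^ 3` is supported. -/
theorem whp_supportsRate_connectivity {r ξ : ℕ → ℝ} (hr : ∀ n, 0 < r n)
    (hrξ : ∀ᶠ n : ℕ in atTop, Real.pi * r n ^ 2 * n = Real.log n + ξ n)
    (hξ : Tendsto ξ atTop atTop) (hξ' : ∀ᶠ n : ℕ in atTop, ξ n ≤ Real.log n) :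
    ∃ c > 0, Whp nodeLaw fun n X => SupportsRate X (r n) (c * (n * r n ^ 3)) := by
  -- From `n r² ≥ log n / 4` and `n / m² ≥ n r² / 36` one gets `log n ≤ 144 n / m²`, and
  -- `whp_windowsGood` needs `12` times this constant.
  obtain ⟨k, hk⟩ : ∃ k : ℕ, k = 12 * 144 := ⟨_, rfl⟩
  -- A block is longer than a trapped component (fewer than `k` cells from its node) followed by one
  -- more link (at most `6` cells).
  obtain ⟨ℓ, hℓ⟩ : ∃ ℓ : ℕ, ℓ = k + 10 := ⟨_, rfl⟩
  have hℓ0 : 0 < ℓ := by omega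
  set m : ℕ → ℕ := fun n => mesh ℓ (r n) with hm
  have hsq : ∀ᶠ n : ℕ in atTop, Real.log n / 4 ≤ n * r n ^ 2 ∧ n * r n ^ 2 ≤ Real.log n := by
    filter_upwards [hrξ, hξ', hξ.eventually_ge_atTop 0, eventually_ge_atTop 1] with n h1 h2 h3 hn
    have hp := Real.pi_gt_three
    have hp' := Real.pi_le_four
    have h0 : 0 ≤ (n:ℝ) * r n ^ 2 := by positivity
    have : Real.pi * (n * r n ^ 2) = Real.log n + ξ n := by rw [← h1]; ring
    have hl : 0 ≤ Real.log n := Real.log_natCast_nonneg n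
    constructor <;> nlinarith
  have hr0 : Tendsto r atTop (𝓝 0) := by
    have h1 : Tendsto (fun n : ℕ => Real.log n / n) atTop (𝓝 0) := by
      have := (Real.isLittleO_log_id_atTop.tendsto_div_nhds_zero).comp
        tendsto_natCast_atTop_atTop
      exact this
    have h2 : Tendsto (fun n => r n ^ 2) atTop (𝓝 0) := by
      refine tendsto_of_tendsto_of_tendsto_of_le_of_le' tendsto_const_nhds h1
        (Eventually.of_forall fun n => sq_nonneg _) ?_
      filter_upwards [hsq, eventually_gt_atTop 0] with n h hn
      have hn' : (0:ℝ) < n := by exact_mod_cast hn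
      rw [le_div_iff₀ hn', mul_comm]; exact h.2
    have h3 := h2.sqrt
    simpa [Real.sqrt_sq (hr _).le] using h3
  have hsmall : ∀ᶠ n in atTop, (ℓ:ℝ) * r n ≤ 2 := by
    have := hr0.const_mul (ℓ:ℝ)
    rw [mul_zero] at this
    filter_upwards [this.eventually (gt_mem_nhds (show (0:ℝ) < 2 by norm_num))] with n hn
    exact hn.le
  have hmpos : ∀ᶠ n in atTop, 0 < m n := Eventually.of_forall fun n => mesh_pos hℓ0 (hr n)
  have hlog : ∀ᶠ n : ℕ in atTop, Real.log n ≤ 144 * (n / (m n : ℝ) ^ 2) := by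
    filter_upwards [hsmall, hsq] with n h1 h2
    have h3 := le_div_mesh_sq hℓ0 (hr n) h1 n
    change n * r n ^ 2 / 36 ≤ n / (m n : ℝ) ^ 2 at h3
    linarith [h2.1]
  -- The access load, of order `n r²`, is dominated by the row load `1 / (n r³)`, because `(n r²) ^
  -- 5 ≤ log ^ 5 n ≤ n` eventually.
  have hfive : ∀ᶠ n : ℕ in atTop, (n:ℝ) * r n ^ 2 * (n * r n ^ 3) ≤ 1 := by
    have h := (Real.isLittleO_pow_log_id_atTop (n := 5)).bound one_pos
    filter_upwards [tendsto_natCast_atTop_atTop.eventually h, hsq, eventually_gt_atTop 0]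
      with n h1 h2 hn
    have hn' : (0:ℝ) < n := by exact_mod_cast hn
    have hrn := hr n
    simp only [id, one_mul] at h1
    rw [Real.norm_of_nonneg hn'.le] at h1
    have h3 : (n * r n ^ 2) ^ 5 ≤ (n:ℝ) :=
      (pow_le_pow_left₀ (by positivity) h2.2 5).trans ((le_abs_self _).trans h1)
    have h4 : ((n:ℝ) * r n ^ 2 * (n * r n ^ 3)) ^ 2 ≤ 1 := by
      have : n * ((n:ℝ) * r n ^ 2 * (n * r n ^ 3)) ^ 2 = (n * r n ^ 2) ^ 5 := by ring
      by_contra! hcon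
      nlinarith
    exact (sq_le_one_iff₀ (by positivity)).1 h4
  have hup := whp_tilesUpper hmpos hlog
  have hwin := whp_windowsGood (k := k) (3 * ℓ) (by rw [hk]; norm_num) hmpos hlog
  have hcl := whp_no_cluster (D := 2 * k + 1) (by positivity) hr hrξ hξ hr0
  have hloginf : Tendsto (fun n : ℕ => Real.log n) atTop atTop :=
    Real.tendsto_log_atTop.comp tendsto_natCast_atTop_atTop
  set u₀ : ℝ := 2 + 3 * 144 with hu₀
  set C : ℝ := 2 * ((4 + 12 * ℓ) * (9 * ℓ ^ 2 * u₀)) + 4 * (ℓ * u₀ * (9 * (12 * ℓ * 16))) * 216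
    with hC
  have hC0 : 0 < C := by positivity
  refine ⟨1 / C, by positivity, ((hup.and (hwin.and hcl)).and
    ((whp_of_ae (G := fun n X => ∀ i, X i ∈ openSquare)
    (Eventually.of_forall fun n => ae_forall_mem ae_openSquare)).and
    (whp_of_ae (G := fun n X => GenPos X) (Eventually.of_forall ae_genPos)))).mono ?_⟩
  filter_upwards [eventually_gt_atTop 0, hsmall, hlog, hfive,
    hloginf.eventually_ge_atTop (4 * 144)] with n hn h1 hlogn hfiven hlarge
  rintro X ⟨⟨hu, hw, hcl⟩, hX, hG⟩
  have hn' : (0:ℝ) < n := by exact_mod_cast hn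
  have hrn := hr n
  have hmn : 0 < m n := mesh_pos hℓ0 hrn
  have hmn' : (0:ℝ) < m n := by exact_mod_cast hmn
  have hkey : (m n : ℝ) * ((m n : ℝ) ^ 2 / n) ≤ 216 / (n * r n ^ 3) :=
    mesh_mul_div_le hℓ0 hrn h1 hn
  have hle : n / (m n : ℝ) ^ 2 ≤ n * r n ^ 2 / 16 := div_mesh_sq_le hℓ0 hrn n
  set a : ℝ := n / (m n : ℝ) ^ 2 with ha
  have ha0 : 0 < a := by positivity
  set T : ℝ := n * r n ^ 3 with hT
  have hT0 : 0 < T := by positivity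
  have haT : a ≤ 1 / T := by
    rw [le_div_iff₀ hT0]
    have : n * r n ^ 2 / 16 ≤ n * r n ^ 2 := by
      have : 0 ≤ (n:ℝ) * r n ^ 2 := by positivity
      linarith
    calc a * T ≤ n * r n ^ 2 * T := by gcongr; exact hle.trans this
      _ ≤ 1 := hfiven
  refine supportsRate_of_near hn hG (by positivity)
    (B := 2 * ((4 + 12 * ℓ) * (9 * ℓ ^ 2 * (u₀ * a))) +
      4 * (ℓ * m n * (u₀ * a) * (9 * (12 * ℓ / (a / 4) ^ 2)))) ?_
    fun σ hσ cap l hl hcap => exists_feasibleFlow_of_windows (q := ⌈4 / (ℓ * r n)⌉₊) hmn hX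
      (mesh_mul_ge hℓ0 hrn) (mesh_mul_le hℓ0 hrn h1) (by linarith) hw rfl (by omega) hℓ.ge
      hu le_rfl hcl hσ hl hcap
  have e1 : (m n : ℝ) ^ 2 / n = 1 / a := by rw [ha]; field_simp
  rw [e1] at hkey
  have e2 : 2 * ((4 + 12 * ℓ) * (9 * ℓ ^ 2 * (u₀ * a))) +
      4 * (ℓ * m n * (u₀ * a) * (9 * (12 * ℓ / (a / 4) ^ 2)))
      = 2 * ((4 + 12 * ℓ) * (9 * ℓ ^ 2 * u₀)) * a +
        4 * (ℓ * u₀ * (9 * (12 * ℓ * 16))) * (m n * (1 / a)) := by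
    field_simp
    ring
  rw [e2]
  calc 1 / C * T * (2 * ((4 + 12 * ℓ) * (9 * ℓ ^ 2 * u₀)) * a +
        4 * (ℓ * u₀ * (9 * (12 * ℓ * 16))) * (m n * (1 / a)))
      ≤ 1 / C * T * (2 * ((4 + 12 * ℓ) * (9 * ℓ ^ 2 * u₀)) * (1 / T) +
        4 * (ℓ * u₀ * (9 * (12 * ℓ * 16))) * (216 / T)) := by gcongr
    _ = 1 / C * T * (C * (1 / T)) := by rw [hC]; ring
    _ = 1 := by field_simp
    _ ≤ 1 := le_rfl

end Rates

/-! ### Adding the random destinations -/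

section NetworkLaw

lemma derangements_nonempty {n : ℕ} (hn : 2 ≤ n) : (derangements (Fin n)).Nonempty := by
  obtain ⟨m, rfl⟩ : ∃ m, n = m + 2 := ⟨n - 2, by omega⟩
  refine ⟨finRotate (m + 2), fun i => ?_⟩
  rw [finRotate_apply]
  simp

lemma isProbabilityMeasure_uniformOn_derangements {n : ℕ} (hn : 2 ≤ n) :
    IsProbabilityMeasure (ProbabilityTheory.uniformOn (derangements (Fin n))) :=
  ProbabilityTheory.isProbabilityMeasure_uniformOn (Set.toFinite _) (derangements_nonempty hn)

lemma isProbabilityMeasure_networkLaw {n : ℕ} (hn : 2 ≤ n) :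
    IsProbabilityMeasure (networkLaw n) := by
  have := isProbabilityMeasure_uniformOn_derangements hn
  unfold networkLaw
  infer_instance

/-- A bound uniform over fixed derangements passes to the product, by decomposition into finitely
many slices `{σ}`; measurability in `X` is not needed. For `n ≥ 2` derangements exist and the law is
a probability measure. -/
lemma networkLaw_le {n : ℕ} (hn : 2 ≤ n) {G : (Fin n → Plane) → Equiv.Perm (Fin n) → Prop}
    {b : ENNReal} (h : ∀ σ : Equiv.Perm (Fin n), (∀ k, σ k ≠ k) → nodeLaw n {X | ¬ G X σ} ≤ b) :
    networkLaw n {ω | ¬ ((∀ k, ω.2 k ≠ k) ∧ G ω.1 ω.2)} ≤ b := by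
  have := isProbabilityMeasure_uniformOn_derangements hn
  set U := ProbabilityTheory.uniformOn (derangements (Fin n)) with hU
  have hsub : {ω : (Fin n → Plane) × Equiv.Perm (Fin n) | ¬ ((∀ k, ω.2 k ≠ k) ∧ G ω.1 ω.2)}
      ⊆ (Set.univ ×ˢ (derangements (Fin n))ᶜ) ∪
        ⋃ σ ∈ (Finset.univ.filter fun σ : Equiv.Perm (Fin n) => ∀ k, σ k ≠ k),
          {X | ¬ G X σ} ×ˢ {σ} := by
    rintro ⟨X, σ⟩ h
    simp only [Set.mem_ofPred_eq] at h
    by_cases hσ : ∀ k, σ k ≠ k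
    · right
      simp only [Set.mem_iUnion, Finset.mem_filter, Finset.mem_univ, true_and]
      exact ⟨σ, hσ, ⟨fun hG => h ⟨hσ, hG⟩, rfl⟩⟩
    · exact Or.inl ⟨trivial, hσ⟩
  have h0 : U (derangements (Fin n))ᶜ = 0 := by
    rw [prob_compl_eq_zero_iff (Set.toFinite _).measurableSet]
    exact ProbabilityTheory.uniformOn_self (Set.toFinite _) (derangements_nonempty hn)
  calc _ ≤ (nodeLaw n).prod U (Set.univ ×ˢ (derangements (Fin n))ᶜ) +
        ∑ σ ∈ (Finset.univ.filter fun σ : Equiv.Perm (Fin n) => ∀ k, σ k ≠ k),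
          (nodeLaw n).prod U ({X | ¬ G X σ} ×ˢ {σ}) :=
        (measure_mono hsub).trans ((measure_union_le _ _).trans
          (add_le_add_right (measure_biUnion_finset_le _ _) _))
    _ ≤ 0 + ∑ σ ∈ (Finset.univ.filter fun σ : Equiv.Perm (Fin n) => ∀ k, σ k ≠ k), b * U {σ} := by
        refine add_le_add ?_ (Finset.sum_le_sum fun σ hσ => ?_)
        · rw [Measure.prod_prod, h0, mul_zero]
        · rw [Measure.prod_prod]
          gcongr
          exact h σ (Finset.mem_filter.1 hσ).2
    _ ≤ b := by
        rw [zero_add, ← Finset.mul_sum, sum_measure_singleton]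
        exact mul_le_of_le_one_right zero_le prob_le_one

lemma whp_networkLaw_of_le {G : ∀ n, (Fin n → Plane) → Equiv.Perm (Fin n) → Prop}
    {b : ℕ → ENNReal} (hb : Tendsto b atTop (𝓝 0))
    (h : ∀ n, ∀ σ : Equiv.Perm (Fin n), (∀ k, σ k ≠ k) → nodeLaw n {X | ¬ G n X σ} ≤ b n) :
    Whp networkLaw fun n ω => (∀ k, ω.2 k ≠ k) ∧ G n ω.1 ω.2 := by
  refine tendsto_of_tendsto_of_tendsto_of_le_of_le' tendsto_const_nhds hb
    (Eventually.of_forall fun _ => zero_le) ?_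
  filter_upwards [eventually_ge_atTop 2] with n hn using networkLaw_le hn (h n)

lemma Whp.network {G : ∀ n, (Fin n → Plane) → Prop} (h : Whp nodeLaw G) :
    Whp networkLaw fun n ω => (∀ k, ω.2 k ≠ k) ∧ G n ω.1 :=
  whp_networkLaw_of_le (G := fun n X _ => G n X) h fun _ _ _ => le_rfl

lemma Whp.tendsto_one_network {G : ∀ n, (Fin n → Plane) × Equiv.Perm (Fin n) → Prop}
    (hG : Whp networkLaw G) : Tendsto (fun n => networkLaw n {ω | G n ω}) atTop (𝓝 1) := by
  have h1 : Tendsto (fun n => 1 - networkLaw n {ω | ¬ G n ω}) atTop (𝓝 (1 - 0)) :=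
    ENNReal.Tendsto.sub tendsto_const_nhds hG (by simp)
  rw [tsub_zero] at h1
  refine tendsto_of_tendsto_of_tendsto_of_le_of_le' h1 tendsto_const_nhds ?_ ?_
  · filter_upwards [eventually_ge_atTop 2] with n hn
    have := isProbabilityMeasure_networkLaw hn
    rw [tsub_le_iff_right]
    calc 1 = networkLaw n Set.univ := measure_univ.symm
      _ ≤ networkLaw n ({ω | G n ω} ∪ {ω | ¬ G n ω}) :=
          measure_mono fun ω _ => em (G n ω)
      _ ≤ _ := measure_union_le _ _
  · filter_upwards [eventually_ge_atTop 2] with n hn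
    have := isProbabilityMeasure_networkLaw hn
    exact prob_le_one

end NetworkLaw

/-! ### Pairs that have to cross the cut -/

section Crossing

variable {n : ℕ}

/-- The left half of the unit square. -/
def leftHalf : Set Plane := rect 0 (1 / 2) 0 1

/-- The right half of the unit square. -/
def rightHalf : Set Plane := rect (1 / 2) 1 0 1

lemma sq_leftHalf : sq.real leftHalf = 1 / 2 := by
  rw [leftHalf, sq_real_of_subset, volume_real_rect (by norm_num) (by norm_num)]
  · norm_num
  · exact rect_subset_unitSquare le_rfl (by norm_num) le_rfl le_rfl

lemma sq_rightHalf : sq.real rightHalf = 1 / 2 := by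
  rw [rightHalf, sq_real_of_subset, volume_real_rect (by norm_num) (by norm_num)]
  · norm_num
  · exact rect_subset_unitSquare (by norm_num) le_rfl le_rfl le_rfl

lemma disjoint_halves : Disjoint leftHalf rightHalf := by
  rw [Set.disjoint_left]
  intro p hp hp'
  have h1 := hp.1.2
  have h2 := hp'.1.1
  linarith

/-- The event that the source is on the left and its destination on the right. -/
def crossEvent (σ : Equiv.Perm (Fin n)) (k : Fin n) : Set (Fin n → Plane) :=
  {X | X k ∈ leftHalf ∧ X (σ k) ∈ rightHalf}

lemma measurableSet_crossEvent (σ : Equiv.Perm (Fin n)) (k : Fin n) :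
    MeasurableSet (crossEvent σ k) := by
  have h : ∀ i, Measurable fun X : Fin n → Plane => X i := fun i => measurable_pi_apply i
  exact (h k (measurableSet_rect 0 (1 / 2) 0 1)).inter (h (σ k) (measurableSet_rect (1 / 2) 1 0 1))

lemma nodeLaw_crossEvent {σ : Equiv.Perm (Fin n)} {k : Fin n} (hσ : σ k ≠ k) :
    (nodeLaw n).real (crossEvent σ k) = 1 / 4 := by
  have h := nodeLaw_finset_box {k, σ k} fun i => if i = k then leftHalf else rightHalf
  rw [Finset.prod_pair hσ.symm] at h
  simp only [hσ, if_true, if_false, sq_leftHalf, sq_rightHalf] at h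
  rw [crossEvent, show (1:ℝ) / 4 = 1 / 2 * (1 / 2) by norm_num, ← h]
  congr 1
  ext X
  simp [hσ]

/-- If the two pairs chain at a node, it would have to be on both sides. Otherwise four distinct
independent nodes are involved. So the events are never positively correlated. -/
lemma nodeLaw_crossEvent_inter {σ : Equiv.Perm (Fin n)} (hσ : ∀ k, σ k ≠ k) {k l : Fin n}
    (hkl : k ≠ l) : (nodeLaw n).real (crossEvent σ k ∩ crossEvent σ l) ≤ 1 / 16 := by
  have hd := Set.disjoint_left.1 disjoint_halves
  by_cases h1 : l = σ k
  · have : crossEvent σ k ∩ crossEvent σ l = ∅ := by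
      rw [Set.eq_empty_iff_forall_notMem]
      rintro X ⟨hX, hX'⟩
      exact hd hX'.1 (h1 ▸ hX.2)
    rw [this]; simp
  by_cases h2 : k = σ l
  · have : crossEvent σ k ∩ crossEvent σ l = ∅ := by
      rw [Set.eq_empty_iff_forall_notMem]
      rintro X ⟨hX, hX'⟩
      exact hd hX.1 (h2 ▸ hX'.2)
    rw [this]; simp
  have h3 : σ k ≠ σ l := fun h => hkl (σ.injective h)
  have h := nodeLaw_finset_box {k, l, σ k, σ l}
    fun i => if i = k ∨ i = l then leftHalf else rightHalf
  rw [Finset.prod_insert (by simp [hkl, (hσ k).symm, h2]),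
    Finset.prod_insert (by simp [(hσ l).symm, h1]), Finset.prod_pair h3] at h
  simp only [hσ, Ne.symm h1, Ne.symm h2, or_self, true_or, or_true, if_true, if_false, sq_leftHalf,
    sq_rightHalf] at h
  rw [show (1:ℝ) / 16 = 1 / 2 * (1 / 2 * (1 / 2 * (1 / 2))) by norm_num, ← h]
  refine measureReal_mono ?_ (measure_ne_top _ _)
  rintro X ⟨hX, hX'⟩ i hi
  simp only [Finset.mem_insert, Finset.mem_singleton] at hi
  rcases hi with rfl | rfl | rfl | rfl
  · simpa using hX.1
  · simpa using hX'.1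
  · simpa [hσ, Ne.symm h1] using hX.2
  · simpa [hσ, Ne.symm h2] using hX'.2

/-- The number of pairs with the source on the left and the destination on the right. -/
def crossCount (X : Fin n → Plane) (σ : Equiv.Perm (Fin n)) : ℕ :=
  (Finset.univ.filter fun k => X ∈ crossEvent σ k).card

lemma crossCount_eq (X : Fin n → Plane) (σ : Equiv.Perm (Fin n)) :
    (crossCount X σ : ℝ) = ∑ k, (crossEvent σ k).indicator (fun _ => (1:ℝ)) X := by
  rw [crossCount, Finset.card_filter]
  push_cast
  exact Finset.sum_congr rfl fun k _ => by rw [Set.indicator_apply]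

lemma crossCount_sq_eq (X : Fin n → Plane) (σ : Equiv.Perm (Fin n)) :
    (crossCount X σ : ℝ) ^ 2
      = ∑ k, ∑ l, (crossEvent σ k ∩ crossEvent σ l).indicator (fun _ => (1:ℝ)) X := by
  rw [crossCount_eq, pow_two, Finset.sum_mul_sum]
  refine Finset.sum_congr rfl fun k _ => Finset.sum_congr rfl fun l _ => ?_
  simp only [Set.indicator_apply, Set.mem_inter_iff]
  split_ifs <;> simp_all

/-- Chebyshev: the mean is `n / 4` and the variance at most `n / 4`. -/
lemma crossCount_lower {σ : Equiv.Perm (Fin n)} (hσ : ∀ k, σ k ≠ k) (hn : 0 < n) :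
    (nodeLaw n).real {X | ¬ (n : ℝ) / 8 ≤ crossCount X σ} ≤ 16 / n := by
  have hn' : (0:ℝ) < n := by exact_mod_cast hn
  have hi1 : ∀ s : Set (Fin n → Plane), MeasurableSet s →
      Integrable (s.indicator fun _ => (1:ℝ)) (nodeLaw n) := fun s hs =>
    (integrable_const 1).indicator hs
  have hm2 := fun k l => (measurableSet_crossEvent σ k).inter (measurableSet_crossEvent σ l)
  have I1 : Integrable (fun X => (crossCount X σ : ℝ)) (nodeLaw n) := by
    simp only [crossCount_eq]
    exact integrable_finsetSum _ fun k _ => hi1 _ (measurableSet_crossEvent σ k)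
  have I2 : Integrable (fun X => (crossCount X σ : ℝ) ^ 2) (nodeLaw n) := by
    simp only [crossCount_sq_eq]
    exact integrable_finsetSum _ fun k _ => integrable_finsetSum _ fun l _ => hi1 _ (hm2 k l)
  have E1 : ∫ X, (crossCount X σ : ℝ) ∂nodeLaw n = n / 4 := by
    simp only [crossCount_eq]
    rw [integral_finsetSum _ fun k _ => hi1 _ (measurableSet_crossEvent σ k)]
    simp only [integral_indicator_const _ (measurableSet_crossEvent σ _), nodeLaw_crossEvent (hσ _)]
    simp; ring
  have E2 : ∫ X, (crossCount X σ : ℝ) ^ 2 ∂nodeLaw n ≤ n / 4 + n ^ 2 / 16 := by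
    simp only [crossCount_sq_eq]
    rw [integral_finsetSum _ fun k _ => integrable_finsetSum _ fun l _ => hi1 _ (hm2 k l)]
    calc _ = ∑ k, ∑ l, (nodeLaw n).real (crossEvent σ k ∩ crossEvent σ l) := by
          refine Finset.sum_congr rfl fun k _ => ?_
          rw [integral_finsetSum _ fun l _ => hi1 _ (hm2 k l)]
          refine Finset.sum_congr rfl fun l _ => ?_
          rw [integral_indicator_const _ (hm2 k l)]
          simp
      _ ≤ ∑ k : Fin n, ∑ l : Fin n, ((if l = k then 1 / 4 else 0) + 1 / 16 : ℝ) := by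
          refine Finset.sum_le_sum fun k _ => Finset.sum_le_sum fun l _ => ?_
          split_ifs with h
          · rw [h, Set.inter_self, nodeLaw_crossEvent (hσ k)]; norm_num
          · rw [zero_add]; exact nodeLaw_crossEvent_inter hσ (Ne.symm h)
      _ = _ := by
          simp only [Finset.sum_add_distrib, Finset.sum_ite_eq', Finset.mem_univ, if_true]
          simp; ring
  have hvar : ∫ X, ((crossCount X σ : ℝ) - (n : ℝ) / 4) ^ 2 ∂nodeLaw n ≤ (n : ℝ) / 4 := by
    have : ∀ X : Fin n → Plane, ((crossCount X σ : ℝ) - n / 4) ^ 2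
        = ((crossCount X σ : ℝ) ^ 2 - n / 2 * crossCount X σ) + n ^ 2 / 16 := fun X => by ring
    simp only [this]
    have I3 : Integrable (fun X => (crossCount X σ : ℝ) ^ 2 - n / 2 * crossCount X σ)
      (nodeLaw n) := I2.sub (I1.const_mul _)
    rw [integral_add I3 (integrable_const _),
      integral_sub I2 (I1.const_mul _), integral_const_mul, E1]
    simp
    nlinarith
  have hint : Integrable (fun X => ((crossCount X σ : ℝ) - n / 4) ^ 2) (nodeLaw n) := by
    have : (fun X : Fin n → Plane => ((crossCount X σ : ℝ) - n / 4) ^ 2)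
        = fun X => ((crossCount X σ : ℝ) ^ 2 - n / 2 * crossCount X σ) + n ^ 2 / 16 := by
      funext X; ring
    rw [this]
    exact (I2.sub (I1.const_mul _)).add (integrable_const _)
  have hmk := mul_meas_ge_le_integral_of_nonneg (μ := nodeLaw n)
    (f := fun X => ((crossCount X σ : ℝ) - n / 4) ^ 2)
    (Eventually.of_forall fun X => sq_nonneg _) hint ((n:ℝ) ^ 2 / 64)
  have hsub : {X : Fin n → Plane | ¬ (n : ℝ) / 8 ≤ crossCount X σ}
      ⊆ {X | (n:ℝ) ^ 2 / 64 ≤ ((crossCount X σ : ℝ) - n / 4) ^ 2} := by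
    intro X hX
    simp only [Set.mem_ofPred_eq, not_le] at hX ⊢
    nlinarith
  have h1 := measureReal_mono hsub (measure_ne_top (nodeLaw n) _)
  rw [le_div_iff₀ hn']
  have h2 : (n:ℝ) ^ 2 / 64 * (nodeLaw n).real {X | ¬ (n : ℝ) / 8 ≤ crossCount X σ} ≤ n / 4 :=
    (mul_le_mul_of_nonneg_left h1 (by positivity)).trans (hmk.trans hvar)
  nlinarith

lemma whp_crossCount : Whp networkLaw fun n ω =>
    (∀ k, ω.2 k ≠ k) ∧ (n : ℝ) / 8 ≤ crossCount ω.1 ω.2 := by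
  have hb : Tendsto (fun n : ℕ => ENNReal.ofReal (16 / n)) atTop (𝓝 0) := by
    have := ENNReal.tendsto_ofReal (tendsto_const_div_nat 16)
    rwa [ENNReal.ofReal_zero] at this
  refine whp_networkLaw_of_le (G := fun n X σ => (n : ℝ) / 8 ≤ crossCount X σ) hb
    fun n σ hσ => ?_
  rcases Nat.eq_zero_or_pos n with rfl | hn
  · simp
  rw [← ofReal_measureReal]
  exact ENNReal.ofReal_le_ofReal (crossCount_lower hσ hn)

/-- The throughput is bounded by the number of links across the cut. -/
lemma throughput_le_cutEdges {X : Fin n → Plane} {σ : Equiv.Perm (Fin n)} {r cap : ℝ}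
    (hn : 0 < n) (hcap : 0 ≤ cap) (hσ : (n : ℝ) / 8 ≤ crossCount X σ) :
    throughput X r σ cap ≤ cap * (8 * cutEdges X r / n) := by
  have hn' : (0:ℝ) < n := by exact_mod_cast hn
  refine csSup_le ⟨0, _, IsFeasibleFlow.zero hcap⟩ ?_
  rintro l ⟨f, hf⟩
  -- A negative rate is not excluded by the definition and is trivially below the bound.
  rcases le_total l 0 with hl | hl
  · exact hl.trans (by positivity)
  have h := hf.cut_bound (Finset.univ.filter fun k => X k 0 < 1 / 2)
  have e1 : (crossCount X σ : ℝ) ≤ ((Finset.univ.filter fun k =>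
      k ∈ (Finset.univ.filter fun k => X k 0 < 1 / 2) ∧
        σ k ∉ Finset.univ.filter fun k => X k 0 < 1 / 2).card : ℝ) := by
    refine Nat.cast_le.2 (Finset.card_le_card fun k hk => ?_)
    simp only [Finset.mem_filter, Finset.mem_univ, true_and, not_lt] at hk ⊢
    exact ⟨hk.1.1.2, hk.2.1.1⟩
  have e2 : ((((Finset.univ.filter fun k => X k 0 < 1 / 2) ×ˢ
      (Finset.univ.filter fun k => X k 0 < 1 / 2)ᶜ).filter fun e => Link X r e.1 e.2).card : ℝ)
      = cutEdges X r := by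
    rw [cutEdges, ← Set.ncard_coe_finset]
    congr 2
    ext e
    simp [and_assoc]
  rw [e2] at h
  have h2 : (n:ℝ) / 8 * l ≤ cap * cutEdges X r :=
    (mul_le_mul_of_nonneg_right (hσ.trans e1) hl).trans h
  rw [← mul_div_assoc, le_div_iff₀ hn']
  linarith

end Crossing

/-! ### Few links across the cut -/

section CutUpper

variable {n m q : ℕ} {X : Fin n → Plane} {r u : ℝ}

/-- A disc about a node meets at most `13 * 13` tiles, those within `6` of its own in both
directions. -/
lemma card_dist_le (hm : 0 < m) (hX : ∀ i, X i ∈ openSquare) (hmr : m * r ≤ 6)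
    (hu : TilesUpper X m u) (i : Fin n) :
    ((Finset.univ.filter fun j => dist (X i) (X j) ≤ r).card : ℝ) ≤ 169 * u := by
  have hu0 : 0 ≤ u := (Nat.cast_nonneg _).trans (hu 0 hm 0 hm)
  set I : Fin 2 → Finset ℕ := fun c => Finset.Ico (cell m (X i) c - 6) (cell m (X i) c + 7) with hI
  have hIc : ∀ c, ((I c).card : ℝ) ≤ 13 := fun c => by
    rw [hI]
    simp only [Nat.card_Ico]
    exact_mod_cast (by omega : cell m (X i) c + 7 - (cell m (X i) c - 6) ≤ 13)
  refine (Nat.cast_le.2 (Finset.card_le_card fun j hj => ?_)).trans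
    ((card_cell_mem_le hm hX hu (I 0) (I 1)).trans ?_)
  · simp only [Finset.mem_filter, Finset.mem_univ, true_and, hI, Finset.mem_Ico] at hj ⊢
    have h1 := fun c => cell_lt_of_dist_le (m := m) hX hmr hj c
    have h2 := fun c => cell_lt_of_dist_le (m := m) hX hmr (by rwa [dist_comm] at hj) c
    have := h1 0; have := h1 1; have := h2 0; have := h2 1
    omega
  · calc _ ≤ (13:ℝ) * 13 * u := by gcongr <;> exact hIc _
      _ = _ := by ring

lemma cell_lt_half (hmq : m = 2 * q) {p : Plane} (hp : p ∈ openSquare) (h : p 0 < 1 / 2)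
    (hq : 0 < q) : cell m p 0 < q := by
  have hq' : (0:ℝ) < q := by exact_mod_cast hq
  have h1 := cell_le_mul (m := m) hp 0
  rw [hmq] at h1 ⊢
  push_cast at h1
  have : (cell (2 * q) p 0 : ℝ) < q := by nlinarith
  exact_mod_cast this

lemma half_le_cell (hmq : m = 2 * q) {p : Plane} (h : 1 / 2 ≤ p 0) : q ≤ cell m p 0 := by
  refine Nat.le_floor ?_
  rw [hmq]
  push_cast
  have : (0:ℝ) ≤ q := Nat.cast_nonneg q
  nlinarith

/-- For even `m` the cut runs along tile boundaries, and transmitters of crossing links lie in the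
seven tile columns to its left. -/
lemma cutEdges_le_of_tiles (hq : 0 < q) (hmq : m = 2 * q) (hX : ∀ i, X i ∈ openSquare)
    (hmr : m * r ≤ 6) (hu : TilesUpper X m u) : (cutEdges X r : ℝ) ≤ 7 * m * u * (169 * u) := by
  have hm : 0 < m := by omega
  have hu0 : 0 ≤ u := (Nat.cast_nonneg _).trans (hu 0 hm 0 hm)
  set I := Finset.univ.filter fun i => cell m (X i) 0 ∈ Finset.Ico (q - 7) q with hI
  have hIc : (I.card : ℝ) ≤ 7 * m * u := by
    refine (card_cell_mem_zero_le hm hX hu _).trans ?_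
    have : ((Finset.Ico (q - 7) q).card : ℝ) ≤ 7 := by
      rw [Nat.card_Ico]
      exact_mod_cast (by omega : q - (q - 7) ≤ 7)
    gcongr
  have hsub : {e : Fin n × Fin n | X e.1 0 < 1 / 2 ∧ 1 / 2 ≤ X e.2 0 ∧ Link X r e.1 e.2}
      ⊆ ((I.biUnion fun i => (Finset.univ.filter fun j => dist (X i) (X j) ≤ r).image
        fun j => (i, j) : Finset (Fin n × Fin n)) : Set (Fin n × Fin n)) := by
    rintro ⟨i, j⟩ ⟨h1, h2, h3⟩
    simp only [Finset.coe_biUnion, Set.mem_iUnion, Finset.mem_coe, Finset.mem_image, hI,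
      Finset.mem_filter, Finset.mem_univ, true_and, exists_prop, Finset.mem_Ico]
    refine ⟨i, ⟨?_, cell_lt_half hmq (hX i) h1 hq⟩, j, h3.2.1, rfl⟩
    have e1 := half_le_cell hmq h2
    have e2 := cell_lt_of_dist_le (m := m) hX hmr (by have := h3.2.1; rwa [dist_comm] at this) 0
    simp only at e1 e2
    omega
  have h1 : (cutEdges X r : ℝ) ≤ ∑ i ∈ I,
      (((Finset.univ.filter fun j => dist (X i) (X j) ≤ r).image fun j => (i, j)).card : ℝ) := by
    refine (Nat.cast_le.2 (Set.ncard_le_ncard hsub (Finset.finite_toSet _))).trans ?_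
    rw [Set.ncard_coe_finset]
    exact_mod_cast Finset.card_biUnion_le
  refine h1.trans ?_
  calc _ ≤ ∑ i ∈ I, 169 * u := by
        refine Finset.sum_le_sum fun i _ => ?_
        exact (Nat.cast_le.2 Finset.card_image_le).trans (card_dist_le hm hX hmr hu i)
    _ ≤ _ := by
        rw [Finset.sum_const, nsmul_eq_mul]
        gcongr

lemma cutEdges_le_sq (X : Fin n → Plane) (r : ℝ) : (cutEdges X r : ℝ) ≤ (n : ℝ) ^ 2 := by
  have h : cutEdges X r ≤ n * n := by
    have := Set.ncard_le_card {e : Fin n × Fin n | X e.1 0 < 1 / 2 ∧ 1 / 2 ≤ X e.2 0 ∧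
      Link X r e.1 e.2}
    simpa [Nat.card_eq_fintype_card, cutEdges] using this
  rw [pow_two]
  exact_mod_cast h

end CutUpper

/-! ### Upper bounds at a connectivity radius -/

section Connectivity

variable {d : ℕ → ℝ}

lemma IsConnectivityRadius.log_le (hconn : IsConnectivityRadius d) :
    ∀ᶠ n : ℕ in atTop, Real.log n / 4 ≤ n * d n ^ 2 := by
  obtain ⟨ξ, hξ, h⟩ := hconn
  filter_upwards [eventually_gt_atTop 0, hξ.eventually_ge_atTop 0] with n hn h1
  have hn' : (0:ℝ) < n := by exact_mod_cast hn
  have h2 := h n hn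
  rw [eq_div_iff hn'.ne'] at h2
  have h3 := Real.pi_le_four
  have h4 : 0 ≤ (n:ℝ) * d n ^ 2 := by positivity
  nlinarith

lemma IsConnectivityRadius.log_le_min (hconn : IsConnectivityRadius d) :
    ∀ᶠ n : ℕ in atTop, Real.log n / 4 ≤ n * (min (d n) 1) ^ 2 := by
  filter_upwards [hconn.log_le, eventually_gt_atTop 0] with n h1 hn
  rcases min_cases (d n) 1 with h | h
  · rw [h.1]; exact h1
  · rw [h.1]
    have hn' : (0:ℝ) < n := by exact_mod_cast hn
    have := Real.log_le_sub_one_of_pos hn'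
    linarith

lemma IsConnectivityRadius.log_le_mesh (hd : ∀ n, 0 < d n) (hconn : IsConnectivityRadius d) :
    ∀ᶠ n : ℕ in atTop, Real.log n ≤ 144 * (n / (mesh 2 (min (d n) 1) : ℝ) ^ 2) := by
  filter_upwards [hconn.log_le_min] with n h
  have h1 := le_div_mesh_sq (l := 2) (by norm_num) (lt_min (hd n) one_pos)
    (by have := min_le_right (d n) 1; push_cast; linarith) n
  linarith

/-- The radius may be unbounded, so the mesh is built for `min (d n) 1`. Once `d n ≥ 1`, the trivial
bound `n ^ 2` by the number of pairs is enough. -/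
theorem whp_cutEdges_le (hd : ∀ n, 0 < d n) (hconn : IsConnectivityRadius d) :
    ∃ C > 0, Whp nodeLaw fun n X => (cutEdges X (d n) : ℝ) ≤ C * ((n : ℝ) ^ 2 * d n ^ 3) := by
  have hr : ∀ n, 0 < min (d n) 1 := fun n => lt_min (hd n) one_pos
  have hup := whp_tilesUpper (m := fun n => mesh 2 (min (d n) 1))
    (Eventually.of_forall fun n => mesh_pos (by norm_num) (hr n)) (hconn.log_le_mesh hd)
  refine ⟨7 * 169 * (2 + 3 * 144) ^ 2 * 6, by norm_num, (hup.and (whp_of_ae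
    (G := fun n X => ∀ i, X i ∈ openSquare)
    (Eventually.of_forall fun n => ae_forall_mem ae_openSquare))).mono ?_⟩
  refine Eventually.of_forall fun n X ⟨hu, hX⟩ => ?_
  have hdn := hd n
  rcases le_total (d n) 1 with h | h
  · rw [min_eq_left h] at hu
    have h2 : ((2:ℕ):ℝ) * d n ≤ 2 := by push_cast; linarith
    have hmr := mesh_mul_le (by norm_num) hdn h2
    have hmp := mesh_pos (l := 2) (by norm_num) hdn
    have h1 := cutEdges_le_of_tiles (m := mesh 2 (d n)) (q := ⌈4 / ((2:ℕ) * d n)⌉₊)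
      (by have : mesh 2 (d n) = 2 * ⌈4 / ((2:ℕ) * d n)⌉₊ := rfl
          omega) rfl hX hmr hu
    refine h1.trans ?_
    have h3 := mesh_le (by norm_num) hdn h2
    have h4 := div_mesh_sq_le (l := 2) (by norm_num) hdn n
    have h5 : n / (mesh 2 (d n) : ℝ) ^ 2 ≤ n * d n ^ 2 := by
      have : 0 ≤ (n:ℝ) * d n ^ 2 := by positivity
      linarith
    calc _ = 7 * 169 * (2 + 3 * 144) ^ 2 * (mesh 2 (d n) * (n / (mesh 2 (d n) : ℝ) ^ 2) ^ 2) := by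
          ring
      _ ≤ 7 * 169 * (2 + 3 * 144) ^ 2 * (6 / d n * (n * d n ^ 2) ^ 2) := by gcongr
      _ = _ := by field_simp
  · refine (cutEdges_le_sq X _).trans ?_
    have : (1:ℝ) ≤ d n ^ 3 := one_le_pow₀ h
    have h2 : 0 ≤ (n:ℝ) ^ 2 := by positivity
    calc (n:ℝ) ^ 2 ≤ (n:ℝ) ^ 2 * d n ^ 3 := le_mul_of_one_le_right h2 this
      _ ≤ _ := le_mul_of_one_le_left (by positivity) (by norm_num)

/-- The throughput is at most of the order `n * d ^ 3`. -/
theorem whp_throughput_le (hd : ∀ n, 0 < d n) (hconn : IsConnectivityRadius d) :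
    ∃ C > 0, ∀ cap : ℝ, 0 ≤ cap → Whp networkLaw fun n ω =>
      throughput ω.1 (d n) ω.2 cap ≤ cap * (C * (n * d n ^ 3)) := by
  obtain ⟨C, hC, h⟩ := whp_cutEdges_le hd hconn
  refine ⟨8 * C, by positivity, fun cap hcap => (h.network.and whp_crossCount).mono ?_⟩
  filter_upwards [eventually_gt_atTop 0] with n hn
  rintro ω ⟨⟨-, h1⟩, -, h2⟩
  have hn' : (0:ℝ) < n := by exact_mod_cast hn
  refine (throughput_le_cutEdges hn hcap h2).trans ?_
  refine mul_le_mul_of_nonneg_left ?_ hcap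
  rw [div_le_iff₀ hn']
  nlinarith

end Connectivity

/-! ### Many links across the cut -/

section CutLower

variable {n m q : ℕ} {X : Fin n → Plane} {r A : ℝ}

lemma mul_measureReal_card_le {Ω : Type*} [MeasurableSpace Ω] (P : Measure Ω)
    [IsProbabilityMeasure P] {ι : Type*} (S : Finset ι) (E : ι → Set Ω)
    (hE : ∀ i, MeasurableSet (E i)) (t : ℝ) :
    t * P.real {ω | t ≤ ((S.filter fun i => ω ∈ E i).card : ℝ)} ≤ ∑ i ∈ S, P.real (E i) := by
  have hi : ∀ i, Integrable ((E i).indicator fun _ => (1:ℝ)) P := fun i =>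
    (integrable_const 1).indicator (hE i)
  have h1 : ∀ ω, ((S.filter fun i => ω ∈ E i).card : ℝ)
      = ∑ i ∈ S, (E i).indicator (fun _ => (1:ℝ)) ω := fun ω => by
    rw [Finset.card_filter]
    push_cast
    exact Finset.sum_congr rfl fun k _ => by rw [Set.indicator_apply]
  have h := mul_meas_ge_le_integral_of_nonneg (μ := P)
    (f := fun ω => ∑ i ∈ S, (E i).indicator (fun _ => (1:ℝ)) ω)
    (Eventually.of_forall fun ω => Finset.sum_nonneg fun i _ =>
      Set.indicator_nonneg (fun _ _ => zero_le_one) _)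
    (integrable_finsetSum _ fun i _ => hi i) t
  simp only [h1]
  refine h.trans_eq ?_
  rw [integral_finsetSum _ fun i _ => hi i]
  refine Finset.sum_congr rfl fun i _ => ?_
  rw [integral_indicator_const _ (hE i)]
  simp

/-- The tile columns `q` and `q + 1` touch the cut from the two sides, and all pairs from adjacent
tiles are linked. -/
lemma cutEdges_ge_of_tiles (hmq : m = 2 * (q + 1)) (hX : ∀ i, X i ∈ openSquare) (hG : GenPos X)
    (hmr : 4 ≤ m * r) (hA : 0 ≤ A) (S : Finset ℕ)
    (hS : ∀ y ∈ S, A ≤ cnt X (tile m q y) ∧ A ≤ cnt X (tile m (q + 1) y)) :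
    S.card * A ^ 2 ≤ cutEdges X r := by
  have hm : 0 < m := by omega
  have hm' : (0:ℝ) < m := by exact_mod_cast hm
  set T : ℕ → Finset (Fin n × Fin n) := fun y => tileNodes X m q y ×ˢ tileNodes X m (q + 1) y
    with hT
  have hsub : ((S.biUnion T : Finset (Fin n × Fin n)) : Set (Fin n × Fin n))
      ⊆ {e | X e.1 0 < 1 / 2 ∧ 1 / 2 ≤ X e.2 0 ∧ Link X r e.1 e.2} := by
    rintro ⟨i, j⟩ he
    simp only [Finset.coe_biUnion, Set.mem_iUnion, Finset.mem_coe, hT, Finset.mem_product,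
      exists_prop] at he
    obtain ⟨y, -, hi, hj⟩ := he
    have hnear := near_right hm hX hmr hi hj
    rw [mem_tileNodes hm hX] at hi hj
    have h1 := mul_lt_cell (m := m) (X i) 0
    have h2 := cell_le_mul (m := m) (hX j) 0
    rw [hi.1] at h1
    rw [hj.1] at h2
    have h3 : (m:ℝ) = 2 * (q + 1) := by rw [hmq]; push_cast; ring
    refine ⟨?_, ?_, hG.near_imp_link le_rfl hnear⟩
    · simp only; nlinarith
    · simp only; push_cast at h2; nlinarith
  have h1 : ((S.biUnion T).card : ℝ) ≤ cutEdges X r := by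
    rw [cutEdges, ← Set.ncard_coe_finset]
    exact Nat.cast_le.2 (Set.ncard_le_ncard hsub (Set.toFinite _))
  refine le_trans ?_ h1
  rw [Finset.card_biUnion]
  · push_cast
    rw [← nsmul_eq_mul, ← Finset.sum_const]
    refine Finset.sum_le_sum fun y hy => ?_
    rw [hT, Finset.card_product, pow_two]
    push_cast
    have := hS y hy
    exact mul_le_mul this.1 this.2 hA (Nat.cast_nonneg _)
  · intro y _ y' _ hne
    rw [Function.onFun, Finset.disjoint_left]
    rintro ⟨i, j⟩ h h'
    simp only [hT, Finset.mem_product, mem_tileNodes hm hX] at h h'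
    exact hne (by omega)

/-- The expected number of rows with a poor tile at the cut is at most `2 m exp (-a / 4)`; Markov at
the level `m / 2`. Asking for all rows would fail when the mean occupation is a small multiple of
`log n`. -/
lemma many_good_rows (hq : 0 < q) (hmq : m = 2 * q) :
    (nodeLaw n).real {X | ¬ ((m : ℝ) / 2 ≤ ((Finset.range m).filter fun y =>
      n / (m : ℝ) ^ 2 / 4 ≤ cnt X (tile m (q - 1) y) ∧
        n / (m : ℝ) ^ 2 / 4 ≤ cnt X (tile m q y)).card)}
      ≤ 4 * Real.exp (-(n / (m : ℝ) ^ 2) / 4) := by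
  have hm : 0 < m := by omega
  have hm' : (0:ℝ) < m := by exact_mod_cast hm
  set a : ℝ := n / (m : ℝ) ^ 2 with ha
  have hmeas : ∀ x y, MeasurableSet {X : Fin n → Plane | (cnt X (tile m x y) : ℝ) < a / 4} :=
    fun x y => measurableSet_lt (measurable_cnt (measurableSet_tile m x y)) measurable_const
  obtain ⟨E, hE⟩ : ∃ E : ℕ → Set (Fin n → Plane), E = fun y =>
    {X | (cnt X (tile m (q - 1) y) : ℝ) < a / 4} ∪ {X | (cnt X (tile m q y) : ℝ) < a / 4} :=
    ⟨_, rfl⟩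
  have hsingle : ∀ x < m, ∀ y < m,
      (nodeLaw n).real {X | (cnt X (tile m x y) : ℝ) < a / 4} ≤ Real.exp (-a / 4) := by
    intro x hx y hy
    have := all_bad_le (n := n) (m := m) {(x, y)} (by simp [hx, hy])
    simpa using this
  have hEm : ∀ y < m, (nodeLaw n).real (E y) ≤ 2 * Real.exp (-a / 4) := by
    intro y hy
    rw [hE]
    refine (measureReal_union_le _ _).trans ?_
    have h1 := hsingle (q - 1) (by omega) y hy
    have h2 := hsingle q (by omega) y hy
    linarith
  have hmk := mul_measureReal_card_le (nodeLaw n) (Finset.range m) E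
    (fun y => by rw [hE]; exact (hmeas _ y).union (hmeas _ y)) ((m:ℝ) / 2)
  have hsum : ∑ y ∈ Finset.range m, (nodeLaw n).real (E y) ≤ m * (2 * Real.exp (-a / 4)) := by
    refine (Finset.sum_le_sum fun y hy => hEm y (Finset.mem_range.1 hy)).trans_eq ?_
    simp
  have hsub : {X : Fin n → Plane | ¬ ((m : ℝ) / 2 ≤ ((Finset.range m).filter fun y =>
      a / 4 ≤ cnt X (tile m (q - 1) y) ∧ a / 4 ≤ cnt X (tile m q y)).card)}
      ⊆ {X | (m:ℝ) / 2 ≤ (((Finset.range m).filter fun y => X ∈ E y).card : ℝ)} := by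
    intro X hX
    simp only [Set.mem_ofPred_eq, not_le] at hX ⊢
    have h := Finset.card_filter_add_card_filter_not (s := Finset.range m) fun y =>
      a / 4 ≤ (cnt X (tile m (q - 1) y) : ℝ) ∧ a / 4 ≤ (cnt X (tile m q y) : ℝ)
    have h2 : (Finset.range m).filter (fun y => X ∈ E y)
        = (Finset.range m).filter fun y => ¬ (a / 4 ≤ (cnt X (tile m (q - 1) y) : ℝ) ∧
          a / 4 ≤ (cnt X (tile m q y) : ℝ)) := by
      refine Finset.filter_congr fun y _ => ?_
      simp only [hE, Set.mem_union, Set.mem_ofPred_eq, not_and_or, not_le]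
    rw [h2]
    rw [Finset.card_range] at h
    have h3 : (((Finset.range m).filter fun y => a / 4 ≤ (cnt X (tile m (q - 1) y) : ℝ) ∧
      a / 4 ≤ (cnt X (tile m q y) : ℝ)).card : ℝ) + (((Finset.range m).filter fun y =>
      ¬ (a / 4 ≤ (cnt X (tile m (q - 1) y) : ℝ) ∧ a / 4 ≤ (cnt X (tile m q y) : ℝ))).card : ℝ)
      = m := by exact_mod_cast h
    linarith
  have h1 := measureReal_mono hsub (measure_ne_top (nodeLaw n) _)
  have h2 := mul_le_mul_of_nonneg_left h1 (show (0:ℝ) ≤ m / 2 by positivity)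
  have h3 := h2.trans (hmk.trans hsum)
  have h4 : (m:ℝ) * (2 * Real.exp (-a / 4)) = m / 2 * (4 * Real.exp (-a / 4)) := by ring
  rw [h4] at h3
  exact le_of_mul_le_mul_left h3 (by positivity)

/-- Half of the `m ≥ 4 / r` rows give `(a / 4) ^ 2` links each, where `r = min (d n) 1`. Boundedness
of `d` is needed because the number of links saturates at `n ^ 2`; it lets `d n` be replaced by a
multiple of `r`. -/
theorem whp_cutEdges_ge {d : ℕ → ℝ} (hd : ∀ n, 0 < d n) (hconn : IsConnectivityRadius d)
    (hb : BddAbove (Set.range d)) :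
    ∃ c > 0, Whp nodeLaw fun n X => c * ((n : ℝ) ^ 2 * d n ^ 3) ≤ (cutEdges X (d n) : ℝ) := by
  have hr : ∀ n, 0 < min (d n) 1 := fun n => lt_min (hd n) one_pos
  set m : ℕ → ℕ := fun n => mesh 2 (min (d n) 1) with hm
  set q : ℕ → ℕ := fun n => ⌈4 / ((2:ℕ) * min (d n) 1)⌉₊ with hq
  have hmq : ∀ n, m n = 2 * q n := fun n => rfl
  have hmp : ∀ n, 0 < m n := fun n => mesh_pos (by norm_num) (hr n)
  have hqp : ∀ n, 0 < q n := fun n => by have := hmp n; rw [hmq] at this; omega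
  have hlim : Tendsto (fun n : ℕ => 4 * Real.exp (-(n / (m n : ℝ) ^ 2) / 4)) atTop (𝓝 0) := by
    have h1 : Tendsto (fun n : ℕ => n / (m n : ℝ) ^ 2) atTop atTop := by
      have h2 : Tendsto (fun n : ℕ => Real.log n / 144) atTop atTop :=
        (Real.tendsto_log_atTop.comp tendsto_natCast_atTop_atTop).atTop_div_const (by norm_num)
      refine tendsto_atTop_mono' _ ?_ h2
      filter_upwards [hconn.log_le_mesh hd] with n h
      change Real.log n / 144 ≤ n / (mesh 2 (min (d n) 1) : ℝ) ^ 2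
      linarith
    have h2 : Tendsto (fun n : ℕ => -(n / (m n : ℝ) ^ 2) / 4) atTop atBot :=
      (tendsto_neg_atTop_atBot.comp h1).atBot_div_const (by norm_num)
    simpa using (Real.tendsto_exp_atBot.comp h2).const_mul 4
  have hrows := whp_of_real_le (P := nodeLaw) (Eventually.of_forall fun n =>
    many_good_rows (n := n) (hqp n) (hmq n)) hlim
  obtain ⟨M, hM⟩ := hb
  have hM' : ∀ n, d n ≤ max M 1 := fun n => (hM ⟨n, rfl⟩).trans (le_max_left _ _)
  have hM1 : 1 ≤ max M 1 := le_max_right _ _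
  set M' := max M 1
  have hM0 : 0 < M' := by linarith
  refine ⟨1 / 100000 / M' ^ 3, by positivity, (hrows.and ((whp_of_ae
    (G := fun n X => ∀ i, X i ∈ openSquare)
    (Eventually.of_forall fun n => ae_forall_mem ae_openSquare)).and
    (whp_of_ae (G := fun n X => GenPos X) (Eventually.of_forall ae_genPos)))).mono ?_⟩
  refine Eventually.of_forall fun n X ⟨hrow, hX, hG⟩ => ?_
  have hrn := hr n
  set r := min (d n) 1 with hrdef
  have hdr : d n ≤ M' * r := by
    rcases min_cases (d n) 1 with h | h
    · rw [hrdef, h.1]; exact le_mul_of_one_le_left (hd n).le hM1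
    · rw [hrdef, h.1, mul_one]; exact hM' n
  have hmr : 4 ≤ m n * r := mesh_mul_ge (by norm_num) hrn
  have hmd : 4 ≤ m n * d n := hmr.trans (by gcongr; exact min_le_left _ _)
  set a : ℝ := n / (m n : ℝ) ^ 2 with ha
  have hale : n * r ^ 2 / 36 ≤ a := le_div_mesh_sq (l := 2) (by norm_num) hrn
    (by have := min_le_right (d n) 1; push_cast; linarith) n
  have hqn := hqp n
  have key := cutEdges_ge_of_tiles (q := q n - 1) (A := a / 4) (r := d n)
    (by rw [hmq]; omega) hX hG hmd (by positivity)
    ((Finset.range (m n)).filter fun y => a / 4 ≤ cnt X (tile (m n) (q n - 1) y) ∧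
      a / 4 ≤ cnt X (tile (m n) (q n) y)) (fun y hy => by
        rw [Nat.sub_add_cancel hqn]; exact (Finset.mem_filter.1 hy).2)
  refine le_trans ?_ key
  calc 1 / 100000 / M' ^ 3 * ((n:ℝ) ^ 2 * d n ^ 3)
      ≤ 1 / 100000 / M' ^ 3 * ((n:ℝ) ^ 2 * (M' * r) ^ 3) := by
        have := hd n
        gcongr
    _ = (1 / 100000) * (n ^ 2 * r ^ 3) := by field_simp
    _ ≤ 2 / r * (n * r ^ 2 / 36 / 4) ^ 2 := by
        have : 2 / r * (n * r ^ 2 / 36 / 4) ^ 2 = 2 / 20736 * (n ^ 2 * r ^ 3) := by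
          field_simp; ring
        rw [this]
        have : 0 ≤ (n:ℝ) ^ 2 * r ^ 3 := by positivity
        linarith
    _ ≤ (m n : ℝ) / 2 * (a / 4) ^ 2 := by
        refine mul_le_mul ?_ (by gcongr) (by positivity) (by positivity)
        rw [div_le_div_iff₀ hrn two_pos]
        linarith
    _ ≤ _ := by gcongr

end CutLower

/-! ### The expected number of links across the cut -/

section Expectation

variable {n m q : ℕ} {r : ℝ}

/-- The event that a pair of nodes within range straddles the cut. -/
def cutEvent (r : ℝ) (e : Fin n × Fin n) : Set (Fin n → Plane) :=
  {X | X e.1 0 < 1 / 2 ∧ 1 / 2 ≤ X e.2 0 ∧ e.1 ≠ e.2 ∧ dist (X e.1) (X e.2) ≤ r}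

lemma measurableSet_cutEvent (r : ℝ) (e : Fin n × Fin n) : MeasurableSet (cutEvent r e) := by
  have h : ∀ i, Measurable fun X : Fin n → Plane => X i := fun i => measurable_pi_apply i
  have h0 : ∀ i, Measurable fun X : Fin n → Plane => X i 0 := fun i =>
    (measurable_coord 0).comp (h i)
  exact (measurableSet_lt (h0 e.1) measurable_const).inter
    ((measurableSet_le measurable_const (h0 e.2)).inter
      ((MeasurableSet.const _).inter (measurableSet_le ((h e.1).dist (h e.2)) measurable_const)))

/-- Off the null set of collinear configurations the count is a sum of measurable indicators; this
provides integrability. -/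
lemma cutEdges_ae_eq (n : ℕ) (r : ℝ) : (fun X => (cutEdges X r : ℝ)) =ᵐ[nodeLaw n]
    fun X => ∑ e, (cutEvent r e).indicator (fun _ => (1:ℝ)) X := by
  filter_upwards [ae_genPos n] with X hX
  have : {e : Fin n × Fin n | X e.1 0 < 1 / 2 ∧ 1 / 2 ≤ X e.2 0 ∧ Link X r e.1 e.2}
      = ((Finset.univ.filter fun e => X ∈ cutEvent r e : Finset (Fin n × Fin n)) :
        Set (Fin n × Fin n)) := by
    ext e
    simp [cutEvent, hX.link_iff]
  rw [cutEdges, this, Set.ncard_coe_finset, Finset.card_filter]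
  push_cast
  exact Finset.sum_congr rfl fun k _ => by rw [Set.indicator_apply]

lemma integrable_cutEvent (r : ℝ) (e : Fin n × Fin n) :
    Integrable ((cutEvent r e).indicator fun _ => (1:ℝ)) (nodeLaw n) :=
  (integrable_const 1).indicator (measurableSet_cutEvent r e)

lemma integrable_cutEdges (n : ℕ) (r : ℝ) :
    Integrable (fun X => (cutEdges X r : ℝ)) (nodeLaw n) :=
  (integrable_finsetSum _ fun e _ => integrable_cutEvent r e).congr (cutEdges_ae_eq n r).symm

lemma integral_cutEdges (n : ℕ) (r : ℝ) : ∫ X, (cutEdges X r : ℝ) ∂nodeLaw n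
    = ∑ e, (nodeLaw n).real (cutEvent r e) := by
  rw [integral_congr_ae (cutEdges_ae_eq n r),
    integral_finsetSum _ fun e _ => integrable_cutEvent r e]
  refine Finset.sum_congr rfl fun e _ => ?_
  rw [integral_indicator_const _ (measurableSet_cutEvent r e)]
  simp

lemma nodeLaw_cutEvent_le (hr : 0 < r) (hr1 : r ≤ 1) (e : Fin n × Fin n) :
    (nodeLaw n).real (cutEvent r e) ≤ 20 * r ^ 3 := by
  by_cases hne : e.1 = e.2
  · have : cutEvent r e = ∅ := by
      rw [Set.eq_empty_iff_forall_notMem]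
      exact fun X hX => hX.2.2.1 hne
    rw [this, measureReal_empty]
    positivity
  have h2 : ((2:ℕ):ℝ) * r ≤ 2 := by push_cast; linarith
  obtain ⟨m, hm⟩ : ∃ m, m = mesh 2 r := ⟨_, rfl⟩
  obtain ⟨q, hmq⟩ : ∃ q, m = 2 * q := ⟨_, hm⟩
  have hmp : 0 < m := hm ▸ mesh_pos (by norm_num) hr
  have hq : 0 < q := by omega
  have hmr : m * r ≤ 6 := hm ▸ mesh_mul_le (by norm_num) hr h2
  have hmr' : 4 ≤ m * r := hm ▸ mesh_mul_ge (by norm_num) hr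
  have hm' : (0:ℝ) < m := by exact_mod_cast hmp
  -- The `13 × 13` tiles around the transmitter contain the receiver, and the transmitter is in one
  -- of `7 m` tiles.
  set big : ℕ × ℕ → Set Plane := fun t =>
    rect (((t.1:ℝ) - 6) / m) (((t.1:ℝ) + 7) / m) (((t.2:ℝ) - 6) / m) (((t.2:ℝ) + 7) / m) with hbig
  have hbigle : ∀ t, sq.real (big t) ≤ 169 / (m:ℝ) ^ 2 := by
    intro t
    have h1 : volume.real (big t) = 169 / (m : ℝ) ^ 2 := by
      rw [hbig, volume_real_rect]
      · field_simp; ring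
      · gcongr; linarith
      · gcongr; linarith
    rw [← h1]
    refine ENNReal.toReal_mono ?_ (sq_le_volume _)
    rw [hbig, volume_rect]
    exact ENNReal.mul_ne_top ENNReal.ofReal_ne_top ENNReal.ofReal_ne_top
  set N : Set (Fin n → Plane) := {X | ¬ ∀ i, X i ∈ openSquare} with hN
  have hN0 : (nodeLaw n).real N = 0 := by
    rw [Measure.real, ae_iff.1 (ae_forall_mem (n := n) ae_openSquare)]
    rfl
  set T := Finset.Ico (q - 7) q ×ˢ Finset.range m with hT
  have hsub : cutEvent r e ⊆ N ∪ ⋃ t ∈ T, {X | ∀ i ∈ ({e.1, e.2} : Finset (Fin n)),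
      X i ∈ if i = e.1 then tile m t.1 t.2 else big t} := by
    intro X hX
    by_cases hXs : ∀ i, X i ∈ openSquare
    · right
      obtain ⟨h1, h2, -, h3⟩ := hX
      simp only [Set.mem_iUnion, exists_prop]
      refine ⟨(cell m (X e.1) 0, cell m (X e.1) 1), ?_, ?_⟩
      · have e1 := half_le_cell hmq h2
        have e2 := cell_lt_of_dist_le (m := m) hXs hmr (by rwa [dist_comm] at h3) 0
        have e3 := cell_lt_half hmq (hXs e.1) h1 hq
        have e4 := cell_lt hmp (hXs e.1) 1
        simp only [hT, Finset.mem_product, Finset.mem_Ico, Finset.mem_range]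
        omega
      · intro i hi
        simp only [Finset.mem_insert, Finset.mem_singleton] at hi
        rcases hi with rfl | rfl
        · rw [if_pos rfl]
          exact (mem_tile_iff hmp (hXs _)).2 ⟨rfl, rfl⟩
        · rw [if_neg (Ne.symm hne)]
          have key : ∀ c, ((cell m (X e.1) c : ℝ) - 6) / m ≤ X e.2 c ∧
              X e.2 c < ((cell m (X e.1) c : ℝ) + 7) / m := by
            intro c
            have a1 := cell_le_mul (m := m) (hXs e.1) c
            have a2 := mul_lt_cell (m := m) (X e.1) c
            have a3 := abs_le.1 ((abs_sub_le_dist (X e.1) (X e.2) c).trans h3)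
            have a4 : m * (X e.1 c - X e.2 c) ≤ m * r := by gcongr; exact a3.2
            have a5 : m * (-r) ≤ m * (X e.1 c - X e.2 c) := by gcongr; exact a3.1
            rw [div_le_iff₀ hm', lt_div_iff₀ hm']
            constructor <;> nlinarith
          exact ⟨key 0, key 1⟩
    · exact Or.inl hXs
  have hbox : ∀ t, (nodeLaw n).real {X | ∀ i ∈ ({e.1, e.2} : Finset (Fin n)),
      X i ∈ if i = e.1 then tile m t.1 t.2 else big t} ≤ 1 / (m:ℝ) ^ 2 * (169 / (m:ℝ) ^ 2) := by
    intro t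
    rw [nodeLaw_finset_box, Finset.prod_pair hne, if_pos rfl, if_neg (Ne.symm hne)]
    exact mul_le_mul (sq_tile_le hmp _ _) (hbigle t) measureReal_nonneg (by positivity)
  have hTc : (T.card : ℝ) ≤ 7 * m := by
    rw [hT, Finset.card_product, Nat.card_Ico, Finset.card_range]
    have : ((q - (q - 7) : ℕ) : ℝ) ≤ 7 := by exact_mod_cast (by omega : q - (q - 7) ≤ 7)
    push_cast
    gcongr
  have h3 := (measureReal_mono hsub (measure_ne_top (nodeLaw n) _)).trans (measureReal_union_le _ _)
  rw [hN0, zero_add] at h3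
  refine h3.trans ((measureReal_biUnion_finset_le _ _).trans
    ((Finset.sum_le_sum fun t _ => hbox t).trans ?_))
  rw [Finset.sum_const, nsmul_eq_mul]
  calc (T.card : ℝ) * (1 / (m:ℝ) ^ 2 * (169 / (m:ℝ) ^ 2))
      ≤ 7 * m * (1 / (m:ℝ) ^ 2 * (169 / (m:ℝ) ^ 2)) := by gcongr
    _ = 1183 / (m:ℝ) ^ 3 := by field_simp; ring
    -- As `(m r) ^ 3 ≥ 64`, the constant `20` works: `20 * 64 ≥ 1183`.
    _ ≤ 20 * r ^ 3 := by
        rw [div_le_iff₀ (by positivity), mul_assoc, ← mul_pow, mul_comm r]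
        have : (4:ℝ) ^ 3 ≤ (m * r) ^ 3 := by gcongr
        linarith

lemma integral_cutEdges_le (hr : 0 < r) (n : ℕ) :
    ∫ X, (cutEdges X r : ℝ) ∂nodeLaw n ≤ 20 * ((n:ℝ) ^ 2 * r ^ 3) := by
  have h : ∀ e : Fin n × Fin n, (nodeLaw n).real (cutEvent r e) ≤ 20 * r ^ 3 := by
    intro e
    rcases le_total r 1 with h | h
    · exact nodeLaw_cutEvent_le hr h e
    · have : (1:ℝ) ≤ r ^ 3 := one_le_pow₀ h
      have h2 : (nodeLaw n).real (cutEvent r e) ≤ 1 := measureReal_le_one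
      linarith
  rw [integral_cutEdges]
  refine (Finset.sum_le_sum fun e _ => h e).trans_eq ?_
  simp
  ring

/-- The upper bound sums the probabilities of all pairs. The lower bound follows from
`whp_cutEdges_ge` by Markov's inequality, that event having probability at least `1/2` eventually.
-/
theorem isTheta_integral_cutEdges {d : ℕ → ℝ} (hd : ∀ n, 0 < d n)
    (hconn : IsConnectivityRadius d) (hb : BddAbove (Set.range d)) :
    (fun n => ∫ X, (cutEdges X (d n) : ℝ) ∂nodeLaw n)
      =Θ[atTop] fun n : ℕ => (n : ℝ) ^ 2 * d n ^ 3 := by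
  have hnn : ∀ n : ℕ, 0 ≤ (n : ℝ) ^ 2 * d n ^ 3 := fun n => by have := hd n; positivity
  have hnn' : ∀ n : ℕ, 0 ≤ ∫ X, (cutEdges X (d n) : ℝ) ∂nodeLaw n := fun n =>
    integral_nonneg fun X => Nat.cast_nonneg _
  obtain ⟨c, hc, h⟩ := whp_cutEdges_ge hd hconn hb
  constructor
  · refine IsBigO.of_bound 20 (Eventually.of_forall fun n => ?_)
    rw [Real.norm_of_nonneg (hnn n), Real.norm_of_nonneg (hnn' n)]
    exact integral_cutEdges_le (hd n) n
  · refine IsBigO.of_bound (2 / c) ?_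
    have h1 := h.tendsto_one.eventually (lt_mem_nhds (show (1/2 : ENNReal) < 1 by
      rw [one_div]; exact ENNReal.inv_lt_one.2 (by norm_num)))
    filter_upwards [h1] with n h1
    rw [Real.norm_of_nonneg (hnn n), Real.norm_of_nonneg (hnn' n)]
    have h2 := mul_meas_ge_le_integral_of_nonneg (μ := nodeLaw n)
      (f := fun X => (cutEdges X (d n) : ℝ)) (Eventually.of_forall fun X => Nat.cast_nonneg _)
      (integrable_cutEdges n (d n)) (c * ((n : ℝ) ^ 2 * d n ^ 3))
    have h3 : (1:ℝ) / 2 ≤ (nodeLaw n).real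
        {X | c * ((n : ℝ) ^ 2 * d n ^ 3) ≤ (cutEdges X (d n) : ℝ)} := by
      have := ENNReal.toReal_mono (measure_ne_top _ _) h1.le
      simpa [Measure.real] using this
    have h4 : c * ((n : ℝ) ^ 2 * d n ^ 3) * (1 / 2) ≤ ∫ X, (cutEdges X (d n) : ℝ) ∂nodeLaw n :=
      (mul_le_mul_of_nonneg_left h3 (mul_nonneg hc.le (hnn n))).trans h2
    rw [div_mul_eq_mul_div, le_div_iff₀ hc]
    linarith

end Expectation

/-! ### The number of beams at the radius of order `n ^ (-1/3)` -/

section Beams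

/-- The tiles contain about as many nodes as the disks if the radius is of order
`n ^ (-1/3)`. -/
theorem whp_beams {d : ℕ → ℝ} (hd : ∀ n, 0 < d n) {c C : ℝ} (hc : 0 < c)
    (h₁ : ∀ᶠ n : ℕ in atTop, c * (n : ℝ) ^ (-(1 / 3) : ℝ) ≤ d n)
    (h₂ : ∀ᶠ n : ℕ in atTop, d n ≤ C * (n : ℝ) ^ (-(1 / 3) : ℝ)) :
    Whp nodeLaw fun n X => ∀ i, c ^ 2 / 288 * (n : ℝ) ^ (1 / 3 : ℝ) ≤ (beams X (d n) i : ℝ) ∧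
      (beams X (d n) i : ℝ) ≤ 400 * C ^ 2 * (n : ℝ) ^ (1 / 3 : ℝ) := by
  set m : ℕ → ℕ := fun n => mesh 1 (d n) with hm
  have hmp : ∀ n, 0 < m n := fun n => mesh_pos one_pos (hd n)
  have hsmall : ∀ᶠ n in atTop, ((1:ℕ):ℝ) * d n ≤ 2 := by
    have h0 : Tendsto (fun n : ℕ => C * (n : ℝ) ^ (-(1 / 3) : ℝ)) atTop (𝓝 0) :=
      tendsto_const_mul_rpow (by norm_num)
    filter_upwards [h0.eventually (gt_mem_nhds (show (0:ℝ) < 2 by norm_num)), h₂] with n h1 h2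
    push_cast
    linarith
  have hpow : ∀ n : ℕ, 0 < n → (n:ℝ) * ((n : ℝ) ^ (-(1 / 3) : ℝ)) ^ 2 = (n:ℝ) ^ (1 / 3 : ℝ) := by
    intro n hn
    have hn' : (0:ℝ) < n := by exact_mod_cast hn
    rw [← Real.rpow_natCast ((n:ℝ) ^ _), ← Real.rpow_mul hn'.le]
    calc (n:ℝ) * (n:ℝ) ^ (-(1 / 3) * ((2:ℕ):ℝ) : ℝ)
        = (n:ℝ) ^ (1:ℝ) * (n:ℝ) ^ (-(1 / 3) * ((2:ℕ):ℝ) : ℝ) := by rw [Real.rpow_one]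
      _ = _ := by rw [← Real.rpow_add hn']; norm_num
  have hlow : ∀ᶠ n : ℕ in atTop, c ^ 2 / 36 * (n:ℝ) ^ (1 / 3 : ℝ) ≤ n / (m n : ℝ) ^ 2 := by
    filter_upwards [eventually_gt_atTop 0, hsmall, h₁] with n hn h1 h2
    have h3 := le_div_mesh_sq one_pos (hd n) h1 n
    refine le_trans ?_ h3
    rw [← hpow n hn]
    calc c ^ 2 / 36 * (n * ((n : ℝ) ^ (-(1 / 3) : ℝ)) ^ 2)
        = n * (c * (n : ℝ) ^ (-(1 / 3) : ℝ)) ^ 2 / 36 := by ring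
      _ ≤ _ := by gcongr
  have hlog : ∀ᶠ n : ℕ in atTop, Real.log n ≤ 1 / 12 * (n / (m n : ℝ) ^ 2) := by
    filter_upwards [hlow, eventually_log_le (c := c ^ 2 / 432) (s := 1 / 3) (by positivity)
      (by norm_num)] with n h1 h2
    linarith
  -- The node itself is not a beam; `a ≥ 8` ensures `a / 4 - 1 ≥ a / 8`, which yields the constant
  -- `c ^ 2 / (36 * 8)`.
  have hlarge : ∀ᶠ n : ℕ in atTop, 8 ≤ n / (m n : ℝ) ^ 2 := by
    filter_upwards [hlog, (Real.tendsto_log_atTop.comp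
      tendsto_natCast_atTop_atTop).eventually_ge_atTop 1] with n h1 h2
    simp only [Function.comp] at h2
    linarith
  have hup := whp_tilesUpper (Eventually.of_forall hmp) hlog
  have hwin := whp_windowsGood (k := 1) 1 (by norm_num) (Eventually.of_forall hmp) hlog
  refine ((hup.and hwin).and (whp_of_ae (G := fun n X => ∀ i, X i ∈ openSquare)
    (Eventually.of_forall fun n => ae_forall_mem ae_openSquare))).mono ?_
  filter_upwards [eventually_gt_atTop 0, hsmall, hlow, hlarge, h₂] with n hn h1 hlow hlarge h₂
  rintro X ⟨⟨hu, hw⟩, hX⟩ i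
  have hdn := hd n
  have hmn := hmp n
  have hmr : m n * d n ≤ 6 := mesh_mul_le one_pos hdn h1
  have hmr' : 4 ≤ m n * d n := mesh_mul_ge one_pos hdn
  have hm' : (0:ℝ) < m n := by exact_mod_cast hmn
  have hale : n / (m n : ℝ) ^ 2 ≤ n * d n ^ 2 / 16 := div_mesh_sq_le one_pos hdn n
  have hbeam : beams X (d n) i
      = ((Finset.univ.filter fun j => dist (X i) (X j) ≤ d n).erase i).card := by
    rw [beams, ← Set.ncard_coe_finset]
    congr 1
    ext j
    simp [and_comm]
  have hi : i ∈ Finset.univ.filter fun j => dist (X i) (X j) ≤ d n := by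
    simp [hdn.le]
  rw [hbeam, Finset.card_erase_of_mem hi]
  constructor
  · set a := cell (m n) (X i) 0
    set b := cell (m n) (X i) 1
    have ha := cell_lt hmn (hX i) 0
    have hb := cell_lt hmn (hX i) 1
    obtain ⟨t, ht, ht'⟩ := hw a ha b hb {(a, b)} (by simp) (by simp) (by simp [a, b, ha, hb])
    rw [Finset.mem_singleton] at ht
    subst ht
    have hsub : tileNodes X (m n) a b ⊆ Finset.univ.filter fun j => dist (X i) (X j) ≤ d n := by
      intro j hj
      rw [mem_tileNodes hmn hX] at hj
      simp only [Finset.mem_filter, Finset.mem_univ, true_and]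
      have h0 := abs_coord_sub_le (i := i) (j := j) (k := 0) (d := 0) hmn hX (by omega) (by omega)
      have h1 := abs_coord_sub_le (i := i) (j := j) (k := 1) (d := 0) hmn hX (by omega) (by omega)
      refine (dist_le_add _ _).trans ((add_le_add h0 h1).trans ?_)
      rw [← add_div, div_le_iff₀ hm']
      push_cast
      linarith
    have h2 : (cnt X (tile (m n) a b) : ℝ)
        ≤ ((Finset.univ.filter fun j => dist (X i) (X j) ≤ d n).card : ℝ) :=
      Nat.cast_le.2 (Finset.card_le_card hsub)
    rw [Nat.cast_sub (Finset.card_pos.2 ⟨i, hi⟩), Nat.cast_one]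
    simp only at ht'
    linarith
  · have h3 := card_dist_le hmn hX hmr hu i
    have h4 : ((((Finset.univ.filter fun j => dist (X i) (X j) ≤ d n).card - 1 : ℕ)) : ℝ)
        ≤ ((Finset.univ.filter fun j => dist (X i) (X j) ≤ d n).card : ℝ) :=
      Nat.cast_le.2 (Nat.sub_le _ _)
    have h5 : n * d n ^ 2 ≤ C ^ 2 * (n:ℝ) ^ (1 / 3 : ℝ) := by
      rw [← hpow n hn]
      calc n * d n ^ 2 ≤ n * (C * (n : ℝ) ^ (-(1 / 3) : ℝ)) ^ 2 := by gcongr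
        _ = _ := by ring
    have h6 : 0 ≤ (n:ℝ) * d n ^ 2 := by positivity
    linarith

end Beams

/-! ### Orders of the radius and of the throughput -/

section Asymptotics

lemma mul_rpow_neg_third_cube {n : ℕ} (hn : 0 < n) :
    (n : ℝ) * ((n : ℝ) ^ (-(1 / 3) : ℝ)) ^ 3 = 1 := by
  have hn' : (0:ℝ) < n := by exact_mod_cast hn
  rw [← Real.rpow_natCast ((n:ℝ) ^ _), ← Real.rpow_mul hn'.le]
  norm_num
  rw [Real.rpow_neg_one]
  field_simp

lemma mul_sqrt_log_div_cube {n : ℕ} (hn : 0 < n) :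
    (n : ℝ) * √(Real.log n / n) ^ 3 = Real.log n ^ (3 / 2 : ℝ) / √n := by
  have hn' : (0:ℝ) < n := by exact_mod_cast hn
  have hs : 0 < √(n:ℝ) := Real.sqrt_pos.2 hn'
  have h1 : Real.log n ^ (3 / 2 : ℝ) = √(Real.log n) ^ 3 := by
    rw [Real.sqrt_eq_rpow, ← Real.rpow_natCast, ← Real.rpow_mul (Real.log_natCast_nonneg n)]
    norm_num
  rw [h1, Real.sqrt_div' _ hn'.le, div_pow]
  have h2 : √(n:ℝ) ^ 3 = n * √(n:ℝ) := by rw [pow_succ, Real.sq_sqrt hn'.le]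
  rw [h2]
  field_simp

lemma SupportsRate.mono {n : ℕ} {X : Fin n → Plane} {r r' l l' : ℝ} (h : SupportsRate X r l)
    (hr : r ≤ r') (hl : l' ≤ l) : SupportsRate X r' l' := fun _ hs σ hσ cap hcap =>
  (mul_le_mul_of_nonneg_left hl hcap).trans (h (hr.trans hs) σ hσ cap hcap)

/-- Every connectivity radius supports the rate that belongs to the minimal order. -/
theorem whp_supportsRate_log {d : ℕ → ℝ} (hd : ∀ n, 0 < d n) (hconn : IsConnectivityRadius d) :
    ∃ c > 0, Whp nodeLaw fun n X => SupportsRate X (d n)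
      (c * (Real.log n ^ (3 / 2 : ℝ) / √n)) := by
  obtain ⟨ξ, hξ, h⟩ := hconn
  have hlog : Tendsto (fun n : ℕ => Real.log n) atTop atTop :=
    Real.tendsto_log_atTop.comp tendsto_natCast_atTop_atTop
  -- Truncation replaces `ξ` by `min ξ (log n)`, which still tends to infinity, so `r` is a
  -- connectivity radius of minimal order below `d`. For `n ≤ 1` the square root vanishes, and `d n`
  -- keeps `r` positive.
  set r : ℕ → ℝ := fun n =>
    if n ≤ 1 then d n else min (d n) (√(2 * Real.log n / (Real.pi * n))) with hr
  have hr0 : ∀ n, 0 < r n := by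
    intro n
    simp only [hr]
    split_ifs with hn
    · exact hd n
    · have h1 : 0 < Real.log n := Real.log_pos (by exact_mod_cast not_le.1 hn)
      have h2 : (0:ℝ) < n := by exact_mod_cast (by omega : 0 < n)
      have := Real.pi_pos
      exact lt_min (hd n) (Real.sqrt_pos.2 (by positivity))
  have hrd : ∀ n, r n ≤ d n := by
    intro n
    simp only [hr]
    split_ifs
    exacts [le_rfl, min_le_left _ _]
  have hξ' : Tendsto (fun n => min (ξ n) (Real.log n)) atTop atTop := by
    rw [tendsto_atTop]
    intro b
    filter_upwards [hξ.eventually_ge_atTop b, hlog.eventually_ge_atTop b] with n h1 h2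
    exact le_min h1 h2
  have hrξ : ∀ᶠ n : ℕ in atTop,
      Real.pi * r n ^ 2 * n = Real.log n + min (ξ n) (Real.log n) := by
    filter_upwards [eventually_gt_atTop 1] with n hn
    have h2 : (0:ℝ) < n := by exact_mod_cast (by omega : 0 < n)
    have hp := Real.pi_pos
    have e1 := h n (by omega)
    rw [eq_div_iff h2.ne'] at e1
    have e2 : Real.pi * √(2 * Real.log n / (Real.pi * n)) ^ 2 * n = 2 * Real.log n := by
      rw [Real.sq_sqrt (div_nonneg (by have := Real.log_natCast_nonneg n; linarith)
        (by positivity))]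
      field_simp
    have e3 : r n = min (d n) (√(2 * Real.log n / (Real.pi * n))) := by
      simp only [hr]; rw [if_neg (by omega)]
    rw [e3]
    rcases le_total (d n) (√(2 * Real.log n / (Real.pi * n))) with hle | hle
    · have h3 : Real.pi * d n ^ 2 * n ≤ 2 * Real.log n := by
        rw [← e2]; have := hd n; gcongr
      rw [min_eq_left hle, e1, min_eq_left (by linarith)]
    · have h3 : 2 * Real.log n ≤ Real.pi * d n ^ 2 * n := by
        rw [← e2]; gcongr
      rw [min_eq_right hle, e2, min_eq_right (by linarith)]
      ring
  obtain ⟨c, hc, hw⟩ := whp_supportsRate_connectivity hr0 hrξ hξ'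
    (Eventually.of_forall fun n => min_le_right _ _)
  refine ⟨c / 8, by positivity, hw.mono ?_⟩
  filter_upwards [hrξ, hξ'.eventually_ge_atTop 0, eventually_gt_atTop 0] with n h1 h2 hn X hX
  refine hX.mono (hrd n) ?_
  have hn' : (0:ℝ) < n := by exact_mod_cast hn
  rw [← mul_sqrt_log_div_cube hn]
  have h3 : √(Real.log n / n) / 2 ≤ r n := by
    refine (sq_le_sq₀ (by positivity) (hr0 n).le).1 ?_
    rw [div_pow, Real.sq_sqrt (div_nonneg (Real.log_natCast_nonneg n) hn'.le), div_div,
      div_le_iff₀ (by positivity)]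
    have := Real.pi_le_four
    have h4 : 0 ≤ r n ^ 2 * n := by positivity
    nlinarith
  calc c / 8 * (n * √(Real.log n / n) ^ 3) = c * (n * (√(Real.log n / n) / 2) ^ 3) := by ring
    _ ≤ _ := by gcongr

lemma eventually_le_of_isBigO {f g : ℕ → ℝ} (h : f =O[atTop] g) (hf : ∀ n, 0 ≤ f n)
    (hg : ∀ n, 0 ≤ g n) : ∃ C > 0, ∀ᶠ n in atTop, f n ≤ C * g n := by
  obtain ⟨C, hC, hb⟩ := h.exists_pos
  refine ⟨C, hC, ?_⟩
  filter_upwards [hb.bound] with n hn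
  rwa [Real.norm_of_nonneg (hf n), Real.norm_of_nonneg (hg n)] at hn

lemma isBigO_of_eventually_le {f g : ℕ → ℝ} {C : ℝ} (h : ∀ᶠ n in atTop, f n ≤ C * g n)
    (hf : ∀ n, 0 ≤ f n) (hg : ∀ n, 0 ≤ g n) : f =O[atTop] g := by
  refine IsBigO.of_bound C ?_
  filter_upwards [h] with n hn
  rwa [Real.norm_of_nonneg (hf n), Real.norm_of_nonneg (hg n)]

section Throughput

variable {cap : ℝ} {d : ℕ → ℝ}

lemma whp_totalThroughput_ge (hcap : 0 < cap) {c : ℝ} (hc : 0 < c)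
    (h : ∀ᶠ n : ℕ in atTop, c * (n : ℝ) ^ (-(1 / 3) : ℝ) ≤ d n) :
    Whp networkLaw fun n ω => cap * (c ^ 3 / 100000) * n ≤ totalThroughput d cap n ω := by
  refine (whp_supportsRate_cbrt hc).network.mono ?_
  filter_upwards [h] with n hn
  rintro ω ⟨hσ, hX⟩
  rw [totalThroughput, mul_comm]
  exact mul_le_mul_of_nonneg_left (hX hn ω.2 hσ cap hcap.le) (Nat.cast_nonneg n)

lemma whp_totalThroughput_le (hcap : 0 < cap) (hd : ∀ n, 0 < d n)
    (hconn : IsConnectivityRadius d) {C : ℝ}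
    (h : ∀ᶠ n : ℕ in atTop, d n ≤ C * (n : ℝ) ^ (-(1 / 3) : ℝ)) :
    ∃ c₂ > 0, Whp networkLaw fun n ω => totalThroughput d cap n ω ≤ c₂ * n := by
  obtain ⟨C₀, hC₀, hw⟩ := whp_throughput_le hd hconn
  have hC : 0 < C := by
    obtain ⟨n, hn, hn'⟩ := (h.and (eventually_gt_atTop 0)).exists
    have h1 : (0:ℝ) < n := by exact_mod_cast hn'
    have h2 : 0 < (n : ℝ) ^ (-(1 / 3) : ℝ) := by positivity
    by_contra! hcon
    have h3 : C * (n : ℝ) ^ (-(1 / 3) : ℝ) ≤ 0 := mul_nonpos_of_nonpos_of_nonneg hcon h2.le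
    linarith [hd n]
  refine ⟨cap * (C₀ * C ^ 3), by positivity, (hw cap hcap.le).mono ?_⟩
  filter_upwards [h, eventually_gt_atTop 0] with n hn hn' ω hω
  have hdn := hd n
  have h1 : n * d n ^ 3 ≤ C ^ 3 := by
    calc n * d n ^ 3 ≤ n * (C * (n : ℝ) ^ (-(1 / 3) : ℝ)) ^ 3 := by gcongr
      _ = C ^ 3 * (n * ((n : ℝ) ^ (-(1 / 3) : ℝ)) ^ 3) := by ring
      _ = C ^ 3 := by rw [mul_rpow_neg_third_cube hn', mul_one]
  rw [totalThroughput, mul_comm]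
  refine mul_le_mul_of_nonneg_right (hω.trans ?_) (Nat.cast_nonneg n)
  gcongr

/-- For large `n` some configuration satisfies both the assumed lower bound and `whp_throughput_le`,
so `c ≤ cap * C * n d ^ 3`. This is a deterministic statement about `d n`. -/
lemma OmegaWHP.isBigO (hcap : 0 < cap) (hd : ∀ n, 0 < d n) (hconn : IsConnectivityRadius d)
    (h : OmegaWHP networkLaw (totalThroughput d cap) fun n => (n : ℝ)) :
    (fun n : ℕ => (n : ℝ) ^ (-(1 / 3) : ℝ)) =O[atTop] d := by
  obtain ⟨c, hc, hlim⟩ := h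
  obtain ⟨C, hC, hw⟩ := whp_throughput_le hd hconn
  -- A substitute for the cube root of `cap * C / c`: the maximum with `1` is at most its own cube.
  obtain ⟨s, hs, hs3⟩ : ∃ s : ℝ, 0 < s ∧ cap * C ≤ s ^ 3 * c := by
    refine ⟨max 1 (cap * C / c), by positivity, ?_⟩
    have h1 : cap * C / c ≤ max 1 (cap * C / c) := le_max_right _ _
    have h2 : 1 ≤ max 1 (cap * C / c) := le_max_left _ _
    set s := max 1 (cap * C / c)
    rw [div_le_iff₀ hc] at h1
    have h3 : s ≤ s ^ 3 := le_self_pow₀ h2 (by norm_num)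
    nlinarith
  refine isBigO_of_eventually_le (C := s) ?_ (fun n => by positivity) fun n => (hd n).le
  filter_upwards [(hw cap hcap.le).eventually_exists hlim, eventually_gt_atTop 0] with n hn hn'
  obtain ⟨ω, hω, hω'⟩ := hn
  have h1 : (0:ℝ) < n := by exact_mod_cast hn'
  have hdn := hd n
  rw [totalThroughput, mul_comm] at hω
  have h2 := (le_of_mul_le_mul_left hω h1).trans hω'
  have h3 : c * 1 ≤ c * (n * (s * d n) ^ 3) := by
    calc c * 1 ≤ cap * (C * (n * d n ^ 3)) := by linarith
      _ = cap * C * (n * d n ^ 3) := by ring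
      _ ≤ s ^ 3 * c * (n * d n ^ 3) := by gcongr
      _ = _ := by ring
  have h4 := le_of_mul_le_mul_left h3 hc
  rw [← mul_rpow_neg_third_cube hn'] at h4
  exact le_of_pow_le_pow_left₀ (n := 3) (by norm_num) (by positivity) (le_of_mul_le_mul_left h4 h1)

/-- For `K` large, the rate supported at `K n ^ (-1/3)` exceeds `c₂`. Since `SupportsRate` covers
all larger radii at once, any single large `n` with `d n > K n ^ (-1/3)` is contradictory; no
subsequence argument is needed. -/
lemma isBigO_of_totalThroughput_le (hcap : 0 < cap) (hd : ∀ n, 0 < d n) {c₂ : ℝ} (hc₂ : 0 < c₂)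
    {E : ∀ n, Set ((Fin n → Plane) × Equiv.Perm (Fin n))}
    (hE : ∀ n, ∀ ω ∈ E n, totalThroughput d cap n ω ≤ c₂ * n)
    (hlim : Tendsto (fun n => networkLaw n (E n)) atTop (𝓝 1)) :
    d =O[atTop] fun n : ℕ => (n : ℝ) ^ (-(1 / 3) : ℝ) := by
  obtain ⟨K, hK, hK3⟩ : ∃ K : ℝ, 0 < K ∧ c₂ < cap * (K ^ 3 / 100000) := by
    refine ⟨1 + 100000 * c₂ / cap, by positivity, ?_⟩
    set K := 1 + 100000 * c₂ / cap with hK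
    have h2 : 1 ≤ K := by rw [hK]; have : 0 ≤ 100000 * c₂ / cap := by positivity
                          linarith
    have h3 : K ≤ K ^ 3 := le_self_pow₀ h2 (by norm_num)
    have h4 : cap * K = cap + 100000 * c₂ := by rw [hK]; field_simp
    nlinarith
  refine isBigO_of_eventually_le (C := K) ?_ (fun n => (hd n).le) fun n => by positivity
  filter_upwards [(whp_supportsRate_cbrt hK).network.eventually_exists hlim,
    eventually_gt_atTop 0] with n hn hn'
  obtain ⟨ω, hω, hσ, hX⟩ := hn
  have h1 : (0:ℝ) < n := by exact_mod_cast hn'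
  by_contra! hcon
  have h2 := hX hcon.le ω.2 hσ cap hcap.le
  have h3 := hE n ω hω
  rw [totalThroughput, mul_comm] at h3
  linarith [le_of_mul_le_mul_right h3 h1]

lemma ThetaWHP.omegaWHP {Y : ∀ n, (Fin n → Plane) × Equiv.Perm (Fin n) → ℝ} {g : ℕ → ℝ}
    (h : ThetaWHP networkLaw Y g) : OmegaWHP networkLaw Y g := by
  obtain ⟨c₁, h₁, c₂, -, hlim⟩ := h
  refine ⟨c₁, h₁, tendsto_of_tendsto_of_tendsto_of_le_of_le' hlim tendsto_const_nhds
    (Eventually.of_forall fun n => measure_mono fun ω hω => hω.1) ?_⟩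
  filter_upwards [eventually_ge_atTop 2] with n hn
  have := isProbabilityMeasure_networkLaw hn
  exact prob_le_one

lemma ThetaWHP.isTheta (hcap : 0 < cap) (hd : ∀ n, 0 < d n) (hconn : IsConnectivityRadius d)
    (h : ThetaWHP networkLaw (totalThroughput d cap) fun n => (n : ℝ)) :
    d =Θ[atTop] fun n : ℕ => (n : ℝ) ^ (-(1 / 3) : ℝ) := by
  refine ⟨?_, h.omegaWHP.isBigO hcap hd hconn⟩
  obtain ⟨c₁, -, c₂, h₂, hlim⟩ := h
  exact isBigO_of_totalThroughput_le hcap hd h₂ (fun n ω hω => hω.2) hlim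

lemma whp_throughput_minimal (hcap : 0 < cap) (hd : ∀ n, 0 < d n)
    (hconn : IsConnectivityRadius d) (hmin : d =O[atTop] fun n : ℕ => √(Real.log n / n)) :
    ∃ c₁ > 0, ∃ c₂ > 0, Whp networkLaw fun n ω =>
      c₁ * (Real.log n ^ (3 / 2 : ℝ) / √n) ≤ throughput ω.1 (d n) ω.2 cap ∧
        throughput ω.1 (d n) ω.2 cap ≤ c₂ * (Real.log n ^ (3 / 2 : ℝ) / √n) := by
  obtain ⟨c, hc, h1⟩ := whp_supportsRate_log hd hconn
  obtain ⟨C, hC, h2⟩ := whp_throughput_le hd hconn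
  obtain ⟨K, hK, h3⟩ := eventually_le_of_isBigO hmin (fun n => (hd n).le)
    fun n => Real.sqrt_nonneg _
  refine ⟨cap * c, by positivity, cap * (C * K ^ 3), by positivity,
    (h1.network.and (h2 cap hcap.le)).mono ?_⟩
  filter_upwards [h3, eventually_gt_atTop 0] with n h3 hn
  rintro ω ⟨⟨hσ, hX⟩, hle⟩
  have hdn := hd n
  refine ⟨?_, hle.trans ?_⟩
  · rw [mul_assoc]
    exact hX le_rfl ω.2 hσ cap hcap.le
  · rw [← mul_sqrt_log_div_cube hn]
    calc cap * (C * (n * d n ^ 3)) ≤ cap * (C * (n * (K * √(Real.log n / n)) ^ 3)) := by gcongr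
      _ = _ := by ring

lemma thetaWHP_throughput_minimal (hcap : 0 < cap) (hd : ∀ n, 0 < d n)
    (hconn : IsConnectivityRadius d) (hmin : d =O[atTop] fun n : ℕ => √(Real.log n / n)) :
    ThetaWHP networkLaw (fun n ω => throughput ω.1 (d n) ω.2 cap)
      fun n => Real.log n ^ (3 / 2 : ℝ) / √n := by
  obtain ⟨c₁, h₁, c₂, h₂, h⟩ := whp_throughput_minimal hcap hd hconn hmin
  exact ⟨c₁, h₁, c₂, h₂, h.tendsto_one_network⟩

end Throughput

end Asymptotics

end BeamNetwork

end

theorem mainTheorem5 (cap : ℝ) (hcap : 0 < cap) (d : ℕ → ℝ) (hd : ∀ n, 0 < d n)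
    (hconn : BeamNetwork.IsConnectivityRadius d) :
    -- the number of edges across the cut, on average and with probability tending to one
    (BddAbove (Set.range d) →
      ((fun n => ∫ X, (BeamNetwork.cutEdges X (d n) : ℝ) ∂(BeamNetwork.nodeLaw n))
          =Θ[atTop] fun n : ℕ => (n : ℝ) ^ 2 * d n ^ 3) ∧
      BeamNetwork.ThetaWHP BeamNetwork.nodeLaw
        (fun n X => (BeamNetwork.cutEdges X (d n) : ℝ))
        (fun n => (n : ℝ) ^ 2 * d n ^ 3)) ∧
    -- throughput per node at a connectivity radius of minimal order
    ((d =O[atTop] fun n : ℕ => √(Real.log n / n)) →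
      BeamNetwork.ThetaWHP BeamNetwork.networkLaw
        (fun n ω => BeamNetwork.throughput ω.1 (d n) ω.2 cap)
        (fun n => Real.log n ^ (3 / 2 : ℝ) / √n)) ∧
    -- linear total throughput
    (BeamNetwork.ThetaWHP BeamNetwork.networkLaw (BeamNetwork.totalThroughput d cap)
        (fun n => (n : ℝ)) ↔
      d =Θ[atTop] fun n : ℕ => (n : ℝ) ^ (-(1 / 3) : ℝ)) ∧
    -- the order of this radius is the least one for which the total throughput is at least linear
    (BeamNetwork.OmegaWHP BeamNetwork.networkLaw (BeamNetwork.totalThroughput d cap)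
        (fun n => (n : ℝ)) ↔
      (fun n : ℕ => (n : ℝ) ^ (-(1 / 3) : ℝ)) =O[atTop] d) ∧
    -- the number of beams of every node when the total throughput is linear
    (BeamNetwork.ThetaWHP BeamNetwork.networkLaw (BeamNetwork.totalThroughput d cap)
        (fun n => (n : ℝ)) →
      ∃ c₁ > 0, ∃ c₂ > 0, Tendsto (fun n => BeamNetwork.nodeLaw n
        {X | ∀ i, c₁ * (n : ℝ) ^ (1 / 3 : ℝ) ≤ (BeamNetwork.beams X (d n) i : ℝ) ∧
          (BeamNetwork.beams X (d n) i : ℝ) ≤ c₂ * (n : ℝ) ^ (1 / 3 : ℝ)}) atTop (𝓝 1)) := by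
  have hpos : ∀ n : ℕ, 0 ≤ (n : ℝ) ^ (-(1 / 3) : ℝ) := fun n => by positivity
  refine ⟨fun hb => ⟨BeamNetwork.isTheta_integral_cutEdges hd hconn hb, ?_⟩, fun hmin => ?_,
    ⟨fun h => h.isTheta hcap hd hconn, fun h => ?_⟩,
    ⟨fun h => h.isBigO hcap hd hconn, fun h => ?_⟩, fun h => ?_⟩
  · obtain ⟨c, hc, h1⟩ := BeamNetwork.whp_cutEdges_ge hd hconn hb
    obtain ⟨C, hC, h2⟩ := BeamNetwork.whp_cutEdges_le hd hconn
    exact ⟨c, hc, C, hC, (h1.and h2).tendsto_one⟩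
  · exact BeamNetwork.thetaWHP_throughput_minimal hcap hd hconn hmin
  · obtain ⟨C, hC, h1⟩ := BeamNetwork.eventually_le_of_isBigO h.1 (fun n => (hd n).le) hpos
    obtain ⟨c, hc, h2⟩ := BeamNetwork.eventually_le_of_isBigO h.2 hpos (fun n => (hd n).le)
    obtain ⟨c₂, hc₂, h3⟩ := BeamNetwork.whp_totalThroughput_le hcap hd hconn h1
    have h4 := BeamNetwork.whp_totalThroughput_ge (c := 1 / c) (d := d) hcap (by positivity)
      (h2.mono fun n hn => by rw [one_div, inv_mul_le_iff₀ hc]; exact hn)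
    exact ⟨_, by positivity, c₂, hc₂, (h4.and h3).tendsto_one_network⟩
  · obtain ⟨c, hc, h2⟩ := BeamNetwork.eventually_le_of_isBigO h hpos (fun n => (hd n).le)
    have h4 := BeamNetwork.whp_totalThroughput_ge (c := 1 / c) (d := d) hcap (by positivity)
      (h2.mono fun n hn => by rw [one_div, inv_mul_le_iff₀ hc]; exact hn)
    exact ⟨_, by positivity, h4.tendsto_one_network⟩
  · have hT := h.isTheta hcap hd hconn
    obtain ⟨C, hC, h1⟩ := BeamNetwork.eventually_le_of_isBigO hT.1 (fun n => (hd n).le) hpos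
    obtain ⟨c, hc, h2⟩ := BeamNetwork.eventually_le_of_isBigO hT.2 hpos (fun n => (hd n).le)
    exact ⟨(1 / c) ^ 2 / 288, by positivity, 400 * C ^ 2, by positivity,
      (BeamNetwork.whp_beams hd (c := 1 / c) (by positivity)
        (h2.mono fun n hn => by rw [one_div, inv_mul_le_iff₀ hc]; exact hn) h1).tendsto_one⟩
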